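/- Let $n\ge 1$ be an integer and let $(\mathcal D,\Sigma,\pentagon)$ be an $(n+2)$-angulated category in the sense of Geiss–Keller–Oppermann: $\mathcal D$ is an additive category, $\Sigma\colon\mathcal D\to\mathcal D$ is an additive automorphism (or, more generally, an additive autoequivalence), and $\pentagon$ is the class of $(n+2)$-angles $X_0\to X_1\to\cdots\to X_{n+1}\to\Sigma X_0$. Let $\mathcal B\subset\mathcal D$ be an additive subcategory, i.e. a full subcategory which is closed under isomorphisms, contains $0$ and is closed under binary biproducts (closure under direct summands is not required). Suppose that $\mathcal B$ is $n$-extension closed: for all $A,C\in\mathcal B$ and all $\delta\in\mathcal D(C,\Sigma A)$ there is an $(n+2)$-angle $$A\xrightarrow{d_0}X_1\xrightarrow{d_1}\cdots\xrightarrow{d_{n-1}}X_n\xrightarrow{d_n}C\xrightarrow{\delta}\Sigma A\qquad(\ast)$$ in $\pentagon$ with $X_1,\dots,X_n\in\mathcal B$. Let $\mathbb G_{\mathcal B}\colon\mathcal B^{\mathrm{op}}\times\mathcal B\to\mathsf{Ab}$ be the restriction of the bifunctor $\mathcal D(-,\Sigma-)$ to $\mathcal B^{\mathrm{op}}\times\mathcal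 B$. For $A,C\in\mathcal B$ and $\delta\in\mathbb G_{\mathcal B}(C,A)=\mathcal D(C,\Sigma A)$ let $\mathfrak r_{\mathcal B}(\delta)$ be the homotopy equivalence class, in the category of complexes $A\to Y_1\to\cdots\to Y_n\to C$ in $\mathcal B$ with fixed ends $A$ and $C$ (and morphisms that are the identity on both ends), of the complex $A\to X_1\to\cdots\to X_n\to C$ obtained from an $(n+2)$-angle $(\ast)$ with $X_1,\dots,X_n\in\mathcal B$. Then $\mathfrak r_{\mathcal B}(\delta)$ does not depend on the chosen $(n+2)$-angle, and $(\mathcal B,\mathbb G_{\mathcal B},\mathfrak r_{\mathcal B})$ is an $n$-exangulated category in the sense of Herschend–Liu–Nakaoka: $\mathcal B$ is additive, $\mathbb G_{\mathcal B}$ is biadditive, $\mathfrak r_{\mathcal B}$ is an exact realisation of $\mathbb G_{\mathcal B}$, $\mathfrak r_{\mathcal B}$-inflations and $\mathfrak r_{\mathcal B}$-deflations are each closed under composition (EA1, EA1$^{\mathrm{op}}$), and the axioms (EA2) and (EA2$^{\mathrm{op}}$) on the existence of good lifts hold. -/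

import Mathlib

open CategoryTheory CategoryTheory.Limits Opposite

universe w v u

namespace NExang

/-! ### Biproducts, sequences of morphisms and complexes -/

section Sequences

variable {D : Type u} [Category.{v} D]

/-- The diagram `X ⇄ Z ⇄ Y` is a biproduct diagram, i.e. `Z = X ⊕ Y`. -/
structure IsBiproduct [Preadditive D] {X Y Z : D} (inl : X ⟶ Z) (inr : Y ⟶ Z) (fst : Z ⟶ X)
    (snd : Z ⟶ Y) : Prop where
  inl_fst : inl ≫ fst = 𝟙 X
  inl_snd : inl ≫ snd = 0
  inr_fst : inr ≫ fst = 0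
  inr_snd : inr ≫ snd = 𝟙 Y
  total : fst ≫ inl + snd ≫ inr = 𝟙 Z

variable (D) in
/-- A sequence of composable morphisms `X_0 ⟶ X_1 ⟶ ⋯ ⟶ X_n ⟶ X_{n+1}` with `n + 2` objects. -/
structure Seq (n : ℕ) where
  /-- the object `X_i`, for `0 ≤ i ≤ n + 1` -/
  obj : ∀ i : ℕ, i ≤ n + 1 → D
  /-- the morphism `d_i : X_i ⟶ X_{i+1}`, for `0 ≤ i ≤ n` -/
  d : ∀ (i : ℕ) (hi : i ≤ n), obj i (by omega) ⟶ obj (i + 1) (by omega)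

namespace Seq

variable {n : ℕ}

/-- Consecutive morphisms compose to zero. -/
def IsComplex [HasZeroMorphisms D] (X : Seq D n) : Prop :=
  ∀ (i : ℕ) (hi : i + 1 ≤ n), X.d i (by omega) ≫ X.d (i + 1) hi = 0

/-- Morphisms of sequences. -/
structure Hom (X Y : Seq D n) where
  f : ∀ (i : ℕ) (hi : i ≤ n + 1), X.obj i hi ⟶ Y.obj i hi
  comm : ∀ (i : ℕ) (hi : i ≤ n),
    X.d i hi ≫ f (i + 1) (by omega) = f i (by omega) ≫ Y.d i hi

/-- The identity morphism of a sequence. -/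
def Hom.id (X : Seq D n) : Hom X X where
  f _ _ := 𝟙 _
  comm i hi := by simp

/-- Composition of morphisms of sequences. -/
def Hom.comp {X Y Z : Seq D n} (φ : Hom X Y) (ψ : Hom Y Z) : Hom X Z where
  f i hi := φ.f i hi ≫ ψ.f i hi
  comm i hi := by
    rw [← Category.assoc, φ.comm, Category.assoc, ψ.comm, Category.assoc]

/-- `φ - ψ` is zero homotopic as a morphism of complexes concentrated in degrees `0, …, n + 1`. -/
def Homotopic [Preadditive D] {X Y : Seq D n} (φ ψ : Hom X Y) : Prop :=
  ∃ h : ∀ (i : ℕ) (hi : i ≤ n), X.obj (i + 1) (Nat.succ_le_succ hi) ⟶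
      Y.obj i (Nat.le_succ_of_le hi),
    (φ.f 0 (Nat.zero_le _) - ψ.f 0 (Nat.zero_le _) =
      X.d 0 (Nat.zero_le _) ≫ h 0 (Nat.zero_le _)) ∧
    (∀ (i : ℕ) (hi : i + 1 ≤ n),
      φ.f (i + 1) (Nat.le_succ_of_le hi) - ψ.f (i + 1) (Nat.le_succ_of_le hi) =
        X.d (i + 1) hi ≫ h (i + 1) hi + h i (Nat.le_of_lt hi) ≫ Y.d i (Nat.le_of_lt hi)) ∧
    (φ.f (n + 1) le_rfl - ψ.f (n + 1) le_rfl = h n le_rfl ≫ Y.d n le_rfl)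

/-- The image of a sequence under a functor. -/
def mapSeq {D' : Type*} [Category* D'] (F : D ⥤ D') (X : Seq D n) : Seq D' n where
  obj i hi := F.obj (X.obj i hi)
  d i hi := F.map (X.d i hi)

end Seq

/-- Complexes `X_0 ⟶ ⋯ ⟶ X_{n+1}` with ends `A` and `C`. The identifications `X_0 = A` and
`X_{n+1} = C` are recorded as isomorphisms; the ones for which they are identities form an
equivalent subcategory, so this gives the same homotopy classes. -/
structure Cplx [HasZeroMorphisms D] (n : ℕ) (A C : D) extends Seq D n where
  isComplex : toSeq.IsComplex
  left : obj 0 (Nat.zero_le _) ≅ A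
  right : obj (n + 1) le_rfl ≅ C

namespace Cplx

variable [Preadditive D] {n : ℕ}

/-- The first differential `d_0`, as a morphism `A ⟶ X_1`. -/
def dFirst {A C : D} (X : Cplx n A C) : A ⟶ X.obj 1 (by omega) :=
  X.left.inv ≫ X.d 0 (by omega)

/-- The last differential `d_n`, as a morphism `X_n ⟶ C`. -/
def dLast {A C : D} (X : Cplx n A C) : X.obj n (by omega) ⟶ C :=
  X.d n le_rfl ≫ X.right.hom

/-- The morphism of complexes `φ` satisfies `φ_0 = a` and `φ_{n+1} = c`. -/
structure IsLift {A B C E : D} {X : Cplx n A C} {Y : Cplx n B E} (φ : X.toSeq.Hom Y.toSeq)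
    (a : A ⟶ B) (c : C ⟶ E) : Prop where
  left : φ.f 0 (by omega) ≫ Y.left.hom = X.left.hom ≫ a
  right : φ.f (n + 1) le_rfl ≫ Y.right.hom = X.right.hom ≫ c

/-- Homotopy equivalence in the category of complexes with fixed ends `A` and `C`, whose morphisms
are the identity on both ends. -/
def HomotopyEquivalent {A C : D} (X Y : Cplx n A C) : Prop :=
  ∃ (φ : X.toSeq.Hom Y.toSeq) (ψ : Y.toSeq.Hom X.toSeq),
    IsLift φ (𝟙 A) (𝟙 C) ∧ IsLift ψ (𝟙 A) (𝟙 C) ∧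
    Seq.Homotopic (φ.comp ψ) (Seq.Hom.id X.toSeq) ∧
    Seq.Homotopic (ψ.comp φ) (Seq.Hom.id Y.toSeq)

/-- `X` is (isomorphic to) the complex `A = A ⟶ 0 ⟶ ⋯ ⟶ 0`. -/
structure IsTrivFirst {A C : D} (X : Cplx n A C) : Prop where
  isIso : IsIso (X.d 0 (by omega))
  isZero : ∀ (i : ℕ) (hi : i ≤ n + 1), 2 ≤ i → IsZero (X.obj i hi)

/-- `X` is (isomorphic to) the complex `0 ⟶ ⋯ ⟶ 0 ⟶ C = C`. -/
structure IsTrivLast {A C : D} (X : Cplx n A C) : Prop where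
  isIso : IsIso (X.d n le_rfl)
  isZero : ∀ (i : ℕ) (hi : i < n), IsZero (X.obj i (by omega))

/-- For a morphism `φ : X ⟶ Y` of complexes that is the identity on the common first object, the
structure of a mapping cone of `φ` on the complex `M`: one has `M_0 = X_1`,
`M_i = X_{i+1} ⊕ Y_i` for `1 ≤ i ≤ n` and `M_{n+1} = Y_{n+1}`, and the differentials are the
matrices `[-d_1; φ_1]`, `[-d_{i+1}, 0; φ_{i+1}, d_i]` and `[φ_{n+1}, d_n]`.
The morphism `inl i` is the inclusion `X_{i+1} ⟶ M_i` for `0 ≤ i ≤ n`, and `inr i` is the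
inclusion `Y_{i+1} ⟶ M_{i+1}` for `0 ≤ i ≤ n`. -/
structure ConeData {A C C' : D} {X : Cplx n A C} {Y : Cplx n A C'} (φ : X.toSeq.Hom Y.toSeq)
    (M : Cplx n (X.obj 1 (by omega)) C') where
  inl : ∀ (i : ℕ) (hi : i ≤ n), X.obj (i + 1) (by omega) ⟶ M.obj i (by omega)
  inr : ∀ (i : ℕ) (hi : i ≤ n), Y.obj (i + 1) (by omega) ⟶ M.obj (i + 1) (by omega)
  inl_zero : inl 0 (by omega) = M.left.inv
  inr_last : inr n le_rfl = Y.right.hom ≫ M.right.inv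
  biproduct : ∀ (i : ℕ) (hi : i + 1 ≤ n),
    ∃ (fst : M.obj (i + 1) (Nat.le_succ_of_le hi) ⟶ X.obj (i + 2) (Nat.succ_le_succ hi))
      (snd : M.obj (i + 1) (Nat.le_succ_of_le hi) ⟶ Y.obj (i + 1) (Nat.le_succ_of_le hi)),
      IsBiproduct (inl (i + 1) hi) (inr i (Nat.le_of_lt hi)) fst snd
  inl_d : ∀ (i : ℕ) (hi : i + 1 ≤ n), inl i (by omega) ≫ M.d i (by omega) =
    -(X.d (i + 1) hi ≫ inl (i + 1) hi) +
      φ.f (i + 1) (Nat.le_succ_of_le hi) ≫ inr i (Nat.le_of_lt hi)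
  inl_d_last : inl n le_rfl ≫ M.d n le_rfl = φ.f (n + 1) le_rfl ≫ inr n le_rfl
  inr_d : ∀ (i : ℕ) (hi : i + 1 ≤ n),
    inr i (by omega) ≫ M.d (i + 1) hi = Y.d (i + 1) hi ≫ inr (i + 1) hi

/-- For a morphism `φ : X ⟶ Y` of complexes that is the identity on the common last object, the
structure of a mapping cocone of `φ` on the complex `N`: one has `N_0 = X_0`,
`N_i = X_i ⊕ Y_{i-1}` for `1 ≤ i ≤ n` and `N_{n+1} = Y_n`, and the differentials are the
matrices `[d_0; φ_0]`, `[d_i, 0; φ_i, -d_{i-1}]` and `[φ_n, -d_{n-1}]`.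
The morphism `fst i` is the projection `N_i ⟶ X_i` for `0 ≤ i ≤ n`, and `snd i` is the
projection `N_{i+1} ⟶ Y_i` for `0 ≤ i ≤ n`. -/
structure CoconeData {A B C : D} {X : Cplx n A C} {Y : Cplx n B C} (φ : X.toSeq.Hom Y.toSeq)
    (N : Cplx n A (Y.obj n (by omega))) where
  fst : ∀ (i : ℕ) (hi : i ≤ n), N.obj i (by omega) ⟶ X.obj i (by omega)
  snd : ∀ (i : ℕ) (hi : i ≤ n), N.obj (i + 1) (by omega) ⟶ Y.obj i (by omega)
  fst_zero : fst 0 (by omega) = N.left.hom ≫ X.left.inv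
  snd_last : snd n le_rfl = N.right.hom
  biproduct : ∀ (i : ℕ) (hi : i + 1 ≤ n),
    ∃ (inl : X.obj (i + 1) (Nat.le_succ_of_le hi) ⟶ N.obj (i + 1) (Nat.le_succ_of_le hi))
      (inr : Y.obj i (Nat.le_of_lt (Nat.le_succ_of_le hi)) ⟶
        N.obj (i + 1) (Nat.le_succ_of_le hi)),
      IsBiproduct inl inr (fst (i + 1) hi) (snd i (Nat.le_of_lt hi))
  d_fst : ∀ (i : ℕ) (hi : i + 1 ≤ n),
    N.d i (by omega) ≫ fst (i + 1) hi = fst i (by omega) ≫ X.d i (by omega)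
  d_snd_zero : N.d 0 (by omega) ≫ snd 0 (by omega) = fst 0 (by omega) ≫ φ.f 0 (by omega)
  d_snd : ∀ (i : ℕ) (hi : i + 1 ≤ n), N.d (i + 1) hi ≫ snd (i + 1) hi =
    fst (i + 1) hi ≫ φ.f (i + 1) (Nat.le_succ_of_le hi) -
      snd i (Nat.le_of_lt hi) ≫ Y.d i (Nat.le_of_lt hi)

end Cplx

end Sequences

/-! ### `n`-exangulated categories -/

section Exangulated

variable {D : Type u} [Category.{v} D]

/-- The set `G(C, A)` of `G`-extensions, for a functor `G : Dᵒᵖ × D ⥤ Ab` (in curried form). -/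
abbrev Ext (G : Dᵒᵖ ⥤ D ⥤ AddCommGrpCat.{w}) (C A : D) : Type w := (G.obj (op C)).obj A

/-- `a_* δ = G(C, a)(δ)`. -/
def push (G : Dᵒᵖ ⥤ D ⥤ AddCommGrpCat.{w}) {A B C : D} (a : A ⟶ B) (δ : Ext G C A) : Ext G C B :=
  (G.obj (op C)).map a δ

/-- `c^* δ = G(c, A)(δ)`. -/
def pull (G : Dᵒᵖ ⥤ D ⥤ AddCommGrpCat.{w}) {A C E : D} (c : E ⟶ C) (δ : Ext G C A) : Ext G E A :=
  (G.map c.op).app A δ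

variable [Preadditive D]

/-- The pair `⟨X, δ⟩` is an `n`-exangle: it is an attached complex, and for all `T` the sequences
`D(T, X_0) ⟶ ⋯ ⟶ D(T, X_{n+1}) ⟶ G(T, A)` and `D(X_{n+1}, T) ⟶ ⋯ ⟶ D(X_0, T) ⟶ G(C, T)`
are exact. -/
structure IsExangle (G : Dᵒᵖ ⥤ D ⥤ AddCommGrpCat.{w}) {n : ℕ} {A C : D} (X : Cplx n A C)
    (δ : Ext G C A) : Prop where
  push_eq_zero : push G X.dFirst δ = 0
  pull_eq_zero : pull G X.dLast δ = 0
  exact_cov : ∀ (T : D) (i : ℕ) (hi : i + 1 ≤ n), Function.Exact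
    (fun g : T ⟶ X.obj i (by omega) => g ≫ X.d i (by omega))
    (fun g : T ⟶ X.obj (i + 1) (by omega) => g ≫ X.d (i + 1) hi)
  exact_cov_last : ∀ T : D, Function.Exact
    (fun g : T ⟶ X.obj n (by omega) => g ≫ X.d n le_rfl)
    (fun g : T ⟶ X.obj (n + 1) le_rfl => pull G (g ≫ X.right.hom) δ)
  exact_contra : ∀ (T : D) (i : ℕ) (hi : i + 1 ≤ n), Function.Exact
    (fun g : X.obj (i + 2) (by omega) ⟶ T => X.d (i + 1) hi ≫ g)
    (fun g : X.obj (i + 1) (by omega) ⟶ T => X.d i (by omega) ≫ g)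
  exact_contra_last : ∀ T : D, Function.Exact
    (fun g : X.obj 1 (by omega) ⟶ T => X.d 0 (by omega) ≫ g)
    (fun g : X.obj 0 (by omega) ⟶ T => push G (X.left.inv ≫ g) δ)

/-- The type of families of sets of complexes `r(δ)`, where `r(δ)` consists of complexes with ends
`A` and `C` for `δ ∈ G(C, A)`; `r δ X` means `X ∈ r(δ)`. -/
abbrev Realization (n : ℕ) (G : Dᵒᵖ ⥤ D ⥤ AddCommGrpCat.{w}) :=
  ∀ ⦃A C : D⦄, Ext G C A → Cplx n A C → Prop

/-- `r` is an exact realisation of `G`. -/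
structure IsExactRealization {n : ℕ} (G : Dᵒᵖ ⥤ D ⥤ AddCommGrpCat.{w}) (r : Realization n G) :
    Prop where
  /-- every `r(δ)` is a homotopy equivalence class -/
  isClass : ∀ ⦃A C : D⦄ (δ : Ext G C A), ∃ X : Cplx n A C, ∀ Y : Cplx n A C,
    r δ Y ↔ X.HomotopyEquivalent Y
  /-- morphisms of extensions lift to morphisms of complexes -/
  exists_lift : ∀ ⦃A B C E : D⦄ (δ : Ext G C A) (ρ : Ext G E B) (X : Cplx n A C) (Y : Cplx n B E),
    r δ X → r ρ Y → ∀ (a : A ⟶ B) (c : C ⟶ E), push G a δ = pull G c ρ →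
      ∃ φ : X.toSeq.Hom Y.toSeq, Cplx.IsLift φ a c
  /-- realisations are `n`-exangles -/
  isExangle : ∀ ⦃A C : D⦄ (δ : Ext G C A) (X : Cplx n A C), r δ X → IsExangle G X δ
  /-- `r(0) = [A = A ⟶ 0 ⟶ ⋯ ⟶ 0]` for `0 ∈ G(0, A)` -/
  triv_first : ∀ ⦃A Z : D⦄, IsZero Z → ∀ X : Cplx n A Z, X.IsTrivFirst → r (0 : Ext G Z A) X
  /-- `r(0) = [0 ⟶ ⋯ ⟶ 0 ⟶ C = C]` for `0 ∈ G(C, 0)` -/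
  triv_last : ∀ ⦃Z C : D⦄, IsZero Z → ∀ X : Cplx n Z C, X.IsTrivLast → r (0 : Ext G C Z) X

/-- `f` is an `r`-inflation: it is the first morphism of an `r`-conflation. -/
def IsInflation {n : ℕ} {G : Dᵒᵖ ⥤ D ⥤ AddCommGrpCat.{w}} (r : Realization n G) {A B : D}
    (f : A ⟶ B) : Prop :=
  ∃ (C : D) (δ : Ext G C A) (X : Cplx n A C) (e : X.obj 1 (by omega) ≅ B),
    r δ X ∧ X.dFirst ≫ e.hom = f

/-- `f` is an `r`-deflation: it is the last morphism of an `r`-conflation. -/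
def IsDeflation {n : ℕ} {G : Dᵒᵖ ⥤ D ⥤ AddCommGrpCat.{w}} (r : Realization n G) {B C : D}
    (f : B ⟶ C) : Prop :=
  ∃ (A : D) (δ : Ext G C A) (X : Cplx n A C) (e : X.obj n (by omega) ≅ B),
    r δ X ∧ e.inv ≫ X.dLast = f

/-- `(D, G, r)` is an `n`-exangulated category. -/
structure IsNExangulated (n : ℕ) (G : Dᵒᵖ ⥤ D ⥤ AddCommGrpCat.{w}) (r : Realization n G) :
    Prop where
  /-- `D` is an additive category -/
  additive : HasFiniteBiproducts D
  /-- `G` is additive in its contravariant argument -/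
  biadditive_left : G.Additive
  /-- `G` is additive in its covariant argument -/
  biadditive_right : ∀ C : Dᵒᵖ, (G.obj C).Additive
  exactRealization : IsExactRealization G r
  /-- (EA1) -/
  inflation_comp : ∀ ⦃X Y Z : D⦄ (f : X ⟶ Y) (g : Y ⟶ Z),
    IsInflation r f → IsInflation r g → IsInflation r (f ≫ g)
  /-- (EA1ᵒᵖ) -/
  deflation_comp : ∀ ⦃X Y Z : D⦄ (f : X ⟶ Y) (g : Y ⟶ Z),
    IsDeflation r f → IsDeflation r g → IsDeflation r (f ≫ g)
  /-- (EA2) -/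
  good_lift : ∀ ⦃A C C' : D⦄ (c : C ⟶ C') (ρ : Ext G C' A) (X : Cplx n A C) (Y : Cplx n A C'),
    r (pull G c ρ) X → r ρ Y →
      ∃ φ : X.toSeq.Hom Y.toSeq, Cplx.IsLift φ (𝟙 A) c ∧
        ∃ M : Cplx n (X.obj 1 (by omega)) C',
          Nonempty (Cplx.ConeData φ M) ∧ r (push G X.dFirst ρ) M
  /-- (EA2ᵒᵖ) -/
  good_lift_op : ∀ ⦃A B C : D⦄ (a : A ⟶ B) (δ : Ext G C A) (X : Cplx n A C) (Y : Cplx n B C),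
    r δ X → r (push G a δ) Y →
      ∃ φ : X.toSeq.Hom Y.toSeq, Cplx.IsLift φ a (𝟙 C) ∧
        ∃ N : Cplx n A (Y.obj n (by omega)),
          Nonempty (Cplx.CoconeData φ N) ∧ r (pull G Y.dLast δ) N

end Exangulated

/-! ### `(n + 2)`-angulated categories -/

section Angulated

variable {D : Type u} [Category.{v} D]

/-- An `(n + 2)`-`S`-sequence `X_0 ⟶ X_1 ⟶ ⋯ ⟶ X_{n+1} ⟶ S X_0`. -/
structure SuspSeq (S : D ⥤ D) (n : ℕ) extends Seq D n where
  δ : obj (n + 1) le_rfl ⟶ S.obj (obj 0 (Nat.zero_le _))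

namespace SuspSeq

variable {S : D ⥤ D} {n : ℕ}

/-- Morphisms of `(n + 2)`-`S`-sequences. -/
structure Hom (X Y : SuspSeq S n) extends Seq.Hom X.toSeq Y.toSeq where
  comm_δ : X.δ ≫ S.map (f 0 (Nat.zero_le _)) = f (n + 1) le_rfl ≫ Y.δ

/-- `X` is (isomorphic to) the trivial sequence `A = A ⟶ 0 ⟶ ⋯ ⟶ 0 ⟶ S A`. -/
structure IsTrivial (X : SuspSeq S n) : Prop where
  isIso : IsIso (X.d 0 (by omega))
  isZero : ∀ (i : ℕ) (hi : i ≤ n + 1), 2 ≤ i → IsZero (X.obj i hi)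

variable [Preadditive D]

/-- `Z` is a direct sum of `X` and `Y` in the category of `(n + 2)`-`S`-sequences. -/
def IsDirectSum (X Y Z : SuspSeq S n) : Prop :=
  ∃ (inl : Hom X Z) (inr : Hom Y Z), ∀ (i : ℕ) (hi : i ≤ n + 1),
    ∃ fst snd, IsBiproduct (inl.f i hi) (inr.f i hi) fst snd

/-- An isomorphism of `Y` with the left rotation
`X_1 ⟶ X_2 ⟶ ⋯ ⟶ X_{n+1} ⟶ S X_0 ⟶ S X_1` of `X`, whose last morphism is `(-1)^(n+2) S(d_0)`. -/
structure RotationData (X Y : SuspSeq S n) where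
  e : ∀ (i : ℕ) (hi : i ≤ n), Y.obj i (by omega) ≅ X.obj (i + 1) (by omega)
  eLast : Y.obj (n + 1) le_rfl ≅ S.obj (X.obj 0 (by omega))
  comm : ∀ (i : ℕ) (hi : i + 1 ≤ n),
    Y.d i (by omega) ≫ (e (i + 1) hi).hom = (e i (by omega)).hom ≫ X.d (i + 1) hi
  comm_last : Y.d n le_rfl ≫ eLast.hom = (e n le_rfl).hom ≫ X.δ
  comm_δ : Y.δ ≫ S.map (e 0 (by omega)).hom =
    eLast.hom ≫ ((-1 : ℤ) ^ (n + 2) • S.map (X.d 0 (by omega)))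

/-- The structure of a cone of a morphism `φ : X ⟶ Y` of `(n + 2)`-`S`-sequences on `M`: one has
`M_i = X_{i+1} ⊕ Y_i` for `i ≤ n`, `M_{n+1} = S X_0 ⊕ Y_{n+1}`, and the morphisms are given by the
matrices `[-d_{i+1}, 0; φ_{i+1}, d_i]`, `[-δ, 0; φ_{n+1}, d_n]` and `[-S d_0, 0; S φ_0, δ]`. -/
structure ConeData {X Y : SuspSeq S n} (φ : Hom X Y) (M : SuspSeq S n) where
  inl : ∀ (i : ℕ) (hi : i ≤ n), X.obj (i + 1) (by omega) ⟶ M.obj i (by omega)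
  inlLast : S.obj (X.obj 0 (by omega)) ⟶ M.obj (n + 1) le_rfl
  inr : ∀ (i : ℕ) (hi : i ≤ n + 1), Y.obj i hi ⟶ M.obj i hi
  biproduct : ∀ (i : ℕ) (hi : i ≤ n),
    ∃ (fst : M.obj i (Nat.le_succ_of_le hi) ⟶ X.obj (i + 1) (Nat.succ_le_succ hi))
      (snd : M.obj i (Nat.le_succ_of_le hi) ⟶ Y.obj i (Nat.le_succ_of_le hi)),
      IsBiproduct (inl i hi) (inr i (Nat.le_succ_of_le hi)) fst snd
  biproduct_last : ∃ fst snd, IsBiproduct inlLast (inr (n + 1) le_rfl) fst snd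
  inl_d : ∀ (i : ℕ) (hi : i + 1 ≤ n), inl i (by omega) ≫ M.d i (by omega) =
    -(X.d (i + 1) hi ≫ inl (i + 1) hi) +
      φ.f (i + 1) (Nat.le_succ_of_le hi) ≫ inr (i + 1) (Nat.le_succ_of_le hi)
  inl_d_last : inl n le_rfl ≫ M.d n le_rfl =
    -(X.δ ≫ inlLast) + φ.f (n + 1) le_rfl ≫ inr (n + 1) le_rfl
  inr_d : ∀ (i : ℕ) (hi : i ≤ n),
    inr i (by omega) ≫ M.d i hi = Y.d i hi ≫ inr (i + 1) (by omega)
  inlLast_δ : inlLast ≫ M.δ =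
    -(S.map (X.d 0 (Nat.zero_le _)) ≫ S.map (inl 0 (Nat.zero_le _))) +
      S.map (φ.f 0 (Nat.zero_le _)) ≫ S.map (inr 0 (Nat.zero_le _))
  inr_δ : inr (n + 1) le_rfl ≫ M.δ = Y.δ ≫ S.map (inr 0 (by omega))

end SuspSeq

/-- `(D, S, pent)` is an `(n + 2)`-angulated category in the sense of Geiss, Keller and
Oppermann, for an additive category `D` with suspension `S`; the elements of `pent` are the
`(n + 2)`-angles. -/
structure IsAngulated [Preadditive D] (n : ℕ) (S : D ⥤ D) (pent : Set (SuspSeq S n)) : Prop where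
  /-- closure under direct sums -/
  directSum : ∀ X Y Z : SuspSeq S n, SuspSeq.IsDirectSum X Y Z → X ∈ pent → Y ∈ pent → Z ∈ pent
  /-- closure under direct summands -/
  summand : ∀ X Y Z : SuspSeq S n, SuspSeq.IsDirectSum X Y Z → Z ∈ pent → X ∈ pent ∧ Y ∈ pent
  trivial : ∀ X : SuspSeq S n, X.IsTrivial → X ∈ pent
  /-- every morphism is the first morphism of an `(n + 2)`-angle -/
  exists_angle : ∀ ⦃A B : D⦄ (f : A ⟶ B), ∃ X ∈ pent,
    ∃ (e₀ : X.obj 0 (by omega) ≅ A) (e₁ : X.obj 1 (by omega) ≅ B),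
      X.d 0 (by omega) ≫ e₁.hom = e₀.hom ≫ f
  rotate : ∀ X Y : SuspSeq S n, Nonempty (SuspSeq.RotationData X Y) → (X ∈ pent ↔ Y ∈ pent)
  /-- commutative squares extend to morphisms of `(n + 2)`-angles -/
  complete : ∀ X ∈ pent, ∀ Y ∈ pent, ∀ (φ₀ : X.obj 0 (by omega) ⟶ Y.obj 0 (by omega))
    (φ₁ : X.obj 1 (by omega) ⟶ Y.obj 1 (by omega)),
    X.d 0 (by omega) ≫ φ₁ = φ₀ ≫ Y.d 0 (by omega) →
      ∃ φ : SuspSeq.Hom X Y, φ.f 0 (by omega) = φ₀ ∧ φ.f 1 (by omega) = φ₁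
  /-- the extension can be chosen such that its cone is an `(n + 2)`-angle -/
  complete_cone : ∀ X ∈ pent, ∀ Y ∈ pent, ∀ (φ₀ : X.obj 0 (by omega) ⟶ Y.obj 0 (by omega))
    (φ₁ : X.obj 1 (by omega) ⟶ Y.obj 1 (by omega)),
    X.d 0 (by omega) ≫ φ₁ = φ₀ ≫ Y.d 0 (by omega) →
      ∃ φ : SuspSeq.Hom X Y, φ.f 0 (by omega) = φ₀ ∧ φ.f 1 (by omega) = φ₁ ∧
        ∃ M ∈ pent, Nonempty (SuspSeq.ConeData φ M)

end Angulated

/-! ### `n`-extension closed subcategories and the induced structure -/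

section Subcategory

variable {D : Type u} [Category.{v} D] [Preadditive D]

/-- The full subcategory on the objects satisfying `P` is an additive subcategory: it is closed
under isomorphisms, contains the zero objects and is closed under binary biproducts. -/
structure IsAdditiveSubcategory (P : ObjectProperty D) : Prop where
  iso : ∀ ⦃X Y : D⦄, (X ≅ Y) → P X → P Y
  zero : ∀ ⦃Z : D⦄, IsZero Z → P Z
  biprod : ∀ ⦃X Y Z : D⦄ (inl : X ⟶ Z) (inr : Y ⟶ Z) (fst : Z ⟶ X) (snd : Z ⟶ Y),
    IsBiproduct inl inr fst snd → P X → P Y → P Z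

/-- `P` is `n`-extension closed: every `δ : C ⟶ S A` with `A` and `C` in `P` is the last morphism
of an `(n + 2)`-angle `A ⟶ X_1 ⟶ ⋯ ⟶ X_n ⟶ C ⟶ S A` with `X_1, …, X_n` in `P`. -/
def IsNExtensionClosed {S : D ⥤ D} {n : ℕ} (pent : Set (SuspSeq S n)) (P : ObjectProperty D) :
    Prop :=
  ∀ ⦃A C : D⦄, P A → P C → ∀ δ : C ⟶ S.obj A, ∃ X ∈ pent,
    (∀ (i : ℕ) (hi : i ≤ n + 1), P (X.obj i hi)) ∧
    ∃ (e₀ : X.obj 0 (by omega) ≅ A) (e₁ : X.obj (n + 1) le_rfl ≅ C),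
      X.δ ≫ S.map e₀.hom = e₁.hom ≫ δ

/-- The functor `D(-, S -) : Dᵒᵖ × D ⥤ Ab`. -/
def homSusp (S : D ⥤ D) : Dᵒᵖ ⥤ D ⥤ AddCommGrpCat.{v} where
  obj C :=
    { obj := fun A => AddCommGrpCat.of (C.unop ⟶ S.obj A)
      map := fun a => AddCommGrpCat.ofHom
        { toFun := fun δ => δ ≫ S.map a
          map_zero' := zero_comp
          map_add' := fun _ _ => Preadditive.add_comp _ _ _ _ _ _ }
      map_id := fun A => by ext δ; simp
      map_comp := fun a b => by ext δ; simp }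
  map c :=
    { app := fun A => AddCommGrpCat.ofHom
        { toFun := fun δ => c.unop ≫ δ
          map_zero' := comp_zero
          map_add' := fun _ _ => Preadditive.comp_add _ _ _ _ _ _ }
      naturality := fun A B a => by ext δ; simp }
  map_id C := by ext A δ; simp
  map_comp c c' := by ext A δ; simp

/-- The restriction of `D(-, S -)` to the full subcategory defined by `P`. -/
def restrictedHomSusp (S : D ⥤ D) (P : ObjectProperty D) :
    P.FullSubcategoryᵒᵖ ⥤ P.FullSubcategory ⥤ AddCommGrpCat.{v} :=
  P.ι.op ⋙ homSusp S ⋙ (Functor.whiskeringLeft _ _ _).obj P.ι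

/-- For a complex `A ⟶ X_1 ⟶ ⋯ ⟶ X_n ⟶ C` in the full subcategory defined by `P` and
`δ : C ⟶ S A`, the sequence `A ⟶ X_1 ⟶ ⋯ ⟶ X_n ⟶ C ⟶ S A` in `D`. -/
def toSuspSeq {S : D ⥤ D} {P : ObjectProperty D} {n : ℕ} {A C : P.FullSubcategory}
    (X : Cplx n A C) (δ : C.obj ⟶ S.obj A.obj) : SuspSeq S n where
  toSeq := X.toSeq.mapSeq P.ι
  δ := P.ι.map X.right.hom ≫ δ ≫ S.map (P.ι.map X.left.inv)

/-- The realisation on the full subcategory defined by `P` sending `δ : C ⟶ S A` to the homotopy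
class, in this subcategory, of the complexes `A ⟶ X_1 ⟶ ⋯ ⟶ X_n ⟶ C` with terms in `P` that are
completed by `δ` to an `(n + 2)`-angle. All angles are used instead of a chosen one, so that the
independence of the choice is the assertion that this set is a single homotopy class. -/
def inducedRealization {S : D ⥤ D} {n : ℕ} (pent : Set (SuspSeq S n)) (P : ObjectProperty D) :
    Realization n (restrictedHomSusp S P) :=
  fun A C (δ : C.obj ⟶ S.obj A.obj) Y =>
    ∃ X : Cplx n A C, toSuspSeq X δ ∈ pent ∧ X.HomotopyEquivalent Y

end Subcategory

end NExang

/-!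
# Extension closed subcategories of `(n + 2)`-angulated categories are `n`-exangulated

Everything rests on the long exact sequences of an `(n + 2)`-angle: `D(T, -)` and `D(-, T)` are
exact on it (`IsAngulated.isHomExact`, `IsAngulated.isHomExact_last`, `IsAngulated.isHomExact_δ`).
They come from comparing an angle with trivial angles and rotating.

*The realization.* By the rotated completion axiom, a morphism of extensions lifts to a morphism of
angles with prescribed components at both ends, and with a cone in `pent`
(`IsAngulated.complete_ends_cone`). If two angles with fixed ends `A` and `C` realize the same `δ`,
there are such lifts `φ` and `ψ` of the identities in both directions. The difference
`α = φ ψ - 1` need not be null homotopic, but `α²` is (`Seq.exists_homotopy_sq`), which is enough to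
correct `ψ` to a homotopy inverse of `φ` (`Cplx.homotopyEquivalent_of_lifts`). Conversely, a complex
homotopy equivalent to an angle, with fixed ends, is a direct summand of the sum of that angle with
rotated trivial angles, hence an angle (`IsAngulated.mem_of_homotopy_retract`). So the complexes in
the class of `δ` are exactly the angles with terms in `P` and extension `δ`
(`IsAngulated.inducedRealization_iff`). This gives the independence of choices, and makes all the
axioms statements about angles.

*Good lifts.* The cone of a lift with an invertible component at one end contains a contractible
summand coming from that component. Splitting it off (`IsAngulated.exists_restriction_two`) leaves
an angle with terms in `P`, which is the mapping cone or cocone that (EA2) and its dual ask for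
(`IsAngulated.exists_angleCocone`, `IsAngulated.exists_angleCone`).

*Composition.* The third term of an arbitrary angle on the composition `f ≫ g` of two inflations
need not lie in `P`, and for `n ≥ 2` angles are not determined by their first morphism, so (EA1)
needs an indirect argument. First, `f ≫ g` composed with a suitable `z` is an inflation
(`IsAngulated.exists_isAngleInflation_comp_comp`): realize an extension chosen such that the exact
sequences let `f ≫ g` divide its first morphism. If `n ≥ 2`, the first factor of an inflation is an
inflation (`IsAngulated.isAngleInflation_of_comp`): a mapping cocone starts with
`(f ≫ g, f) : A ⟶ C ⊕ B`, and the superfluous summand `C` is removed from degree `1` by means of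
a trivial angle `C = C` in degrees `2` and `3`. If `n = 1` there is no room for the latter, but a
triangle is determined by its first morphism, and the octahedral argument identifies its third term
with an object of `P` (`IsAngulated.isAngleInflation_comp_of_triangulated`). Deflations are treated
dually; the axioms of `IsAngulated` are not symmetric in form under passage to the opposite
category, so the dual statements are proved separately.
-/

namespace NExang

/-! ### Biproduct diagrams -/

section Biproducts

variable {D : Type u} [Category.{v} D] [Preadditive D]

theorem IsBiproduct.map {D' : Type*} [Category* D'] [Preadditive D'] (F : D ⥤ D') [F.Additive]
    {X Y Z : D} {inl : X ⟶ Z} {inr : Y ⟶ Z} {fst : Z ⟶ X} {snd : Z ⟶ Y}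
    (h : IsBiproduct inl inr fst snd) :
    IsBiproduct (F.map inl) (F.map inr) (F.map fst) (F.map snd) where
  inl_fst := by rw [← F.map_comp, h.inl_fst, F.map_id]
  inl_snd := by rw [← F.map_comp, h.inl_snd, F.map_zero]
  inr_fst := by rw [← F.map_comp, h.inr_fst, F.map_zero]
  inr_snd := by rw [← F.map_comp, h.inr_snd, F.map_id]
  total := by simp only [← F.map_comp, ← F.map_add, h.total, F.map_id]

theorem IsBiproduct.hom_ext {X Y Z T : D} {inl : X ⟶ Z} {inr : Y ⟶ Z} {fst : Z ⟶ X}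
    {snd : Z ⟶ Y} (h : IsBiproduct inl inr fst snd) {f g : Z ⟶ T}
    (h₁ : inl ≫ f = inl ≫ g) (h₂ : inr ≫ f = inr ≫ g) : f = g := by
  rw [← Category.id_comp f, ← Category.id_comp g, ← h.total]
  simp [h₁, h₂]

theorem IsBiproduct.hom_ext_to {X Y Z T : D} {inl : X ⟶ Z} {inr : Y ⟶ Z} {fst : Z ⟶ X}
    {snd : Z ⟶ Y} (h : IsBiproduct inl inr fst snd) {f g : T ⟶ Z}
    (h₁ : f ≫ fst = g ≫ fst) (h₂ : f ≫ snd = g ≫ snd) : f = g := by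
  rw [← Category.comp_id f, ← Category.comp_id g, ← h.total]
  simp only [Preadditive.comp_add, ← Category.assoc, h₁, h₂]

theorem isBiproduct_biprod [HasBinaryBiproducts D] (X Y : D) :
    IsBiproduct (biprod.inl : X ⟶ X ⊞ Y) biprod.inr biprod.fst biprod.snd where
  inl_fst := by simp
  inl_snd := by simp
  inr_fst := by simp
  inr_snd := by simp
  total := biprod.total

theorem IsBiproduct.precomp {X Y Z X' Y' : D} {inl : X ⟶ Z} {inr : Y ⟶ Z} {fst : Z ⟶ X}
    {snd : Z ⟶ Y} (h : IsBiproduct inl inr fst snd) (e : X' ≅ X) (f : Y' ≅ Y) :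
    IsBiproduct (e.hom ≫ inl) (f.hom ≫ inr) (fst ≫ e.inv) (snd ≫ f.inv) where
  inl_fst := by simp [reassoc_of% h.inl_fst]
  inl_snd := by simp [reassoc_of% h.inl_snd]
  inr_fst := by simp [reassoc_of% h.inr_fst]
  inr_snd := by simp [reassoc_of% h.inr_snd]
  total := by simp [h.total]

theorem IsBiproduct.symm {X Y Z : D} {inl : X ⟶ Z} {inr : Y ⟶ Z} {fst : Z ⟶ X} {snd : Z ⟶ Y}
    (h : IsBiproduct inl inr fst snd) : IsBiproduct inr inl snd fst :=
  ⟨h.inr_snd, h.inr_fst, h.inl_snd, h.inl_fst, (add_comm _ _).trans h.total⟩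

/-- Comparison isomorphism between two biproducts of isomorphic objects. -/
@[simps]
def IsBiproduct.iso {X Y Z X' Y' Z' : D} {inl : X ⟶ Z} {inr : Y ⟶ Z} {fst : Z ⟶ X} {snd : Z ⟶ Y}
    (h : IsBiproduct inl inr fst snd) {inl' : X' ⟶ Z'} {inr' : Y' ⟶ Z'} {fst' : Z' ⟶ X'}
    {snd' : Z' ⟶ Y'} (h' : IsBiproduct inl' inr' fst' snd') (e : X ≅ X') (f : Y ≅ Y') :
    Z ≅ Z' where
  hom := fst ≫ e.hom ≫ inl' + snd ≫ f.hom ≫ inr'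
  inv := fst' ≫ e.inv ≫ inl + snd' ≫ f.inv ≫ inr
  hom_inv_id := by
    apply h.hom_ext
    · simp [reassoc_of% h.inl_fst, reassoc_of% h.inl_snd, reassoc_of% h'.inl_fst,
        reassoc_of% h'.inl_snd]
    · simp [reassoc_of% h.inr_fst, reassoc_of% h.inr_snd, reassoc_of% h'.inr_fst,
        reassoc_of% h'.inr_snd]
  inv_hom_id := by
    apply h'.hom_ext
    · simp [reassoc_of% h.inl_fst, reassoc_of% h.inl_snd, reassoc_of% h'.inl_fst,
        reassoc_of% h'.inl_snd]
    · simp [reassoc_of% h.inr_fst, reassoc_of% h.inr_snd, reassoc_of% h'.inr_fst,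
        reassoc_of% h'.inr_snd]

end Biproducts

/-! ### Families defined separately at the last index -/

section Snoc

/-- The dependent family on `{0, …, m}` with prescribed values below `m` and at `m`. -/
def snocDep {m : ℕ} {α : ∀ i : ℕ, i ≤ m → Sort*} (F : ∀ (i : ℕ) (h : i < m), α i h.le)
    (l : α m le_rfl) (i : ℕ) (hi : i ≤ m) : α i hi :=
  if h : i < m then F i h else
    have e : m = i := le_antisymm (not_lt.1 h) hi
    e.rec (motive := fun j e => α j e.ge) l

variable {m : ℕ} {α : ∀ i : ℕ, i ≤ m → Sort*} (F : ∀ (i : ℕ) (h : i < m), α i h.le)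
    (l : α m le_rfl)

theorem snocDep_lt (i : ℕ) (h : i < m) : snocDep F l i h.le = F i h := dif_pos h

theorem snocDep_last : snocDep F l m le_rfl = l := dif_neg (lt_irrefl m)

/-- Two values of a dependent family can be prescribed. -/
theorem exists_update_two (f : ∀ i hi, α i hi) {p q : ℕ} (hp : p ≤ m) (hq : q ≤ m) (hpq : p ≠ q)
    (a : α p hp) (b : α q hq) : ∃ g : ∀ i hi, α i hi, g p hp = a ∧ g q hq = b ∧
      ∀ i hi, i ≠ p → i ≠ q → g i hi = f i hi := by
  classical
  let F : ∀ i : {i // i ≤ m}, α i.1 i.2 :=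
    Function.update (Function.update (fun i => f i.1 i.2) ⟨p, hp⟩ a) ⟨q, hq⟩ b
  refine ⟨fun i hi => F ⟨i, hi⟩, ?_, ?_, fun i hi h₁ h₂ => ?_⟩
  · simp only [F]
    rw [Function.update_of_ne (by simpa using hpq), Function.update_self]
  · simp only [F]
    rw [Function.update_self]
  · simp only [F]
    rw [Function.update_of_ne (by simpa using h₂), Function.update_of_ne (by simpa using h₁)]

end Snoc

/-! ### Sums, summands and rotations of `(n + 2)`-angles -/

section Angles

variable {D : Type u} [Category.{v} D] {S : D ⥤ D} {n : ℕ}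

namespace SuspSeq

/-- The composition of morphisms of `(n + 2)`-`S`-sequences. -/
def Hom.comp' {X Y Z : SuspSeq S n} (φ : Hom X Y) (ψ : Hom Y Z) : Hom X Z where
  toHom := φ.toHom.comp ψ.toHom
  comm_δ := by
    simp only [Seq.Hom.comp, Functor.map_comp]
    rw [← Category.assoc, φ.comm_δ, Category.assoc, ψ.comm_δ, Category.assoc]

@[simp]
theorem Hom.comp'_f {X Y Z : SuspSeq S n} (φ : Hom X Y) (ψ : Hom Y Z) (i : ℕ) (hi : i ≤ n + 1) :
    (φ.comp' ψ).f i hi = φ.f i hi ≫ ψ.f i hi := rfl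

variable [Preadditive D]

/-- The sum of two morphisms of `(n + 2)`-`S`-sequences. -/
def Hom.add [S.Additive] {X Y : SuspSeq S n} (φ ψ : Hom X Y) : Hom X Y where
  f i hi := φ.f i hi + ψ.f i hi
  comm i hi := by rw [Preadditive.comp_add, Preadditive.add_comp, φ.comm, ψ.comm]
  comm_δ := by rw [S.map_add, Preadditive.comp_add, Preadditive.add_comp, φ.comm_δ, ψ.comm_δ]

@[simp]
theorem Hom.add_f [S.Additive] {X Y : SuspSeq S n} (φ ψ : Hom X Y) (i : ℕ) (hi : i ≤ n + 1) :
    (φ.add ψ).f i hi = φ.f i hi + ψ.f i hi := rfl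

/-- The direct sum of two `(n + 2)`-`S`-sequences. -/
noncomputable def sum [HasBinaryBiproducts D] (X Y : SuspSeq S n) : SuspSeq S n where
  obj i hi := X.obj i hi ⊞ Y.obj i hi
  d i hi := biprod.map (X.d i hi) (Y.d i hi)
  δ := biprod.desc (X.δ ≫ S.map biprod.inl) (Y.δ ≫ S.map biprod.inr)

/-- Every sequence is the left rotation of a sequence
`S⁻¹ X_{n+1} ⟶ X_0 ⟶ ⋯ ⟶ X_n ⟶ X_{n+1}`. -/
theorem exists_rotationData_to [S.IsEquivalence] [S.Additive] (X : SuspSeq S n) :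
    ∃ R : SuspSeq S n, Nonempty (RotationData R X) := by
  let O : ∀ i : ℕ, i ≤ n + 1 → D := fun i h => match i, h with
    | 0, _ => S.objPreimage (X.obj (n + 1) le_rfl)
    | i + 1, h => X.obj i (by omega)
  let w : S.obj (O 0 (Nat.zero_le _)) ≅ X.obj (n + 1) le_rfl := S.objObjPreimageIso _
  let e : ∀ (i : ℕ) (hi : i ≤ n), X.obj i (by omega) ≅ O (i + 1) (by omega) :=
    fun i hi => Iso.refl _
  let d : ∀ (i : ℕ) (hi : i ≤ n), O i (by omega) ⟶ O (i + 1) (by omega) := fun i hi =>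
    match i, hi with
    | 0, _ => (-1 : ℤ) ^ n • (S.preimage (w.hom ≫ X.δ) ≫ (e 0 (by omega)).hom)
    | i + 1, h => (e i (by omega)).inv ≫ X.d i (by omega) ≫ (e (i + 1) (by omega)).hom
  have hd0 : d 0 (by omega) = (-1 : ℤ) ^ n • (S.preimage (w.hom ≫ X.δ) ≫ (e 0 (by omega)).hom) :=
    rfl
  have hd : ∀ i (hi : i + 1 ≤ n), d (i + 1) hi =
    (e i (by omega)).inv ≫ X.d i (by omega) ≫ (e (i + 1) (by omega)).hom := fun _ _ => rfl
  clear_value e d w O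
  refine ⟨⟨⟨O, d⟩, (e n le_rfl).inv ≫ X.d n le_rfl ≫ w.inv⟩, ⟨⟨e, w.symm, ?_, ?_, ?_⟩⟩⟩
  · intro i hi
    simp [hd]
  · simp
  · have : (-1 : ℤ) ^ (n + 2) * (-1 : ℤ) ^ n = 1 := by
      rw [← pow_add]
      exact Even.neg_one_pow ⟨n + 1, by ring⟩
    simp only [hd0, Functor.map_zsmul, smul_smul, this]
    simp

/-- Every sequence `X` has a left rotation `X_1 ⟶ ⋯ ⟶ X_{n+1} ⟶ S X_0 ⟶ S X_1`. -/
theorem exists_rotationData_from (X : SuspSeq S n) :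
    ∃ L : SuspSeq S n, Nonempty (RotationData X L) := by
  obtain ⟨O, ⟨e⟩, ⟨l⟩⟩ : ∃ O : ∀ i : ℕ, i ≤ n + 1 → D,
      Nonempty (∀ (i : ℕ) (hi : i ≤ n), O i (by omega) ≅ X.obj (i + 1) (by omega)) ∧
      Nonempty (O (n + 1) le_rfl ≅ S.obj (X.obj 0 (by omega))) :=
    ⟨snocDep (fun i h => X.obj (i + 1) (by omega)) (S.obj (X.obj 0 (by omega))),
      ⟨fun i hi => eqToIso (snocDep_lt (α := fun _ _ => D) _ _ i (Nat.lt_succ_of_le hi))⟩,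
      ⟨eqToIso (snocDep_last (α := fun _ _ => D) _ _)⟩⟩
  let d : ∀ (i : ℕ) (hi : i ≤ n), O i (by omega) ⟶ O (i + 1) (by omega) :=
    snocDep (m := n) (α := fun i hi => O i (by omega) ⟶ O (i + 1) (by omega))
      (fun i h => (e i (by omega)).hom ≫ X.d (i + 1) (by omega) ≫ (e (i + 1) (by omega)).inv)
      ((e n (by omega)).hom ≫ X.δ ≫ l.inv)
  refine ⟨⟨⟨O, d⟩, l.hom ≫ ((-1 : ℤ) ^ (n + 2) • S.map (X.d 0 (by omega))) ≫
    S.map (e 0 (by omega)).inv⟩, ⟨⟨e, l, ?_, ?_, ?_⟩⟩⟩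
  · intro i hi
    simp only [d]
    rw [snocDep_lt _ _ i hi]
    simp
  · simp only [d]
    rw [snocDep_last]
    simp
  · simp only [Category.assoc, ← S.map_comp, Iso.inv_hom_id, S.map_id, Category.comp_id]

end SuspSeq

variable [Preadditive D] {pent : Set (SuspSeq S n)}

namespace IsAngulated

/-- If `Y` is degreewise a direct summand of the `(n + 2)`-angle `V`, with inclusions and
projections being morphisms of sequences, then `Y` is an `(n + 2)`-angle: the degreewise
complements automatically form a sequence. -/
theorem mem_of_retract [S.Additive] (h : IsAngulated n S pent) {V Y : SuspSeq S n} (hV : V ∈ pent)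
    (s : SuspSeq.Hom Y V) (r : SuspSeq.Hom V Y)
    (H : ∀ i hi, ∃ (T : D) (inr : T ⟶ V.obj i hi) (snd : V.obj i hi ⟶ T),
      IsBiproduct (s.f i hi) inr (r.f i hi) snd) : Y ∈ pent := by
  choose T inr snd H using H
  let K : SuspSeq S n :=
    { obj := T
      d := fun i hi => inr i (by omega) ≫ V.d i hi ≫ snd (i + 1) (by omega)
      δ := inr (n + 1) le_rfl ≫ V.δ ≫ S.map (snd 0 (by omega)) }
  let ι : SuspSeq.Hom K V :=
    { f := inr
      comm := fun i hi => by
        apply (H (i + 1) (by omega)).hom_ext_to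
        · simp only [K, Category.assoc, (H (i + 1) (by omega)).inr_fst, comp_zero]
          rw [r.comm, reassoc_of% (H i (by omega)).inr_fst, zero_comp]
        · simp only [K, Category.assoc, (H (i + 1) (by omega)).inr_snd, Category.comp_id]
      comm_δ := by
        apply ((H 0 (by omega)).map S).hom_ext_to
        · simp only [K, Category.assoc, ((H 0 (by omega)).map S).inr_fst, comp_zero]
          rw [r.comm_δ, reassoc_of% (H (n + 1) (by omega)).inr_fst, zero_comp]
        · simp only [K, Category.assoc, ((H 0 (by omega)).map S).inr_snd, Category.comp_id] }
  exact (h.summand Y K V ⟨s, ι, fun i hi => ⟨_, _, H i hi⟩⟩ hV).1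

theorem exists_sum [HasBinaryBiproducts D] [S.Additive] (h : IsAngulated n S pent)
    {X Y : SuspSeq S n} (hX : X ∈ pent) (hY : Y ∈ pent) :
    ∃ Z ∈ pent, ∃ (inl : SuspSeq.Hom X Z) (inr : SuspSeq.Hom Y Z) (fst : SuspSeq.Hom Z X)
      (snd : SuspSeq.Hom Z Y), ∀ i hi,
        IsBiproduct (inl.f i hi) (inr.f i hi) (fst.f i hi) (snd.f i hi) := by
  refine ⟨X.sum Y, ?_, ⟨⟨fun i hi => biprod.inl, ?_⟩, ?_⟩, ⟨⟨fun i hi => biprod.inr, ?_⟩, ?_⟩,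
    ⟨⟨fun i hi => biprod.fst, ?_⟩, ?_⟩, ⟨⟨fun i hi => biprod.snd, ?_⟩, ?_⟩,
    fun i hi => isBiproduct_biprod _ _⟩
  · refine h.directSum X Y _ ⟨⟨⟨fun i hi => biprod.inl, ?_⟩, ?_⟩,
      ⟨⟨fun i hi => biprod.inr, ?_⟩, ?_⟩, fun i hi => ⟨_, _, isBiproduct_biprod _ _⟩⟩ hX hY
    all_goals intros; simp [SuspSeq.sum]
  all_goals intros
  all_goals first
    | simp [SuspSeq.sum]
      done
    | apply biprod.hom_ext' <;> simp [SuspSeq.sum, ← S.map_comp]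

theorem rotation_mem (h : IsAngulated n S pent) {X Y : SuspSeq S n}
    (ρ : SuspSeq.RotationData X Y) : X ∈ pent ↔ Y ∈ pent :=
  h.rotate _ _ ⟨ρ⟩

end IsAngulated

end Angles

/-! ### Exactness under all Hom functors -/

section HomExact

variable {D : Type u} [Category.{v} D] [Preadditive D]

/-- `A ⟶ B ⟶ C` becomes exact under all functors `D(T, -)` and `D(-, T)`. -/
structure IsHomExact {A B C : D} (f : A ⟶ B) (g : B ⟶ C) : Prop where
  zero : f ≫ g = 0
  lift : ∀ {T : D} (t : T ⟶ B), t ≫ g = 0 → ∃ k, t = k ≫ f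
  desc : ∀ {T : D} (t : B ⟶ T), f ≫ t = 0 → ∃ k, t = g ≫ k

namespace IsHomExact

theorem of_iso {A B C A' B' C' : D} {f : A ⟶ B} {g : B ⟶ C} (h : IsHomExact f g)
    {f' : A' ⟶ B'} {g' : B' ⟶ C'} (e₁ : A ≅ A') (e₂ : B ≅ B') (e₃ : C ≅ C')
    (hf : f ≫ e₂.hom = e₁.hom ≫ f') (hg : g ≫ e₃.hom = e₂.hom ≫ g') : IsHomExact f' g' where
  zero := by
    rw [← cancel_epi e₁.hom, ← reassoc_of% hf, ← hg, reassoc_of% h.zero, comp_zero, zero_comp]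
  lift t ht := by
    obtain ⟨k, hk⟩ := h.lift (t ≫ e₂.inv) (by
      rw [← cancel_mono e₃.hom, Category.assoc, Category.assoc, hg, Iso.inv_hom_id_assoc, ht,
        zero_comp])
    refine ⟨k ≫ e₁.hom, ?_⟩
    rw [Category.assoc, ← hf, ← reassoc_of% hk, Iso.inv_hom_id, Category.comp_id]
  desc t ht := by
    obtain ⟨k, hk⟩ := h.desc (e₂.hom ≫ t) (by rw [reassoc_of% hf, ht, comp_zero])
    refine ⟨e₃.inv ≫ k, ?_⟩
    rw [← cancel_epi e₂.hom, hk, ← reassoc_of% hg, Iso.hom_inv_id_assoc]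

theorem sign_left {A B C : D} {f : A ⟶ B} {g : B ⟶ C} {m : ℕ}
    (h : IsHomExact ((-1 : ℤ) ^ m • f) g) : IsHomExact f g := by
  rcases neg_one_pow_eq_or ℤ m with e | e <;> rw [e] at h
  · simpa using h
  · refine h.of_iso ⟨-𝟙 _, -𝟙 _, by simp, by simp⟩ (Iso.refl _) (Iso.refl _) ?_ ?_ <;> simp

theorem map {D' : Type*} [Category* D'] [Preadditive D'] (S : D ⥤ D') [S.Additive]
    [S.IsEquivalence] {A B C : D} {f : A ⟶ B} {g : B ⟶ C} (h : IsHomExact f g) :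
    IsHomExact (S.map f) (S.map g) where
  zero := by rw [← S.map_comp, h.zero, S.map_zero]
  lift {T} t ht := by
    obtain ⟨k, hk⟩ := h.lift (S.preimage ((S.objObjPreimageIso T).hom ≫ t)) (S.map_injective (by
      simp [ht]))
    refine ⟨(S.objObjPreimageIso T).inv ≫ S.map k, ?_⟩
    rw [Category.assoc, ← S.map_comp, ← hk]
    simp
  desc {T} t ht := by
    obtain ⟨k, hk⟩ := h.desc (S.preimage (t ≫ (S.objObjPreimageIso T).inv)) (S.map_injective (by
      simp [reassoc_of% ht]))
    refine ⟨S.map k ≫ (S.objObjPreimageIso T).hom, ?_⟩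
    rw [← Category.assoc, ← S.map_comp, ← hk]
    simp

end IsHomExact

end HomExact

/-! ### Rotated trivial sequences and rotated cones -/

section Angles

variable {D : Type u} [Category.{v} D] {S : D ⥤ D} {n : ℕ}

namespace SuspSeq

/-- `X` is a rotation of a trivial sequence: its only nonzero objects are in degrees `k` and
`k + 1`, and the morphism between them is invertible. For `k = n + 1` the degree `k + 1` is
understood as degree `0`, and the morphism is the last one. -/
structure IsTrivAt (X : SuspSeq S n) (k : ℕ) : Prop where
  isIso : ∀ h : k ≤ n, IsIso (X.d k h)
  isIso_δ : k = n + 1 → IsIso X.δ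
  isZero : ∀ i hi, i ≠ k → i ≠ k + 1 → ¬ (k = n + 1 ∧ i = 0) → IsZero (X.obj i hi)

variable [Preadditive D]

theorem isZero_of_map [S.Faithful] [S.Additive] {Z : D} (h : IsZero (S.obj Z)) : IsZero Z := by
  rw [IsZero.iff_id_eq_zero]
  exact S.map_injective (h.eq_of_src _ _)

theorem IsTrivAt.rotation [S.Faithful] [S.Additive] {R X : SuspSeq S n} (ρ : RotationData R X)
    {k : ℕ} (hk : k ≤ n) (h : X.IsTrivAt k) : R.IsTrivAt (k + 1) where
  isIso hk' := by
    have := h.isIso hk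
    have e := ρ.comm k hk'
    rw [← Iso.inv_comp_eq] at e
    rw [← e]
    infer_instance
  isIso_δ hk' := by
    obtain rfl : k = n := by omega
    have := h.isIso le_rfl
    have e := ρ.comm_last
    rw [← Iso.inv_comp_eq] at e
    rw [← e]
    infer_instance
  isZero i hi h₁ h₂ h₃ := by
    match i, hi with
    | 0, hi =>
      exact isZero_of_map ((h.isZero (n + 1) le_rfl (by omega) (by omega) (by omega)).of_iso
        ρ.eLast.symm)
    | i + 1, hi =>
      exact (h.isZero i (by omega) (by omega) (by omega) (by omega)).of_iso (ρ.e i (by omega)).symm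

theorem IsTrivAt.isTrivial [S.Full] [S.Faithful] [S.Additive] {R X : SuspSeq S n}
    (ρ : RotationData R X) (h : X.IsTrivAt (n + 1)) : R.IsTrivial where
  isIso := by
    have := h.isIso_δ rfl
    have e := ρ.comm_δ
    rw [← Iso.inv_comp_eq] at e
    have : IsIso (S.map (R.d 0 (Nat.zero_le _))) := by
      rcases neg_one_pow_eq_or ℤ (n + 2) with h | h <;> rw [h] at e
      · rw [one_smul] at e
        rw [← e]
        infer_instance
      · rw [neg_one_smul, ← neg_eq_iff_eq_neg] at e
        rw [← e]
        exact ⟨-inv (ρ.eLast.inv ≫ X.δ ≫ S.map (ρ.e 0 (Nat.zero_le _)).hom), by simp, by simp⟩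
    exact isIso_of_reflects_iso _ S
  isZero i hi h₂ := by
    obtain ⟨i, rfl⟩ : ∃ j, i = j + 1 := ⟨i - 1, by omega⟩
    exact (h.isZero i (by omega) (by omega) (by omega) (by omega)).of_iso (ρ.e i (by omega)).symm

end SuspSeq

variable [Preadditive D] {pent : Set (SuspSeq S n)}

namespace IsAngulated

open SuspSeq ZeroObject

section

variable [S.IsEquivalence] [S.Additive] (h : IsAngulated n S pent)
include h

theorem isTrivAt_mem {k : ℕ} (hk : k ≤ n + 1) {X : SuspSeq S n} (hX : X.IsTrivAt k) :
    X ∈ pent := by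
  obtain ⟨j, hj⟩ : ∃ j, k + j = n + 1 := ⟨n + 1 - k, by omega⟩
  induction j generalizing k X with
  | zero =>
    obtain rfl : k = n + 1 := hj
    obtain ⟨R, ⟨ρ⟩⟩ := X.exists_rotationData_to
    exact (h.rotation_mem ρ).1 (h.trivial R (hX.isTrivial ρ))
  | succ j ih =>
    obtain ⟨R, ⟨ρ⟩⟩ := X.exists_rotationData_to
    exact (h.rotation_mem ρ).1 (ih (by omega) (hX.rotation ρ (by omega)) (by omega))

theorem exists_isTrivAt [HasZeroObject D] (C : D) {k : ℕ} (hk : k ≤ n + 1) :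
    ∃ T ∈ pent, T.IsTrivAt k ∧ Nonempty (T.obj k hk ≅ C) := by
  suffices ∃ T : SuspSeq S n, T.IsTrivAt k ∧ Nonempty (T.obj k hk ≅ C) by
    obtain ⟨T, hT, e⟩ := this
    exact ⟨T, h.isTrivAt_mem hk hT, hT, e⟩
  induction k with
  | zero =>
    refine ⟨⟨⟨fun i _ => match i with | 0 => C | 1 => C | _ + 2 => 0, fun i _ =>
      match i with | 0 => 𝟙 C | _ + 1 => 0⟩, 0⟩, ⟨?_, ?_, ?_⟩, ⟨Iso.refl _⟩⟩
    · intro _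
      exact inferInstanceAs (IsIso (𝟙 C))
    · intro h
      omega
    · intro i hi h₁ h₂ _
      obtain ⟨i, rfl⟩ : ∃ j, i = j + 2 := ⟨i - 2, by omega⟩
      exact isZero_zero D
  | succ k ih =>
    obtain ⟨T, hT, ⟨e⟩⟩ := ih (by omega)
    obtain ⟨R, ⟨ρ⟩⟩ := T.exists_rotationData_to
    exact ⟨R, hT.rotation ρ (by omega), ⟨(ρ.e k (by omega)).symm ≪≫ e⟩⟩

end

end IsAngulated

/-- The cone of the rotation to the right of a morphism `φ : X ⟶ Y`: one has `M_0 = X_0 ⊕ W`,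
where `S W = Y_{n+1}`, and `M_{i+1} = X_{i+1} ⊕ Y_i` for `i ≤ n`. -/
structure RotCone [Preadditive D] {X Y : SuspSeq S n} (φ : SuspSeq.Hom X Y) (M : SuspSeq S n) where
  W : D
  w : S.obj W ≅ Y.obj (n + 1) le_rfl
  d₀ : W ⟶ Y.obj 0 (by omega)
  map_d₀ : S.map d₀ = (-1 : ℤ) ^ n • (w.hom ≫ Y.δ)
  inl : ∀ (i : ℕ) (hi : i ≤ n + 1), X.obj i hi ⟶ M.obj i hi
  fst : ∀ (i : ℕ) (hi : i ≤ n + 1), M.obj i hi ⟶ X.obj i hi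
  inr : ∀ (i : ℕ) (hi : i ≤ n), Y.obj i (by omega) ⟶ M.obj (i + 1) (by omega)
  snd : ∀ (i : ℕ) (hi : i ≤ n), M.obj (i + 1) (by omega) ⟶ Y.obj i (by omega)
  inr₀ : W ⟶ M.obj 0 (by omega)
  snd₀ : M.obj 0 (by omega) ⟶ W
  biproduct₀ : IsBiproduct (inl 0 (by omega)) inr₀ (fst 0 (by omega)) snd₀
  biproduct : ∀ (i : ℕ) (hi : i ≤ n),
    IsBiproduct (inl (i + 1) (by omega)) (inr i hi) (fst (i + 1) (by omega)) (snd i hi)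
  inl_d : ∀ (i : ℕ) (hi : i ≤ n), inl i (by omega) ≫ M.d i hi =
    -(X.d i hi ≫ inl (i + 1) (Nat.succ_le_succ hi)) + φ.f i (Nat.le_succ_of_le hi) ≫ inr i hi
  inr₀_d : inr₀ ≫ M.d 0 (by omega) = d₀ ≫ inr 0 (by omega)
  inr_d : ∀ (i : ℕ) (hi : i + 1 ≤ n), inr i (by omega) ≫ M.d (i + 1) hi =
    Y.d i (by omega) ≫ inr (i + 1) hi
  inl_δ : inl (n + 1) le_rfl ≫ M.δ = (-1 : ℤ) ^ (n + 1) • (X.δ ≫ S.map (inl 0 (Nat.zero_le _))) +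
    φ.f (n + 1) le_rfl ≫ w.inv ≫ S.map inr₀
  inr_δ : inr n le_rfl ≫ M.δ = Y.d n le_rfl ≫ w.inv ≫ S.map inr₀

namespace IsAngulated

open SuspSeq

variable [S.IsEquivalence] [S.Additive] (h : IsAngulated n S pent)
include h

/-- A morphism of the last terms and the first terms that is compatible with the last morphisms of
two `(n + 2)`-angles extends to a morphism with a cone that is an `(n + 2)`-angle: this is the axiom
`complete_cone` for the rotations to the right of the two angles. -/
theorem complete_ends_cone {X Y : SuspSeq S n} (hX : X ∈ pent) (hY : Y ∈ pent)
    (a : X.obj 0 (by omega) ⟶ Y.obj 0 (by omega))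
    (c : X.obj (n + 1) le_rfl ⟶ Y.obj (n + 1) le_rfl) (hac : X.δ ≫ S.map a = c ≫ Y.δ) :
    ∃ φ : Hom X Y, φ.f 0 (by omega) = a ∧ φ.f (n + 1) le_rfl = c ∧
      ∃ M ∈ pent, Nonempty (RotCone φ M) := by
  obtain ⟨R, ⟨ρ⟩⟩ := X.exists_rotationData_to
  obtain ⟨Q, ⟨σ⟩⟩ := Y.exists_rotationData_to
  have sgn : (-1 : ℤ) ^ n * (-1 : ℤ) ^ n = 1 := by
    rw [← pow_add]
    exact Even.neg_one_pow ⟨n, rfl⟩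
  have sgn' : (-1 : ℤ) ^ (n + 2) = (-1) ^ n := by rw [pow_add]; simp
  have hR : S.map (R.d 0 (by omega)) = (-1 : ℤ) ^ n • (ρ.eLast.inv ≫ X.δ ≫
      S.map (ρ.e 0 (by omega)).hom) := by
    rw [ρ.comm_δ, Iso.inv_hom_id_assoc, smul_smul, sgn', sgn, one_smul]
  have hQ : S.map (Q.d 0 (by omega)) = (-1 : ℤ) ^ n • (σ.eLast.inv ≫ Y.δ ≫
      S.map (σ.e 0 (by omega)).hom) := by
    rw [σ.comm_δ, Iso.inv_hom_id_assoc, smul_smul, sgn', sgn, one_smul]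
  obtain ⟨φ, h₀, h₁, M, hM, ⟨C⟩⟩ := h.complete_cone R ((h.rotation_mem ρ).2 hX) Q
    ((h.rotation_mem σ).2 hY) (S.preimage (ρ.eLast.inv ≫ c ≫ σ.eLast.hom))
    ((ρ.e 0 (by omega)).inv ≫ a ≫ (σ.e 0 (by omega)).hom) (S.map_injective (by
      simp only [S.map_comp, S.map_preimage, hR, hQ, Preadditive.zsmul_comp,
        Preadditive.comp_zsmul, Category.assoc, Iso.hom_inv_id_assoc]
      rw [← S.map_comp_assoc (ρ.e 0 (by omega)).hom, Iso.hom_inv_id, S.map_id, Category.id_comp,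
        reassoc_of% hac]))
  let f : ∀ (i : ℕ) (hi : i ≤ n + 1), X.obj i hi ⟶ Y.obj i hi :=
    snocDep (fun i hi => (ρ.e i (by omega)).hom ≫ φ.f (i + 1) (by omega) ≫ (σ.e i (by omega)).inv) c
  have hf : ∀ i (hi : i < n + 1), f i hi.le = (ρ.e i (by omega)).hom ≫ φ.f (i + 1) (by omega) ≫
    (σ.e i (by omega)).inv := fun i hi => snocDep_lt _ _ i hi
  have hfl : f (n + 1) le_rfl = c := snocDep_last _ _
  have hf0 : f 0 (by omega) = a := by
    rw [hf 0 (by omega), h₁]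
    simp
  clear_value f
  have hRd : ∀ i (hi : i + 1 ≤ n), X.d i (by omega) = (ρ.e i (by omega)).hom ≫ R.d (i + 1) hi ≫
      (ρ.e (i + 1) hi).inv := fun i hi => by
    rw [← Category.assoc, ← ρ.comm i hi, Category.assoc, Iso.hom_inv_id, Category.comp_id]
  have hQd : ∀ i (hi : i + 1 ≤ n), Y.d i (by omega) = (σ.e i (by omega)).hom ≫ Q.d (i + 1) hi ≫
      (σ.e (i + 1) hi).inv := fun i hi => by
    rw [← Category.assoc, ← σ.comm i hi, Category.assoc, Iso.hom_inv_id, Category.comp_id]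
  have hRl : X.d n le_rfl = (ρ.e n le_rfl).hom ≫ R.δ ≫ ρ.eLast.inv := by
    rw [← Category.assoc, ← ρ.comm_last, Category.assoc, Iso.hom_inv_id, Category.comp_id]
  have hQl : Y.d n le_rfl = (σ.e n le_rfl).hom ≫ Q.δ ≫ σ.eLast.inv := by
    rw [← Category.assoc, ← σ.comm_last, Category.assoc, Iso.hom_inv_id, Category.comp_id]
  have hφδ := φ.comm_δ
  rw [h₀, S.map_preimage] at hφδ
  let ψ : Hom X Y :=
    { f := f
      comm := fun i hi => by
        rcases hi.lt_or_eq with hi' | rfl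
        · rw [hf i (by omega), hf (i + 1) (by omega), hRd i hi', hQd i hi']
          simp [reassoc_of% φ.comm (i + 1) hi']
        · rw [hf i (by omega), hfl, hRl, hQl]
          simp only [Category.assoc, Iso.inv_hom_id_assoc]
          rw [← reassoc_of% hφδ]
          simp
      comm_δ := by rw [hf0, hfl, hac] }
  refine ⟨ψ, hf0, hfl, M, hM, ?_⟩
  choose fst snd hbi using C.biproduct
  obtain ⟨fstL, sndL, hL⟩ := C.biproduct_last
  let inl : ∀ (i : ℕ) (hi : i ≤ n + 1), X.obj i hi ⟶ M.obj i hi :=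
    snocDep (fun i hi => (ρ.e i (by omega)).hom ≫ C.inl i (by omega)) (ρ.eLast.hom ≫ C.inlLast)
  have hinl : ∀ i (hi : i < n + 1), inl i hi.le = (ρ.e i (by omega)).hom ≫ C.inl i (by omega) :=
    fun i hi => snocDep_lt _ _ i hi
  have hinlL : inl (n + 1) le_rfl = ρ.eLast.hom ≫ C.inlLast := snocDep_last _ _
  let fst' : ∀ (i : ℕ) (hi : i ≤ n + 1), M.obj i hi ⟶ X.obj i hi :=
    snocDep (fun i hi => fst i (by omega) ≫ (ρ.e i (by omega)).inv) (fstL ≫ ρ.eLast.inv)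
  have hfst : ∀ i (hi : i < n + 1), fst' i hi.le = fst i (by omega) ≫ (ρ.e i (by omega)).inv :=
    fun i hi => snocDep_lt _ _ i hi
  have hfstL : fst' (n + 1) le_rfl = fstL ≫ ρ.eLast.inv := snocDep_last _ _
  let snd' : ∀ (i : ℕ) (hi : i ≤ n), M.obj (i + 1) (by omega) ⟶ Y.obj i (by omega) :=
    snocDep (α := fun i hi => M.obj (i + 1) (by omega) ⟶ Y.obj i (by omega))
      (fun i hi => snd (i + 1) (by omega) ≫ (σ.e i (by omega)).inv) (sndL ≫ (σ.e n le_rfl).inv)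
  have hsnd : ∀ i (hi : i < n), snd' i hi.le = snd (i + 1) (by omega) ≫ (σ.e i (by omega)).inv :=
    fun i hi => snocDep_lt _ _ i hi
  have hsndL : snd' n le_rfl = sndL ≫ (σ.e n le_rfl).inv := snocDep_last _ _
  clear_value inl fst' snd'
  exact ⟨{
    W := Q.obj 0 (by omega)
    w := σ.eLast.symm
    d₀ := Q.d 0 (by omega) ≫ (σ.e 0 (by omega)).inv
    map_d₀ := by
      rw [S.map_comp, hQ]
      simp [← S.map_comp]
    inl := inl
    fst := fst'
    inr := fun i hi => (σ.e i hi).hom ≫ C.inr (i + 1) (by omega)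
    snd := snd'
    inr₀ := C.inr 0 (by omega)
    snd₀ := snd 0 (by omega)
    biproduct₀ := by
      rw [hinl 0 (by omega), hfst 0 (by omega)]
      simpa using (hbi 0 (by omega)).precomp (ρ.e 0 (by omega)) (Iso.refl _)
    biproduct := fun i hi => by
      rcases hi.lt_or_eq with hi' | rfl
      · rw [hinl _ (by omega), hfst _ (by omega), hsnd _ hi']
        exact (hbi (i + 1) hi').precomp _ _
      · rw [hinlL, hfstL, hsndL]
        exact hL.precomp _ _
    inl_d := fun i hi => by
      rw [hinl i (by omega)]
      change _ = _ + f i _ ≫ _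
      rw [hf i (by omega)]
      rcases hi.lt_or_eq with hi' | rfl
      · rw [hinl (i + 1) (by omega), Category.assoc, C.inl_d i hi', hRd i hi']
        simp
      · rw [hinlL, Category.assoc, C.inl_d_last, hRl]
        simp
    inr₀_d := by rw [C.inr_d]; simp
    inr_d := fun i hi => by
      rw [Category.assoc, C.inr_d, hQd i hi]
      simp
    inl_δ := by
      change _ = _ + f (n + 1) _ ≫ _
      rw [hinlL, hinl 0 (by omega), hfl, Category.assoc, C.inlLast_δ, hR, h₀, S.map_preimage]
      simp only [Preadditive.comp_add, Preadditive.comp_neg, Preadditive.zsmul_comp,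
        Preadditive.comp_zsmul, Category.assoc, Iso.hom_inv_id_assoc, S.map_comp, pow_succ,
        mul_neg, mul_one, neg_smul, Iso.symm_inv]
    inr_δ := by
      rw [Category.assoc, C.inr_δ, hQl]
      simp }⟩

theorem complete_ends {X Y : SuspSeq S n} (hX : X ∈ pent) (hY : Y ∈ pent)
    (a : X.obj 0 (by omega) ⟶ Y.obj 0 (by omega))
    (c : X.obj (n + 1) le_rfl ⟶ Y.obj (n + 1) le_rfl) (hac : X.δ ≫ S.map a = c ≫ Y.δ) :
    ∃ φ : Hom X Y, φ.f 0 (by omega) = a ∧ φ.f (n + 1) le_rfl = c := by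
  obtain ⟨φ, h₀, h₁, -⟩ := h.complete_ends_cone hX hY a c hac
  exact ⟨φ, h₀, h₁⟩

end IsAngulated

end Angles

/-! ### Exactness of `(n + 2)`-angles -/

section Angles

variable {D : Type u} [Category.{v} D] {S : D ⥤ D} {n : ℕ} [Preadditive D]

namespace SuspSeq.RotationData

variable {X Y : SuspSeq S n} (ρ : RotationData X Y)
include ρ

theorem isHomExact_succ (i : ℕ) (hi : i + 2 ≤ n)
    (h : IsHomExact (Y.d i (by omega)) (Y.d (i + 1) (by omega))) :
    IsHomExact (X.d (i + 1) (by omega)) (X.d (i + 2) hi) :=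
  h.of_iso (ρ.e _ _) (ρ.e _ _) (ρ.e _ _) (ρ.comm i (by omega)) (ρ.comm (i + 1) (by omega))

theorem isHomExact_last (h : IsHomExact (X.δ) (S.map (X.d 0 (Nat.zero_le _)))) :
    IsHomExact (Y.d n le_rfl) Y.δ := by
  refine IsHomExact.of_iso (e₁ := (ρ.e n le_rfl).symm) (e₂ := ρ.eLast.symm)
    (e₃ := (S.mapIso (ρ.e 0 (by omega))).symm) (f := X.δ)
    (g := (-1 : ℤ) ^ (n + 2) • S.map (X.d 0 (Nat.zero_le _))) ?_ ?_ ?_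
  · rcases neg_one_pow_eq_or ℤ (n + 2) with e | e <;> rw [e]
    · simpa using h
    · refine h.of_iso (Iso.refl _) (Iso.refl _) ⟨-𝟙 _, -𝟙 _, by simp, by simp⟩ ?_ ?_ <;> simp
  · simp only [Iso.symm_hom]
    rw [Iso.comp_inv_eq, Category.assoc, ρ.comm_last, Iso.inv_hom_id_assoc]
  · simp only [Iso.symm_hom, Functor.mapIso_inv]
    rw [Iso.eq_inv_comp, ← Category.assoc, ← ρ.comm_δ, Category.assoc, ← S.map_comp,
      Iso.hom_inv_id, S.map_id, Category.comp_id]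

theorem isHomExact_δ [S.Additive] [S.IsEquivalence] (hn : 1 ≤ n)
    (h : IsHomExact (X.d 0 (Nat.zero_le _)) (X.d (0 + 1) hn)) :
    IsHomExact Y.δ (S.map (Y.d 0 (Nat.zero_le _))) := by
  have sgn : (-1 : ℤ) ^ (n + 2) * (-1 : ℤ) ^ (n + 2) = 1 := by
    rw [← pow_add]
    exact Even.neg_one_pow ⟨n + 2, rfl⟩
  refine IsHomExact.sign_left (m := n + 2) ((h.map S).of_iso ρ.eLast.symm
    (S.mapIso (ρ.e 0 (by omega))).symm (S.mapIso (ρ.e 1 hn)).symm ?_ ?_)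
  · rw [Iso.symm_hom, Iso.symm_hom, Iso.eq_inv_comp, ← cancel_mono (S.map (ρ.e 0 (by omega)).hom),
      Preadditive.zsmul_comp, ρ.comm_δ, Functor.mapIso_inv, Category.assoc, Category.assoc,
      ← S.map_comp (ρ.e 0 _).inv, Iso.inv_hom_id, S.map_id, Category.comp_id,
      Preadditive.comp_zsmul, smul_smul, sgn, one_smul]
  · rw [Iso.symm_hom, Iso.symm_hom, Functor.mapIso_inv, Functor.mapIso_inv, ← S.map_comp,
      ← S.map_comp]
    congr 1
    rw [Iso.comp_inv_eq, Category.assoc, ρ.comm 0 hn, Iso.inv_hom_id_assoc]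

end SuspSeq.RotationData

namespace IsAngulated

open SuspSeq ZeroObject

variable {pent : Set (SuspSeq S n)} [S.IsEquivalence] [S.Additive] [HasZeroObject D]
  (h : IsAngulated n S pent) (hn : 1 ≤ n)
include h hn

/-- Compare with the trivial angle `X_0 = X_0`, whose term in degree `2` is zero. -/
theorem d_zero_comp_d_one {X : SuspSeq S n} (hX : X ∈ pent) :
    X.d 0 (Nat.zero_le _) ≫ X.d (0 + 1) hn = 0 := by
  obtain ⟨T, hT, hT', ⟨e⟩⟩ := h.exists_isTrivAt (X.obj 0 (by omega)) (Nat.zero_le _)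
  have := hT'.isIso (Nat.zero_le _)
  obtain ⟨φ, -, h₁⟩ := h.complete T hT X hX e.hom
    (inv (T.d 0 (Nat.zero_le _)) ≫ e.hom ≫ X.d 0 (Nat.zero_le _)) (by simp)
  have := φ.comm 1 hn
  rw [h₁, (hT'.isZero 2 (by omega) (by omega) (by omega) (by omega)).eq_of_src (φ.f 2 (by omega)) 0,
    comp_zero] at this
  simpa using this.symm

/-- Compare with the trivial angle `T = T` in degrees `1` and `2`. -/
theorem exists_desc_d_one {X : SuspSeq S n} (hX : X ∈ pent) {T : D} (t : X.obj 1 (by omega) ⟶ T)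
    (ht : X.d 0 (Nat.zero_le _) ≫ t = 0) : ∃ k, t = X.d (0 + 1) hn ≫ k := by
  obtain ⟨V, hV, hV', ⟨e⟩⟩ := h.exists_isTrivAt T (k := 1) (by omega)
  have := hV'.isIso hn
  obtain ⟨φ, -, h₁⟩ := h.complete X hX V hV 0 (t ≫ e.inv) (by rw [reassoc_of% ht]; simp)
  have := φ.comm 1 hn
  rw [h₁] at this
  refine ⟨φ.f 2 (Nat.succ_le_succ hn) ≫ inv (V.d 1 hn) ≫ e.hom, ?_⟩
  rw [reassoc_of% this]
  simp

/-- Compare with the trivial angle `T = T` in degrees `n` and `n + 1`. -/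
theorem exists_lift_d_last {X : SuspSeq S n} (hX : X ∈ pent) {T : D} (t : T ⟶ X.obj (n + 1) le_rfl)
    (ht : t ≫ X.δ = 0) : ∃ k, t = k ≫ X.d n le_rfl := by
  obtain ⟨V, hV, hV', ⟨e⟩⟩ := h.exists_isTrivAt T (k := n) (by omega)
  have := hV'.isIso le_rfl
  have hz := hV'.isZero 0 (by omega) (by omega) (by omega) (by omega)
  obtain ⟨φ, -, h₁⟩ := h.complete_ends hV hX 0 (inv (V.d n le_rfl) ≫ e.hom ≫ t)
    (by simp [ht])
  have := φ.comm n le_rfl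
  rw [h₁, IsIso.hom_inv_id_assoc] at this
  exact ⟨e.inv ≫ φ.f n (by omega), by rw [Category.assoc, ← this, Iso.inv_hom_id_assoc]⟩

theorem isHomExact_zero {X : SuspSeq S n} (hX : X ∈ pent) :
    IsHomExact (X.d 0 (Nat.zero_le _)) (X.d (0 + 1) hn) where
  zero := h.d_zero_comp_d_one hn hX
  desc := h.exists_desc_d_one hn hX
  lift {T} t ht := by
    -- After two left rotations, `S d_0` and `S d_1` are, up to sign, the last two morphisms of an
    -- angle, where `exists_lift_d_last` applies.
    obtain ⟨L, ⟨ρ⟩⟩ := X.exists_rotationData_from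
    obtain ⟨L', ⟨ρ'⟩⟩ := L.exists_rotationData_from
    have hL := h.rotation_mem ρ |>.1 hX
    have hL' := h.rotation_mem ρ' |>.1 hL
    have key := h.exists_lift_d_last hn hL'
      (S.map t ≫ S.map (ρ.e 0 (by omega)).inv ≫ ρ'.eLast.inv) (by
      rw [← cancel_mono (S.map (ρ'.e 0 (by omega)).hom)]
      have e₀ : S.map t ≫ S.map (ρ.e 0 (by omega)).inv ≫ S.map (L.d 0 (Nat.zero_le _)) = 0 := by
        rw [← S.map_comp, ← S.map_comp, ← cancel_mono (S.map (ρ.e 1 hn).hom), ← S.map_comp,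
          Category.assoc, Category.assoc, ρ.comm 0 hn, Iso.inv_hom_id_assoc, ht, S.map_zero,
          zero_comp]
      simp only [Category.assoc, ρ'.comm_δ, Iso.inv_hom_id_assoc, Preadditive.comp_zsmul, e₀,
        smul_zero, zero_comp])
    obtain ⟨k, hk⟩ := key
    have e₁ : S.map t = (k ≫ (ρ'.e n le_rfl).hom ≫ ρ.eLast.hom) ≫
        ((-1 : ℤ) ^ (n + 2) • S.map (X.d 0 (Nat.zero_le _))) := by
      rw [Category.assoc, Category.assoc, ← ρ.comm_δ, ← reassoc_of% ρ'.comm_last, ← reassoc_of% hk,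
        Iso.inv_hom_id_assoc, ← S.map_comp, Iso.inv_hom_id, S.map_id, Category.comp_id]
    refine ⟨(-1 : ℤ) ^ (n + 2) • S.preimage (k ≫ (ρ'.e n le_rfl).hom ≫ ρ.eLast.hom),
      S.map_injective ?_⟩
    rw [e₁, S.map_comp, S.map_zsmul, S.map_preimage, Preadditive.zsmul_comp,
      Preadditive.comp_zsmul]

/-- An `(n + 2)`-angle is exact at `X_{i+1}` under `D(T, -)` and `D(-, T)`, for `i + 1 ≤ n`. -/
theorem isHomExact {X : SuspSeq S n} (hX : X ∈ pent) (i : ℕ) (hi : i + 1 ≤ n) :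
    IsHomExact (X.d i (by omega)) (X.d (i + 1) hi) := by
  induction i generalizing X with
  | zero => exact h.isHomExact_zero hn hX
  | succ i ih =>
    obtain ⟨L, ⟨ρ⟩⟩ := X.exists_rotationData_from
    exact ρ.isHomExact_succ i hi (ih (h.rotation_mem ρ |>.1 hX) (by omega))

theorem isHomExact_δ {X : SuspSeq S n} (hX : X ∈ pent) :
    IsHomExact X.δ (S.map (X.d 0 (Nat.zero_le _))) := by
  obtain ⟨R, ⟨ρ⟩⟩ := X.exists_rotationData_to
  exact ρ.isHomExact_δ hn (h.isHomExact_zero hn (h.rotation_mem ρ |>.2 hX))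

theorem isHomExact_last {X : SuspSeq S n} (hX : X ∈ pent) :
    IsHomExact (X.d n le_rfl) X.δ := by
  obtain ⟨R, ⟨ρ⟩⟩ := X.exists_rotationData_to
  exact ρ.isHomExact_last (h.isHomExact_δ hn (h.rotation_mem ρ |>.2 hX))

/-- A morphism out of the first term of an `(n + 2)`-angle extends to the second term as soon as
it annihilates the last morphism. -/
theorem exists_extension {X : SuspSeq S n} (hX : X ∈ pent) {T : D} (t : X.obj 0 (by omega) ⟶ T)
    (ht : X.δ ≫ S.map t = 0) : ∃ k, t = X.d 0 (Nat.zero_le _) ≫ k := by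
  obtain ⟨k, hk⟩ := (h.isHomExact_δ hn hX).desc (S.map t) ht
  exact ⟨S.preimage k, S.map_injective (by simp [hk])⟩

end IsAngulated

end Angles

/-! ### Invariance of `(n + 2)`-angles under homotopy equivalence -/

section SplitEpi

variable {D : Type u} [Category.{v} D] [Preadditive D]

/-- The morphism `f` is the projection onto a direct summand (with a complement in `D`). -/
def IsProjection {X Y : D} (f : X ⟶ Y) : Prop :=
  ∃ (s : Y ⟶ X) (T : D) (inr : T ⟶ X) (snd : X ⟶ T), IsBiproduct s inr f snd

/-- The section of a projection onto a direct summand may be chosen freely. -/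
theorem IsProjection.isBiproduct {X Y : D} {f : X ⟶ Y} (hf : IsProjection f) {s : Y ⟶ X}
    (hs : s ≫ f = 𝟙 Y) :
    ∃ (T : D) (inr : T ⟶ X) (snd : X ⟶ T), IsBiproduct s inr f snd := by
  obtain ⟨σ, T, κ, π, h⟩ := hf
  refine ⟨T, κ, π - f ≫ s ≫ π, ⟨hs, ?_, h.inr_fst, ?_, ?_⟩⟩
  · rw [Preadditive.comp_sub, reassoc_of% hs, sub_self]
  · rw [Preadditive.comp_sub, reassoc_of% h.inr_fst, h.inr_snd, zero_comp, sub_zero]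
  · have e : π ≫ κ = 𝟙 X - f ≫ σ := by rw [← h.total]; abel
    simp only [Preadditive.sub_comp, Category.assoc, e, Preadditive.comp_sub, Category.comp_id,
      reassoc_of% hs]
    abel

variable {X T Z Y : D} {inl : X ⟶ Z} {inr : T ⟶ Z} {fst : Z ⟶ X} {snd : Z ⟶ T}

theorem IsProjection.desc [HasBinaryBiproducts D] (h : IsBiproduct inl inr fst snd) {f : X ⟶ Y}
    (hf : IsProjection f) (g : T ⟶ Y) : IsProjection (fst ≫ f + snd ≫ g) := by
  obtain ⟨σ, K, κ, π, h'⟩ := hf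
  refine ⟨σ ≫ inl, K ⊞ T, biprod.desc (κ ≫ inl) (inr - g ≫ σ ≫ inl),
    biprod.lift (fst ≫ π) snd, ⟨?_, ?_, ?_, ?_, ?_⟩⟩
  · simp [reassoc_of% h.inl_fst, reassoc_of% h.inl_snd, h'.inl_fst]
  · apply biprod.hom_ext <;>
      simp [reassoc_of% h.inl_fst, h.inl_snd, h'.inl_snd]
  · apply biprod.hom_ext' <;>
      simp [reassoc_of% h.inl_fst, reassoc_of% h.inl_snd, reassoc_of% h.inr_fst,
        reassoc_of% h.inr_snd, h'.inl_fst, h'.inr_fst]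
  · apply biprod.hom_ext' <;> apply biprod.hom_ext <;>
      simp [reassoc_of% h.inl_fst, h.inl_snd, reassoc_of% h.inr_fst, h.inr_snd,
        h'.inl_snd, h'.inr_snd]
  · have e : π ≫ κ = 𝟙 X - f ≫ σ := by rw [← h'.total]; abel
    rw [biprod.lift_desc]
    simp only [Category.assoc, reassoc_of% e, Preadditive.sub_comp, Preadditive.comp_sub,
      Preadditive.add_comp, Category.id_comp]
    rw [← h.total]
    abel

theorem IsProjection.desc_iso (h : IsBiproduct inl inr fst snd) (f : X ⟶ Y) (g : T ≅ Y) :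
    IsProjection (fst ≫ f + snd ≫ g.hom) := by
  refine ⟨g.inv ≫ inr, X, inl - f ≫ g.inv ≫ inr, fst, ⟨?_, ?_, ?_, ?_, ?_⟩⟩
  · simp [reassoc_of% h.inr_fst, reassoc_of% h.inr_snd]
  · simp [h.inr_fst]
  · simp [reassoc_of% h.inl_fst, reassoc_of% h.inl_snd, reassoc_of% h.inr_fst,
      reassoc_of% h.inr_snd]
  · simp [h.inl_fst, h.inr_fst]
  · rw [← h.total]
    simp only [Preadditive.add_comp, Preadditive.comp_sub, Category.assoc, Iso.hom_inv_id_assoc]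
    abel

end SplitEpi

section Angles

variable {D : Type u} [Category.{v} D] {S : D ⥤ D} {n : ℕ} [Preadditive D]

namespace SuspSeq

/-- All consecutive compositions in `X_0 ⟶ ⋯ ⟶ X_{n+1} ⟶ S X_0 ⟶ S X_1` vanish. -/
structure IsPeriodicComplex (X : SuspSeq S n) : Prop where
  d_d : ∀ i (hi : i + 1 ≤ n), X.d i (by omega) ≫ X.d (i + 1) hi = 0
  d_δ : X.d n le_rfl ≫ X.δ = 0
  δ_d : X.δ ≫ S.map (X.d 0 (Nat.zero_le _)) = 0

variable [S.Additive] {T Y : SuspSeq S n} {k : ℕ}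

/-- A morphism out of the first of the two nonzero terms of a trivial sequence determines a morphism
of sequences. -/
theorem IsTrivAt.exists_hom_from (hT : T.IsTrivAt k) (hk : k ≤ n) (hn : 1 ≤ n)
    (hY : Y.IsPeriodicComplex) (u : T.obj k (by omega) ⟶ Y.obj k (by omega)) :
    ∃ ρ : Hom T Y, ρ.f k (by omega) = u ∧
      T.d k hk ≫ ρ.f (k + 1) (Nat.succ_le_succ hk) = u ≫ Y.d k hk := by
  have := hT.isIso hk
  obtain ⟨f, h₁, h₂, -⟩ := exists_update_two (m := n + 1)
    (α := fun i hi => T.obj i hi ⟶ Y.obj i hi) (fun _ _ => 0) (Nat.le_succ_of_le hk)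
    (Nat.succ_le_succ hk) (by omega) u (inv (T.d k hk) ≫ u ≫ Y.d k hk)
  refine ⟨⟨⟨f, fun i hi => ?_⟩, ?_⟩, h₁, ?_⟩
  · by_cases e₁ : i = k
    · subst e₁
      rw [h₁, h₂, IsIso.hom_inv_id_assoc]
    by_cases e₂ : i = k + 1
    · subst e₂
      rw [(hT.isZero (k + 2) (by omega) (by omega) (by omega) (by omega)).eq_of_tgt
        (T.d (k + 1) hi) 0, zero_comp, h₂, Category.assoc, Category.assoc, hY.d_d, comp_zero,
        comp_zero]
    · exact (hT.isZero i (by omega) (by omega) (by omega) (by omega)).eq_of_src _ _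
  · by_cases e : k = n
    · subst e
      have hz := hT.isZero 0 (by omega) (by omega) (by omega) (by omega)
      change T.δ ≫ S.map (f 0 _) = f (k + 1) _ ≫ Y.δ
      rw [hz.eq_of_src (f 0 (Nat.zero_le _)) 0, S.map_zero, comp_zero, h₂, Category.assoc,
        Category.assoc, hY.d_δ, comp_zero, comp_zero]
    · exact (hT.isZero (n + 1) (by omega) (by omega) (by omega) (by omega)).eq_of_src _ _
  · change T.d k hk ≫ f (k + 1) _ = _
    rw [h₂, IsIso.hom_inv_id_assoc]

/-- A morphism into the second of the two nonzero terms of a trivial sequence determines a morphism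
of sequences. -/
theorem IsTrivAt.exists_hom_to (hT : T.IsTrivAt k) (hk : k ≤ n) (hn : 1 ≤ n)
    (hY : Y.IsPeriodicComplex)
    (v : Y.obj (k + 1) (Nat.succ_le_succ hk) ⟶ T.obj (k + 1) (Nat.succ_le_succ hk)) :
    ∃ σ : Hom Y T, σ.f (k + 1) (by omega) = v ∧
      σ.f k (Nat.le_succ_of_le hk) ≫ T.d k hk = Y.d k hk ≫ v := by
  have := hT.isIso hk
  obtain ⟨f, h₁, h₂, -⟩ := exists_update_two (m := n + 1)
    (α := fun i hi => Y.obj i hi ⟶ T.obj i hi) (fun _ _ => 0) (Nat.le_succ_of_le hk)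
    (Nat.succ_le_succ hk) (by omega) (Y.d k hk ≫ v ≫ inv (T.d k hk)) v
  refine ⟨⟨⟨f, fun i hi => ?_⟩, ?_⟩, h₂, ?_⟩
  · by_cases e₁ : i = k
    · subst e₁
      simp [h₁, h₂]
    by_cases e₂ : i + 1 = k
    · subst e₂
      rw [(hT.isZero i (by omega) (by omega) (by omega) (by omega)).eq_of_tgt (f i _) 0,
        zero_comp, h₁, reassoc_of% hY.d_d i hk, zero_comp]
    · exact (hT.isZero (i + 1) (by omega) (by omega) (by omega) (by omega)).eq_of_tgt _ _
  · by_cases e : k = 0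
    · subst e
      have hz := hT.isZero (n + 1) (by omega) (by omega) (by omega) (by omega)
      change Y.δ ≫ S.map (f 0 _) = f (n + 1) _ ≫ T.δ
      rw [hz.eq_of_tgt (f (n + 1) le_rfl) 0, zero_comp, h₁, S.map_comp,
        reassoc_of% hY.δ_d, zero_comp]
    · have hz := hT.isZero 0 (by omega) (by omega) (by omega) (by omega)
      change Y.δ ≫ S.map (f 0 _) = f (n + 1) _ ≫ T.δ
      rw [hz.eq_of_tgt (f 0 (Nat.zero_le _)) 0, S.map_zero, comp_zero]
      have : S.map (𝟙 (T.obj 0 (Nat.zero_le _))) = 0 := by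
        rw [hz.eq_of_src (𝟙 _) 0, S.map_zero]
      rw [← Category.comp_id T.δ, ← S.map_id, this, comp_zero, comp_zero]
  · change f k _ ≫ _ = _
    rw [h₁]
    simp

end SuspSeq

namespace IsAngulated

open SuspSeq ZeroObject

variable {pent : Set (SuspSeq S n)} [S.IsEquivalence] [S.Additive] [HasFiniteBiproducts D]
  (h : IsAngulated n S pent) (hn : 1 ≤ n)
include h hn

/-- If a periodic complex `Y` is a retract up to homotopy of an `(n + 2)`-angle, then it is an
`(n + 2)`-angle. Here the homotopy vanishes on the connecting degree, and the projection is
assumed to be a projection onto a direct summand in degree `n + 1`.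

Adding rotated trivial angles `Y_k = Y_k` to the `(n + 2)`-angle for `k = 0, …, n` kills the
components of the homotopy one by one, and makes the projection degreewise a projection onto a
direct summand. -/
theorem mem_of_homotopy_retract {X Y : SuspSeq S n} (hX : X ∈ pent) (hY : Y.IsPeriodicComplex)
    (φ : Hom X Y) (ψ : Hom Y X) (H : ∀ (i : ℕ) (hi : i ≤ n),
      Y.obj (i + 1) (Nat.succ_le_succ hi) ⟶ Y.obj i (Nat.le_succ_of_le hi))
    (h₀ : 𝟙 _ - ψ.f 0 (Nat.zero_le _) ≫ φ.f 0 (Nat.zero_le _) =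
      Y.d 0 (Nat.zero_le _) ≫ H 0 (Nat.zero_le _))
    (hs : ∀ (i : ℕ) (hi : i + 1 ≤ n),
      𝟙 _ - ψ.f (i + 1) (Nat.le_succ_of_le hi) ≫ φ.f (i + 1) (Nat.le_succ_of_le hi) =
        Y.d (i + 1) hi ≫ H (i + 1) hi + H i (Nat.le_of_lt hi) ≫ Y.d i (Nat.le_of_lt hi))
    (hl : 𝟙 _ - ψ.f (n + 1) le_rfl ≫ φ.f (n + 1) le_rfl = H n le_rfl ≫ Y.d n le_rfl)
    (hφ : IsProjection (φ.f (n + 1) le_rfl)) : Y ∈ pent := by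
  have := hasBinaryBiproducts_of_finite_biproducts D
  have key : ∀ m ≤ n + 1, ∃ X ∈ pent, ∃ (φ : Hom X Y) (ψ : Hom Y X),
      IsProjection (φ.f (n + 1) le_rfl) ∧
      (∀ i hi, i < m → IsProjection (φ.f i hi) ∧ ψ.f i hi ≫ φ.f i hi = 𝟙 _) ∧
      (∀ hm : m ≤ n, 𝟙 _ - ψ.f m (Nat.le_succ_of_le hm) ≫ φ.f m (Nat.le_succ_of_le hm) =
        Y.d m hm ≫ H m hm) ∧
      (∀ (i : ℕ) (hi : i + 1 ≤ n), m ≤ i →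
        𝟙 _ - ψ.f (i + 1) (Nat.le_succ_of_le hi) ≫ φ.f (i + 1) (Nat.le_succ_of_le hi) =
          Y.d (i + 1) hi ≫ H (i + 1) hi + H i (Nat.le_of_lt hi) ≫ Y.d i (Nat.le_of_lt hi)) ∧
      (m ≤ n → 𝟙 _ - ψ.f (n + 1) le_rfl ≫ φ.f (n + 1) le_rfl = H n le_rfl ≫ Y.d n le_rfl) ∧
      (m = n + 1 → ψ.f (n + 1) le_rfl ≫ φ.f (n + 1) le_rfl = 𝟙 _) := by
    intro m
    induction m with
    | zero =>
      intro _
      exact ⟨X, hX, φ, ψ, hφ, fun i hi h => absurd h (Nat.not_lt_zero i), fun _ => h₀,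
        fun i hi _ => hs i hi, fun _ => hl, fun h => by omega⟩
    | succ m ih =>
      intro hm
      have hm' : m ≤ n := by omega
      obtain ⟨X, hX, φ, ψ, hφ, ha, hφm, hc, hd, -⟩ := ih (by omega)
      obtain ⟨T, hT, hT', ⟨τ⟩⟩ := h.exists_isTrivAt (Y.obj m (by omega)) (k := m) (by omega)
      have := hT'.isIso hm'
      obtain ⟨ρ, hρ, hρ'⟩ := hT'.exists_hom_from hm' hn hY τ.hom
      obtain ⟨σ, hσ, hσ'⟩ := hT'.exists_hom_to hm' hn hY (H m hm' ≫ τ.inv ≫ T.d m hm')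
      have e₁ : σ.f m (by omega) ≫ ρ.f m (by omega) = Y.d m hm' ≫ H m hm' := by
        rw [hρ, ← cancel_mono τ.inv, Category.assoc, Iso.hom_inv_id, Category.comp_id,
          ← cancel_mono (T.d m hm'), hσ']
        simp
      have e₂ : σ.f (m + 1) (by omega) ≫ ρ.f (m + 1) (by omega) = H m hm' ≫ Y.d m hm' := by
        rw [hσ, Category.assoc, Category.assoc, hρ', Iso.inv_hom_id_assoc]
      have e₃ : ∀ i hi, i ≠ m → i ≠ m + 1 → σ.f i hi ≫ ρ.f i hi = 0 := fun i hi h₁ h₂ => by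
        rw [(hT'.isZero i hi h₁ h₂ (by omega)).eq_of_src (ρ.f i hi) 0, comp_zero]
      obtain ⟨Z, hZ, inl, inr, fst, snd, hb⟩ := h.exists_sum hX hT
      have e₄ : ∀ i hi, (ψ.f i hi ≫ inl.f i hi + σ.f i hi ≫ inr.f i hi) ≫
          (fst.f i hi ≫ φ.f i hi + snd.f i hi ≫ ρ.f i hi) =
          ψ.f i hi ≫ φ.f i hi + σ.f i hi ≫ ρ.f i hi := fun i hi => by
        simp [reassoc_of% (hb i hi).inl_fst, reassoc_of% (hb i hi).inl_snd,
          reassoc_of% (hb i hi).inr_fst, reassoc_of% (hb i hi).inr_snd]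
      refine ⟨Z, hZ, (fst.comp' φ).add (snd.comp' ρ), (ψ.comp' inl).add (σ.comp' inr),
        IsProjection.desc (hb _ _) hφ _, fun i hi him => ⟨?_, ?_⟩, fun h => ?_, fun i hi him => ?_,
        fun h => ?_, fun h => ?_⟩
      all_goals simp only [Hom.add_f, Hom.comp'_f, e₄]
      · by_cases him' : i = m
        · subst him'
          rw [hρ]
          exact IsProjection.desc_iso (hb _ _) _ _
        · exact IsProjection.desc (hb _ _) (ha i hi (by omega)).1 _
      · by_cases him' : i = m
        · subst him'
          rw [e₁, ← hφm hm']
          abel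
        · rw [e₃ i hi him' (by omega), add_zero, (ha i hi (by omega)).2]
      · rw [e₂, ← sub_sub, hc m h le_rfl, add_sub_cancel_right]
      · rw [e₃ _ _ (by omega) (by omega), add_zero, hc i hi (by omega)]
      · rw [e₃ _ _ (by omega) (by omega), add_zero, hd (by omega)]
      · obtain rfl : m = n := by omega
        rw [e₂, ← hd le_rfl]
        abel
  obtain ⟨X, hX, φ, ψ, hφ, ha, -, -, -, hl⟩ := key (n + 1) le_rfl
  refine h.mem_of_retract hX ψ φ fun i hi => ?_
  rcases hi.lt_or_eq with hi' | rfl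
  · exact (ha i hi hi').1.isBiproduct (ha i hi hi').2
  · exact hφ.isBiproduct (hl rfl)

end IsAngulated

end Angles

/-! ### Lifts of identities are homotopy equivalences -/

section Homotopy

/-- Dependent choice along `{0, …, m}`. -/
theorem exists_dependent_sequence {m : ℕ} {α : ∀ i : ℕ, i ≤ m → Sort*}
    (Q : ∀ i hi, α i hi → Prop)
    (R : ∀ (i : ℕ) (hi : i + 1 ≤ m), α i (Nat.le_of_lt hi) → α (i + 1) hi → Prop)
    (a : α 0 (Nat.zero_le _)) (ha : Q 0 _ a)
    (step : ∀ i hi a, Q i (Nat.le_of_lt hi) a → ∃ b, Q (i + 1) hi b ∧ R i hi a b) :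
    ∃ f : ∀ i hi, α i hi, f 0 (Nat.zero_le _) = a ∧
      ∀ (i : ℕ) (hi : i + 1 ≤ m), R i hi (f i (Nat.le_of_lt hi)) (f (i + 1) hi) := by
  choose b hb hR using step
  let F : ∀ i hi, {x : α i hi // Q i hi x} := fun i =>
    Nat.rec (motive := fun i => ∀ hi, {x : α i hi // Q i hi x}) (fun _ => ⟨a, ha⟩)
      (fun i F hi => ⟨b i hi (F (Nat.le_of_lt hi)).1 (F (Nat.le_of_lt hi)).2, hb _ _ _ _⟩) i
  exact ⟨fun i hi => (F i hi).1, rfl, fun i hi => hR _ _ _ (F i (Nat.le_of_lt hi)).2⟩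

variable {D : Type u} [Category.{v} D] [Preadditive D] {n : ℕ}

/-- An endomorphism of an exact sequence which vanishes at both ends has a null homotopic square:
it is of the form `d h + h d` except in the last degree, where it vanishes, and composing with the
endomorphism makes `d h + h d` vanish in the last degree, too. -/
theorem Seq.exists_homotopy_sq (X : Seq D n) (hX' : X.IsComplex)
    (hX : ∀ (i : ℕ) (hi : i + 1 ≤ n) {T : D} (t : X.obj (i + 1) (Nat.le_succ_of_le hi) ⟶ T),
      X.d i (by omega) ≫ t = 0 → ∃ k, t = X.d (i + 1) hi ≫ k)
    (α : Seq.Hom X X) (h₀ : α.f 0 (Nat.zero_le _) = 0) (hl : α.f (n + 1) le_rfl = 0) :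
    ∃ h : ∀ (i : ℕ) (hi : i ≤ n), X.obj (i + 1) (Nat.succ_le_succ hi) ⟶
      X.obj i (Nat.le_succ_of_le hi),
    h 0 (Nat.zero_le _) = 0 ∧
    (∀ (i : ℕ) (hi : i + 1 ≤ n),
      α.f (i + 1) (Nat.le_succ_of_le hi) ≫ α.f (i + 1) (Nat.le_succ_of_le hi) =
        X.d (i + 1) hi ≫ h (i + 1) hi + h i (Nat.le_of_lt hi) ≫ X.d i (Nat.le_of_lt hi)) ∧
    h n le_rfl ≫ X.d n le_rfl = 0 := by
  obtain ⟨h, h0, hs⟩ := exists_dependent_sequence (m := n)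
    (α := fun i hi => X.obj (i + 1) (Nat.succ_le_succ hi) ⟶ X.obj i (Nat.le_succ_of_le hi))
    (fun i hi a => X.d i hi ≫ (α.f (i + 1) (Nat.succ_le_succ hi) - a ≫ X.d i hi) = 0)
    (fun i hi a b => α.f (i + 1) (Nat.le_succ_of_le hi) =
      X.d (i + 1) hi ≫ b + a ≫ X.d i (Nat.le_of_lt hi)) 0
    (by rw [zero_comp, sub_zero, α.comm, h₀, zero_comp]) (fun i hi a ha => by
      obtain ⟨b, hb⟩ := hX i hi _ ha
      rw [sub_eq_iff_eq_add] at hb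
      refine ⟨b, ?_, hb⟩
      rw [Preadditive.comp_sub, α.comm, hb, Preadditive.add_comp, Category.assoc, Category.assoc,
        hX', comp_zero, add_zero, sub_self])
  refine ⟨fun i hi => h i hi ≫ α.f i (Nat.le_succ_of_le hi), ?_, fun i hi => ?_, ?_⟩
  · simp [h0]
  · refine (congrArg (· ≫ α.f (i + 1) _) (hs i hi)).trans ?_
    simp only [Preadditive.add_comp, Category.assoc, α.comm]
  · rw [Category.assoc, ← α.comm, hl, comp_zero, comp_zero]

/-- If `φ` and `ψ` are morphisms in opposite directions between exact complexes with fixed ends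
which are the identity on the ends, then the complexes are homotopy equivalent: with
`α = φ ψ - 1`, the morphism `ψ - ψ α` is inverse to `φ` up to homotopy, because `α²` is null
homotopic. -/
theorem Cplx.homotopyEquivalent_of_lifts {A C : D} (X Y : Cplx n A C)
    (hX : ∀ (i : ℕ) (hi : i + 1 ≤ n) {T : D} (t : X.obj (i + 1) (Nat.le_succ_of_le hi) ⟶ T),
      X.d i (by omega) ≫ t = 0 → ∃ k, t = X.d (i + 1) hi ≫ k)
    (hY : ∀ (i : ℕ) (hi : i + 1 ≤ n) {T : D} (t : Y.obj (i + 1) (Nat.le_succ_of_le hi) ⟶ T),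
      Y.d i (by omega) ≫ t = 0 → ∃ k, t = Y.d (i + 1) hi ≫ k)
    (φ : Seq.Hom X.toSeq Y.toSeq) (ψ : Seq.Hom Y.toSeq X.toSeq)
    (hφ : Cplx.IsLift φ (𝟙 A) (𝟙 C)) (hψ : Cplx.IsLift ψ (𝟙 A) (𝟙 C)) :
    X.HomotopyEquivalent Y := by
  have main : ∀ (X Y : Cplx n A C), (∀ (i : ℕ) (hi : i + 1 ≤ n) {T : D}
      (t : X.obj (i + 1) (Nat.le_succ_of_le hi) ⟶ T),
      X.d i (by omega) ≫ t = 0 → ∃ k, t = X.d (i + 1) hi ≫ k) →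
      ∀ (φ : Seq.Hom X.toSeq Y.toSeq) (ψ : Seq.Hom Y.toSeq X.toSeq),
      Cplx.IsLift φ (𝟙 A) (𝟙 C) → Cplx.IsLift ψ (𝟙 A) (𝟙 C) →
      φ.f 0 (Nat.zero_le _) ≫ ψ.f 0 (Nat.zero_le _) = 𝟙 _ ∧
      φ.f (n + 1) le_rfl ≫ ψ.f (n + 1) le_rfl = 𝟙 _ ∧
      ∀ χ : Seq.Hom X.toSeq X.toSeq, (∀ i hi, χ.f i hi =
        𝟙 _ - (φ.f i hi ≫ ψ.f i hi - 𝟙 _) ≫ (φ.f i hi ≫ ψ.f i hi - 𝟙 _)) →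
        Seq.Homotopic χ (Seq.Hom.id X.toSeq) := by
    intro X Y hX φ ψ hφ hψ
    have e₀ : φ.f 0 (Nat.zero_le _) ≫ ψ.f 0 (Nat.zero_le _) = 𝟙 _ := by
      rw [← cancel_mono X.left.hom, Category.assoc, hψ.left, reassoc_of% hφ.left]
      simp
    have e₁ : φ.f (n + 1) le_rfl ≫ ψ.f (n + 1) le_rfl = 𝟙 _ := by
      rw [← cancel_mono X.right.hom, Category.assoc, hψ.right, reassoc_of% hφ.right]
      simp
    refine ⟨e₀, e₁, fun χ hχ => ?_⟩
    obtain ⟨h, h₀, hs, hl⟩ := X.toSeq.exists_homotopy_sq X.isComplex hX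
      ⟨fun i hi => φ.f i hi ≫ ψ.f i hi - 𝟙 _, fun i hi => by
        simp only [Preadditive.comp_sub, Preadditive.sub_comp, Category.comp_id, Category.id_comp,
          Category.assoc, ← ψ.comm]
        rw [reassoc_of% φ.comm]⟩ (by simp [e₀]) (by simp [e₁])
    refine ⟨fun i hi => -h i hi, ?_, fun i hi => ?_, ?_⟩
    · simp [hχ, e₀, h₀, Seq.Hom.id]
    · rw [hχ, hs i hi]
      simp only [Seq.Hom.id, Preadditive.comp_neg, Preadditive.neg_comp]
      abel
    · simp [hχ, e₁, hl, Seq.Hom.id]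
  obtain ⟨x₀, x₁, hx⟩ := main X Y hX φ ψ hφ hψ
  obtain ⟨y₀, y₁, hy⟩ := main Y X hY ψ φ hψ hφ
  refine ⟨φ, ⟨fun i hi => ψ.f i hi + ψ.f i hi - ψ.f i hi ≫ φ.f i hi ≫ ψ.f i hi, fun i hi => ?_⟩,
    hφ, ⟨?_, ?_⟩, hx _ fun i hi => ?_, hy _ fun i hi => ?_⟩
  · simp only [Preadditive.comp_sub, Preadditive.comp_add, Preadditive.sub_comp,
      Preadditive.add_comp, Category.assoc, ← ψ.comm]
    rw [← reassoc_of% φ.comm, ← reassoc_of% ψ.comm]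
  · simp only [x₀, Category.comp_id, add_sub_cancel_right]
    simpa using hψ.left
  · simp only [x₁, Category.comp_id, add_sub_cancel_right]
    simpa using hψ.right
  all_goals
    simp only [Seq.Hom.comp, Preadditive.comp_sub, Preadditive.comp_add, Preadditive.sub_comp,
      Preadditive.add_comp, Category.assoc, Category.comp_id, Category.id_comp]
    abel

end Homotopy

/-! ### Sequences in the subcategory -/

section Subcategory

variable {D : Type u} [Category.{v} D] [Preadditive D] {S : D ⥤ D} {n : ℕ}
  {P : ObjectProperty D}

theorem isZero_obj {Z : P.FullSubcategory} (hZ : IsZero Z) : IsZero Z.obj := by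
  rw [IsZero.iff_id_eq_zero] at hZ ⊢
  exact congrArg InducedCategory.Hom.hom hZ

/-- A morphism of complexes in the subcategory which is compatible with the extensions induces a
morphism of `(n + 2)`-`S`-sequences. -/
def suspHom {A B C E : P.FullSubcategory} {X : Cplx n A C} {Y : Cplx n B E}
    {δ : C.obj ⟶ S.obj A.obj} {ρ : E.obj ⟶ S.obj B.obj} (φ : Seq.Hom X.toSeq Y.toSeq) {a : A ⟶ B}
    {c : C ⟶ E} (hφ : Cplx.IsLift φ a c) (h : δ ≫ S.map a.hom = c.hom ≫ ρ) :
    SuspSeq.Hom (toSuspSeq X δ) (toSuspSeq Y ρ) where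
  f i hi := (φ.f i hi).hom
  comm i hi := congrArg InducedCategory.Hom.hom (φ.comm i hi)
  comm_δ := by
    have h₁ : X.left.inv ≫ φ.f 0 (Nat.zero_le _) = a ≫ Y.left.inv := by
      rw [Iso.inv_comp_eq, ← Category.assoc, ← hφ.left, Category.assoc, Iso.hom_inv_id,
        Category.comp_id]
    have h₁' : X.left.inv.hom ≫ (φ.f 0 (Nat.zero_le _)).hom = a.hom ≫ Y.left.inv.hom :=
      congrArg InducedCategory.Hom.hom h₁
    have h₂ : (φ.f (n + 1) le_rfl).hom ≫ Y.right.hom.hom = X.right.hom.hom ≫ c.hom :=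
      congrArg InducedCategory.Hom.hom hφ.right
    change (X.right.hom.hom ≫ δ ≫ S.map X.left.inv.hom) ≫ S.map (φ.f 0 _).hom =
      (φ.f (n + 1) _).hom ≫ Y.right.hom.hom ≫ ρ ≫ S.map Y.left.inv.hom
    rw [reassoc_of% h₂, ← reassoc_of% h, ← S.map_comp, ← h₁', S.map_comp]
    simp only [Category.assoc]

/-- A morphism of `(n + 2)`-`S`-sequences with terms in the subcategory is a morphism of complexes
in the subcategory. -/
def seqHom {A B C E : P.FullSubcategory} {X : Cplx n A C} {Y : Cplx n B E}
    {δ : C.obj ⟶ S.obj A.obj} {ρ : E.obj ⟶ S.obj B.obj}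
    (φ : SuspSeq.Hom (toSuspSeq X δ) (toSuspSeq Y ρ)) : Seq.Hom X.toSeq Y.toSeq where
  f i hi := ObjectProperty.homMk (φ.f i hi)
  comm i hi := ObjectProperty.hom_ext _ (φ.comm i hi)

/-- A periodic complex with terms in the subcategory gives a complex in the subcategory. -/
def SuspSeq.toCplx (X : SuspSeq S n) (hX : ∀ (i : ℕ) (hi : i + 1 ≤ n),
      X.d i (Nat.le_of_lt hi) ≫ X.d (i + 1) hi = 0)
    (hP : ∀ i hi, P (X.obj i hi)) {A C : P.FullSubcategory}
    (e₀ : X.obj 0 (Nat.zero_le _) ≅ A.obj) (e₁ : X.obj (n + 1) le_rfl ≅ C.obj) : Cplx n A C where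
  obj i hi := ⟨X.obj i hi, hP i hi⟩
  d i hi := ObjectProperty.homMk (X.d i hi)
  isComplex i hi := ObjectProperty.hom_ext _ (hX i hi)
  left := P.isoMk e₀
  right := P.isoMk e₁

theorem SuspSeq.toSuspSeq_toCplx (X : SuspSeq S n) (hX : ∀ (i : ℕ) (hi : i + 1 ≤ n),
      X.d i (Nat.le_of_lt hi) ≫ X.d (i + 1) hi = 0)
    (hP : ∀ i hi, P (X.obj i hi)) {A C : P.FullSubcategory}
    (e₀ : X.obj 0 (Nat.zero_le _) ≅ A.obj) (e₁ : X.obj (n + 1) le_rfl ≅ C.obj)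
    (δ : C.obj ⟶ S.obj A.obj) (h : X.δ ≫ S.map e₀.hom = e₁.hom ≫ δ) :
    toSuspSeq (X.toCplx hX hP e₀ e₁) δ = X := by
  obtain ⟨X, δ'⟩ := X
  have : e₁.hom ≫ δ ≫ S.map e₀.inv = δ' := by
    rw [← reassoc_of% h, ← S.map_comp, Iso.hom_inv_id, S.map_id, Category.comp_id]
  exact congrArg (SuspSeq.mk X) this

namespace IsAngulated

open SuspSeq ZeroObject

variable {pent : Set (SuspSeq S n)}

theorem mem_of_isTrivFirst (h : IsAngulated n S pent) {A Z : P.FullSubcategory} {X : Cplx n A Z}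
    (hX : X.IsTrivFirst) (δ : Z.obj ⟶ S.obj A.obj) : toSuspSeq X δ ∈ pent := by
  have := hX.isIso
  exact h.trivial _ ⟨inferInstanceAs (IsIso (X.d 0 (Nat.zero_le _)).hom),
    fun i hi h₂ => isZero_obj (hX.isZero i hi h₂)⟩

variable [S.IsEquivalence] [S.Additive] (h : IsAngulated n S pent)
include h

/-- A morphism of extensions lifts to a morphism of `(n + 2)`-angles with a cone that is an
`(n + 2)`-angle. -/
theorem exists_lift_toSuspSeq {A B C E : P.FullSubcategory} {X : Cplx n A C} {Y : Cplx n B E}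
    {δ : C.obj ⟶ S.obj A.obj} {ρ : E.obj ⟶ S.obj B.obj} (hX : toSuspSeq X δ ∈ pent)
    (hY : toSuspSeq Y ρ ∈ pent) (a : A ⟶ B) (c : C ⟶ E)
    (hac : δ ≫ S.map a.hom = c.hom ≫ ρ) :
    ∃ (φ : SuspSeq.Hom (toSuspSeq X δ) (toSuspSeq Y ρ)), Cplx.IsLift (seqHom φ) a c ∧
      ∃ M ∈ pent, Nonempty (RotCone φ M) := by
  obtain ⟨φ, h₀, h₁, hM⟩ := h.complete_ends_cone hX hY
    (X.left.hom ≫ a ≫ Y.left.inv).hom (X.right.hom ≫ c ≫ Y.right.inv).hom (by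
      change (X.right.hom.hom ≫ δ ≫ S.map X.left.inv.hom) ≫
          S.map (X.left.hom.hom ≫ a.hom ≫ Y.left.inv.hom) =
        (X.right.hom.hom ≫ c.hom ≫ Y.right.inv.hom) ≫ Y.right.hom.hom ≫ ρ ≫ S.map Y.left.inv.hom
      simp only [Category.assoc, S.map_comp]
      rw [ObjectProperty.isoInv_hom_id_hom_assoc, ← S.map_comp_assoc X.left.inv.hom,
        ObjectProperty.isoInv_hom_id_hom, S.map_id, Category.id_comp, reassoc_of% hac])
  refine ⟨φ, ⟨?_, ?_⟩, hM⟩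
  · have : (seqHom φ).f 0 (Nat.zero_le _) = X.left.hom ≫ a ≫ Y.left.inv :=
      ObjectProperty.hom_ext _ h₀
    rw [this]
    simp
  · have : (seqHom φ).f (n + 1) le_rfl = X.right.hom ≫ c ≫ Y.right.inv :=
      ObjectProperty.hom_ext _ h₁
    rw [this]
    simp

theorem mem_of_isTrivLast {Z C : P.FullSubcategory} {X : Cplx n Z C} (hX : X.IsTrivLast)
    (δ : C.obj ⟶ S.obj Z.obj) : toSuspSeq X δ ∈ pent := by
  have := hX.isIso
  exact h.isTrivAt_mem (k := n) (by omega) ⟨fun _ => inferInstanceAs (IsIso (X.d n le_rfl).hom),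
    fun h => by omega, fun i hi h₁ h₂ _ => isZero_obj (hX.isZero i (by omega))⟩

variable [HasFiniteBiproducts D] (hn : 1 ≤ n)
include hn

theorem isPeriodicComplex {X : SuspSeq S n} (hX : X ∈ pent) : X.IsPeriodicComplex where
  d_d i hi := (h.isHomExact hn hX i hi).zero
  d_δ := (h.isHomExact_last hn hX).zero
  δ_d := (h.isHomExact_δ hn hX).zero

theorem desc_toSuspSeq {A C : P.FullSubcategory} {X : Cplx n A C} {δ : C.obj ⟶ S.obj A.obj}
    (hX : toSuspSeq X δ ∈ pent) (i : ℕ) (hi : i + 1 ≤ n) {T : P.FullSubcategory}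
    (t : X.obj (i + 1) (Nat.le_succ_of_le hi) ⟶ T)
    (ht : X.d i (Nat.le_of_lt hi) ≫ t = 0) : ∃ k, t = X.d (i + 1) hi ≫ k := by
  obtain ⟨k, hk⟩ := (h.isHomExact hn hX i hi).desc t.hom (congrArg InducedCategory.Hom.hom ht)
  exact ⟨ObjectProperty.homMk k, ObjectProperty.hom_ext _ hk⟩

/-- Two `(n + 2)`-angles realizing the same extension are homotopy equivalent. -/
theorem homotopyEquivalent_of_mem {A C : P.FullSubcategory} {X Y : Cplx n A C}
    {δ : C.obj ⟶ S.obj A.obj} (hX : toSuspSeq X δ ∈ pent) (hY : toSuspSeq Y δ ∈ pent) :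
    X.HomotopyEquivalent Y := by
  obtain ⟨φ, hφ, -⟩ := h.exists_lift_toSuspSeq hX hY (𝟙 A) (𝟙 C) (by simp)
  obtain ⟨ψ, hψ, -⟩ := h.exists_lift_toSuspSeq hY hX (𝟙 A) (𝟙 C) (by simp)
  exact X.homotopyEquivalent_of_lifts Y (fun i hi T t => h.desc_toSuspSeq hn hX i hi t)
    (fun i hi T t => h.desc_toSuspSeq hn hY i hi t) _ _ hφ hψ

/-- The `(n + 2)`-angles with terms in the subcategory realizing a given extension are closed
under homotopy equivalence. -/
theorem mem_of_homotopyEquivalent {A C : P.FullSubcategory} {X Y : Cplx n A C}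
    {δ : C.obj ⟶ S.obj A.obj} (hX : toSuspSeq X δ ∈ pent) (hXY : X.HomotopyEquivalent Y) :
    toSuspSeq Y δ ∈ pent := by
  obtain ⟨φ, ψ, hφ, hψ, -, H, H₀, Hs, Hl⟩ := hXY
  let Φ : SuspSeq.Hom (toSuspSeq X δ) (toSuspSeq Y δ) := suspHom φ hφ (by simp)
  let Ψ : SuspSeq.Hom (toSuspSeq Y δ) (toSuspSeq X δ) := suspHom ψ hψ (by simp)
  have iso : ∀ {X Y : Cplx n A C} (χ : Seq.Hom X.toSeq Y.toSeq), Cplx.IsLift χ (𝟙 A) (𝟙 C) →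
      IsIso (χ.f 0 (Nat.zero_le _)) ∧ IsIso (χ.f (n + 1) le_rfl) := fun {X Y} χ hχ => by
    have e₀ : χ.f 0 (Nat.zero_le _) = X.left.hom ≫ Y.left.inv := by
      rw [Iso.eq_comp_inv, hχ.left, Category.comp_id]
    have e₁ : χ.f (n + 1) le_rfl = X.right.hom ≫ Y.right.inv := by
      rw [Iso.eq_comp_inv, hχ.right, Category.comp_id]
    rw [e₀, e₁]
    exact ⟨inferInstance, inferInstance⟩
  obtain ⟨i₀, i₁⟩ := iso φ hφ
  obtain ⟨j₀, j₁⟩ := iso ψ hψ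
  have k₁ : IsIso (Φ.f (n + 1) le_rfl) := inferInstanceAs (IsIso (φ.f (n + 1) le_rfl).hom)
  have l₀ : IsIso (Ψ.f 0 (Nat.zero_le _)) := inferInstanceAs (IsIso (ψ.f 0 (Nat.zero_le _)).hom)
  have hX' := h.isPeriodicComplex hn hX
  have hY' : (toSuspSeq Y δ).IsPeriodicComplex :=
    { d_d := fun i hi => congrArg InducedCategory.Hom.hom (Y.isComplex i hi)
      d_δ := by
        rw [← cancel_mono (S.map (Ψ.f 0 (Nat.zero_le _))), Category.assoc, Ψ.comm_δ, zero_comp,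
          reassoc_of% Ψ.comm n le_rfl, hX'.d_δ, comp_zero]
      δ_d := by
        rw [← cancel_epi (Φ.f (n + 1) le_rfl), ← reassoc_of% Φ.comm_δ, ← S.map_comp,
          ← Φ.comm 0, S.map_comp, reassoc_of% hX'.δ_d, zero_comp, comp_zero] }
  let H' : ∀ (i : ℕ) (hi : i ≤ n), (toSuspSeq Y δ).obj (i + 1) (Nat.succ_le_succ hi) ⟶
    (toSuspSeq Y δ).obj i (Nat.le_succ_of_le hi) := fun i hi => (H i hi).hom
  have H₀' : Ψ.f 0 (Nat.zero_le _) ≫ Φ.f 0 (Nat.zero_le _) - 𝟙 _ =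
      (toSuspSeq Y δ).d 0 (Nat.zero_le _) ≫ H' 0 (Nat.zero_le _) :=
    congrArg InducedCategory.Hom.hom H₀
  have Hs' : ∀ (i : ℕ) (hi : i + 1 ≤ n),
      Ψ.f (i + 1) (Nat.le_succ_of_le hi) ≫ Φ.f (i + 1) (Nat.le_succ_of_le hi) - 𝟙 _ =
        (toSuspSeq Y δ).d (i + 1) hi ≫ H' (i + 1) hi +
          H' i (Nat.le_of_lt hi) ≫ (toSuspSeq Y δ).d i (Nat.le_of_lt hi) :=
    fun i hi => congrArg InducedCategory.Hom.hom (Hs i hi)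
  have Hl' : Ψ.f (n + 1) le_rfl ≫ Φ.f (n + 1) le_rfl - 𝟙 _ =
      H' n le_rfl ≫ (toSuspSeq Y δ).d n le_rfl := congrArg InducedCategory.Hom.hom Hl
  refine h.mem_of_homotopy_retract hn hX hY' Φ Ψ (fun i hi => -H' i hi) ?_ (fun i hi => ?_) ?_
    ⟨inv (Φ.f (n + 1) le_rfl), 0, 0, 0, by simp, by simp, by simp, by simp, by simp⟩
  · rw [← neg_sub, Preadditive.comp_neg, H₀']
  · rw [← neg_sub, Preadditive.comp_neg, Preadditive.neg_comp, ← neg_add, Hs' i hi]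
  · rw [← neg_sub, Preadditive.neg_comp, Hl']

/-- The homotopy class of an `(n + 2)`-angle consists of all `(n + 2)`-angles with the same
extension. -/
theorem inducedRealization_iff {A C : P.FullSubcategory} (δ : C.obj ⟶ S.obj A.obj)
    (Y : Cplx n A C) : inducedRealization pent P δ Y ↔ toSuspSeq Y δ ∈ pent :=
  ⟨fun ⟨_, hX, hXY⟩ => h.mem_of_homotopyEquivalent hn hX hXY,
    fun hY => ⟨Y, hY, h.homotopyEquivalent_of_mem hn hY hY⟩⟩

theorem isExangle_of_mem {A C : P.FullSubcategory} {X : Cplx n A C} {δ : C.obj ⟶ S.obj A.obj}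
    (hX : toSuspSeq X δ ∈ pent) : IsExangle (restrictedHomSusp S P) X δ where
  push_eq_zero := by
    change δ ≫ S.map (X.left.inv.hom ≫ (X.d 0 _).hom) = 0
    have := (h.isHomExact_δ hn hX).zero
    change (X.right.hom.hom ≫ δ ≫ S.map X.left.inv.hom) ≫ S.map (X.d 0 _).hom = 0 at this
    rw [← cancel_epi X.right.hom.hom, comp_zero, S.map_comp]
    simpa using this
  pull_eq_zero := by
    change ((X.d n _).hom ≫ X.right.hom.hom) ≫ δ = 0
    have := (h.isHomExact_last hn hX).zero
    change (X.d n _).hom ≫ X.right.hom.hom ≫ δ ≫ S.map X.left.inv.hom = 0 at this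
    rw [← cancel_mono (S.map X.left.inv.hom), zero_comp]
    simpa using this
  exact_cov T i hi t := by
    constructor
    · intro ht
      obtain ⟨k, hk⟩ := (h.isHomExact hn hX i hi).lift t.hom
        (congrArg InducedCategory.Hom.hom ht)
      exact ⟨ObjectProperty.homMk k, ObjectProperty.hom_ext _ hk.symm⟩
    · rintro ⟨k, rfl⟩
      exact (Category.assoc _ _ _).trans (by rw [X.isComplex, comp_zero])
  exact_cov_last T t := by
    have key : pull (restrictedHomSusp S P) (t ≫ X.right.hom) δ = 0 ↔
        t.hom ≫ (toSuspSeq X δ).δ = 0 := by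
      change (t.hom ≫ X.right.hom.hom) ≫ δ = 0 ↔
        t.hom ≫ X.right.hom.hom ≫ δ ≫ S.map X.left.inv.hom = 0
      rw [← cancel_mono (S.map X.left.inv.hom), zero_comp, Category.assoc, Category.assoc]
    rw [key]
    constructor
    · intro ht
      obtain ⟨k, hk⟩ := (h.isHomExact_last hn hX).lift t.hom ht
      exact ⟨ObjectProperty.homMk k, ObjectProperty.hom_ext _ hk.symm⟩
    · rintro ⟨k, rfl⟩
      exact (Category.assoc _ _ _).trans
        ((congrArg (k.hom ≫ ·) (h.isHomExact_last hn hX).zero).trans comp_zero)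
  exact_contra T i hi t := by
    constructor
    · intro ht
      obtain ⟨k, hk⟩ := h.desc_toSuspSeq hn hX i hi t ht
      exact ⟨k, hk.symm⟩
    · rintro ⟨k, rfl⟩
      exact (Category.assoc _ _ _).symm.trans (by rw [X.isComplex, zero_comp])
  exact_contra_last T t := by
    have key : push (restrictedHomSusp S P) (X.left.inv ≫ t) δ = 0 ↔
        (toSuspSeq X δ).δ ≫ S.map t.hom = 0 := by
      change δ ≫ S.map (X.left.inv.hom ≫ t.hom) = 0 ↔
        (X.right.hom.hom ≫ δ ≫ S.map X.left.inv.hom) ≫ S.map t.hom = 0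
      rw [← cancel_epi X.right.hom.hom, comp_zero, Category.assoc, Category.assoc, S.map_comp]
    rw [key]
    constructor
    · intro ht
      obtain ⟨k, hk⟩ := h.exists_extension hn hX t.hom ht
      exact ⟨ObjectProperty.homMk k, ObjectProperty.hom_ext _ hk.symm⟩
    · rintro ⟨k, rfl⟩
      have hk : ∀ k : (toSuspSeq X δ).obj 1 (Nat.succ_le_succ (Nat.zero_le _)) ⟶ T.obj,
          (toSuspSeq X δ).δ ≫ S.map ((toSuspSeq X δ).d 0 (Nat.zero_le _) ≫ k) = 0 := fun k => by
        rw [S.map_comp, reassoc_of% (h.isHomExact_δ hn hX).zero, zero_comp]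
      exact hk k.hom

end IsAngulated

end Subcategory

/-! ### Reduction of cones of morphisms that are invertible at one end -/

section Decomp

variable {D : Type u} [Category.{v} D] [Preadditive D]

/-- A direct sum decomposition `V = N ⊕ T`, where the summand `N` is to be kept and the summand
`T` is to be removed. -/
structure Decomp (V : D) where
  N : D
  T : D
  inl : N ⟶ V
  inr : T ⟶ V
  fst : V ⟶ N
  snd : V ⟶ T
  isBiproduct : IsBiproduct inl inr fst snd

open ZeroObject in
/-- The decomposition `V = V ⊕ 0`. -/
noncomputable def Decomp.triv [HasZeroObject D] (V : D) : Decomp V where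
  N := V
  T := 0
  inl := 𝟙 V
  inr := 0
  fst := 𝟙 V
  snd := 0
  isBiproduct := ⟨by simp, by simp, by simp, by simp, by simp⟩

/-- The image of a decomposition under an additive functor. -/
def Decomp.map (S : D ⥤ D) [S.Additive] {V : D} (a : Decomp V) : Decomp (S.obj V) where
  N := S.obj a.N
  T := S.obj a.T
  inl := S.map a.inl
  inr := S.map a.inr
  fst := S.map a.fst
  snd := S.map a.snd
  isBiproduct := a.isBiproduct.map S

/-- The morphism `d` is diagonal with respect to the decompositions. -/
structure IsDiagonal {V W : D} (d : V ⟶ W) (a : Decomp V) (b : Decomp W) : Prop where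
  inl_snd : a.inl ≫ d ≫ b.snd = 0
  inr_fst : a.inr ≫ d ≫ b.fst = 0

variable [HasZeroObject D]

theorem isDiagonal_triv {V W : D} (d : V ⟶ W) : IsDiagonal d (Decomp.triv V) (Decomp.triv W) :=
  ⟨(Category.id_comp _).trans comp_zero, zero_comp⟩

theorem isDiagonal_triv_left {V W : D} {d : V ⟶ W} {b : Decomp W} (h : d ≫ b.snd = 0) :
    IsDiagonal d (Decomp.triv V) b :=
  ⟨by rw [h, comp_zero], zero_comp⟩

theorem isDiagonal_triv_right {V W : D} {d : V ⟶ W} {a : Decomp V} (h : a.inr ≫ d = 0) :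
    IsDiagonal d a (Decomp.triv W) :=
  ⟨(congrArg (a.inl ≫ ·) comp_zero).trans comp_zero, by rw [reassoc_of% h, zero_comp]⟩

theorem isDiagonal_map_triv {V W : D} (S : D ⥤ D) [S.Additive] {d : V ⟶ S.obj W}
    {a : Decomp V} (h : a.inr ≫ d = 0) : IsDiagonal d a ((Decomp.triv W).map S) :=
  ⟨(congrArg (fun f => a.inl ≫ d ≫ f) (S.map_zero _ _)).trans
    ((congrArg (a.inl ≫ ·) comp_zero).trans comp_zero), by
    rw [reassoc_of% h, zero_comp]⟩

end Decomp

section Angles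

variable {D : Type u} [Category.{v} D] [Preadditive D] {S : D ⥤ D} {n : ℕ}

section

variable [S.Additive]

/-- If the morphisms of an `(n + 2)`-angle are diagonal with respect to a degreewise
decomposition, then the first summands form an `(n + 2)`-angle. -/
theorem IsAngulated.exists_restriction {pent : Set (SuspSeq S n)} (h : IsAngulated n S pent)
    {V : SuspSeq S n} (hV : V ∈ pent) (Dc : ∀ i hi, Decomp (V.obj i hi))
    (hd : ∀ i (hi : i ≤ n), IsDiagonal (V.d i hi) (Dc i (Nat.le_succ_of_le hi))
      (Dc (i + 1) (Nat.succ_le_succ hi)))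
    (hδ : IsDiagonal V.δ (Dc (n + 1) le_rfl) ((Dc 0 (Nat.zero_le _)).map S)) :
    ∃ N ∈ pent, ∃ (s : SuspSeq.Hom N V) (r : SuspSeq.Hom V N), ∀ i hi,
      ∃ e : N.obj i hi ≅ (Dc i hi).N, s.f i hi = e.hom ≫ (Dc i hi).inl ∧
        r.f i hi = (Dc i hi).fst ≫ e.inv := by
  let N : SuspSeq S n :=
    { obj := fun i hi => (Dc i hi).N
      d := fun i hi => (Dc i (by omega)).inl ≫ V.d i hi ≫ (Dc (i + 1) (by omega)).fst
      δ := (Dc (n + 1) le_rfl).inl ≫ V.δ ≫ S.map (Dc 0 (by omega)).fst }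
  let s : SuspSeq.Hom N V :=
    { f := fun i hi => (Dc i hi).inl
      comm := fun i hi => by
        apply (Dc (i + 1) (by omega)).isBiproduct.hom_ext_to
        · simp only [N, Category.assoc, (Dc (i + 1) _).isBiproduct.inl_fst, Category.comp_id]
        · simp only [N, Category.assoc, (Dc (i + 1) _).isBiproduct.inl_snd, comp_zero,
            (hd i hi).inl_snd]
      comm_δ := by
        apply ((Dc 0 (by omega)).map S).isBiproduct.hom_ext_to
        · simp only [N, Category.assoc, Decomp.map, ((Dc 0 _).isBiproduct.map S).inl_fst,
            Category.comp_id]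
        · have h₁ : (S.map (Dc 0 (by omega)).inl) ≫ S.map (Dc 0 (by omega)).snd = 0 :=
            ((Dc 0 _).isBiproduct.map S).inl_snd
          simp only [N, Category.assoc, Decomp.map, h₁, comp_zero]
          exact hδ.inl_snd.symm }
  let r : SuspSeq.Hom V N :=
    { f := fun i hi => (Dc i hi).fst
      comm := fun i hi => by
        apply (Dc i (by omega)).isBiproduct.hom_ext
        · simp only [N, reassoc_of% (Dc i _).isBiproduct.inl_fst]
        · simp only [N, reassoc_of% (Dc i _).isBiproduct.inr_fst, zero_comp, (hd i hi).inr_fst]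
      comm_δ := by
        apply (Dc (n + 1) (by omega)).isBiproduct.hom_ext
        · simp only [N, reassoc_of% (Dc (n + 1) _).isBiproduct.inl_fst]
        · simp only [N, reassoc_of% (Dc (n + 1) _).isBiproduct.inr_fst, zero_comp]
          exact hδ.inr_fst }
  exact ⟨N, h.mem_of_retract hV s r fun i hi => ⟨_, _, _, (Dc i hi).isBiproduct⟩, s, r,
    fun i hi => ⟨Iso.refl _, (Category.id_comp _).symm, (Category.comp_id _).symm⟩⟩

/-- As `exists_restriction`, for decompositions that are trivial in all but two degrees. -/
theorem IsAngulated.exists_restriction_two [HasZeroObject D] {pent : Set (SuspSeq S n)}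
    (h : IsAngulated n S pent)
    {V : SuspSeq S n} (hV : V ∈ pent) {p q : ℕ} (hp : p ≤ n + 1) (hq : q ≤ n + 1) (hpq : p ≠ q)
    (a : Decomp (V.obj p hp)) (b : Decomp (V.obj q hq))
    (hd : ∀ Dc : ∀ i hi, Decomp (V.obj i hi), Dc p hp = a → Dc q hq = b →
      (∀ i hi, i ≠ p → i ≠ q → Dc i hi = Decomp.triv _) →
      (∀ i (hi : i ≤ n), IsDiagonal (V.d i hi) (Dc i (Nat.le_succ_of_le hi))
        (Dc (i + 1) (Nat.succ_le_succ hi))) ∧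
      IsDiagonal V.δ (Dc (n + 1) le_rfl) ((Dc 0 (Nat.zero_le _)).map S)) :
    ∃ N ∈ pent, ∃ (s : SuspSeq.Hom N V) (r : SuspSeq.Hom V N),
      (∃ e : N.obj p hp ≅ a.N, s.f p hp = e.hom ≫ a.inl ∧ r.f p hp = a.fst ≫ e.inv) ∧
      (∃ e : N.obj q hq ≅ b.N, s.f q hq = e.hom ≫ b.inl ∧ r.f q hq = b.fst ≫ e.inv) ∧
      ∀ i hi, i ≠ p → i ≠ q →
        ∃ e : N.obj i hi ≅ V.obj i hi, s.f i hi = e.hom ∧ r.f i hi = e.inv := by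
  obtain ⟨Dc, rfl, rfl, hDc⟩ := exists_update_two (m := n + 1)
    (α := fun i hi => Decomp (V.obj i hi)) (fun i hi => Decomp.triv _) hp hq hpq a b
  obtain ⟨hd, hδ⟩ := hd Dc rfl rfl hDc
  obtain ⟨N, hN, s, r, hsr⟩ := h.exists_restriction hV Dc hd hδ
  refine ⟨N, hN, s, r, hsr p hp, hsr q hq, fun i hi h₁ h₂ => ?_⟩
  have := hsr i hi
  rw [hDc i hi h₁ h₂] at this
  obtain ⟨e, h₁, h₂⟩ := this
  exact ⟨e, by simpa [Decomp.triv] using h₁, by simpa [Decomp.triv] using h₂⟩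

end

namespace RotCone

variable {X Y M : SuspSeq S n} {φ : SuspSeq.Hom X Y} (C : RotCone φ M)
include C

theorem d_fst (i : ℕ) (hi : i ≤ n) : M.d i hi ≫ C.fst (i + 1) (Nat.succ_le_succ hi) =
    -(C.fst i (Nat.le_succ_of_le hi) ≫ X.d i hi) := by
  cases i with
  | zero =>
    apply C.biproduct₀.hom_ext
    · simp [reassoc_of% C.inl_d, (C.biproduct 0 _).inl_fst, (C.biproduct 0 _).inr_fst,
        reassoc_of% C.biproduct₀.inl_fst]
    · simp [reassoc_of% C.inr₀_d, (C.biproduct 0 _).inr_fst, reassoc_of% C.biproduct₀.inr_fst]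
  | succ i =>
    apply (C.biproduct i (by omega)).hom_ext
    · simp [reassoc_of% C.inl_d, (C.biproduct (i + 1) hi).inl_fst,
        (C.biproduct (i + 1) hi).inr_fst, reassoc_of% (C.biproduct i (by omega)).inl_fst]
    · simp [reassoc_of% C.inr_d, (C.biproduct (i + 1) hi).inr_fst,
        reassoc_of% (C.biproduct i (by omega)).inr_fst]

theorem d_snd_zero : M.d 0 (Nat.zero_le _) ≫ C.snd 0 (Nat.zero_le _) =
    C.fst 0 (Nat.zero_le _) ≫ φ.f 0 (Nat.zero_le _) + C.snd₀ ≫ C.d₀ := by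
  apply C.biproduct₀.hom_ext
  · simp [reassoc_of% C.inl_d, (C.biproduct 0 _).inl_snd, (C.biproduct 0 _).inr_snd,
      reassoc_of% C.biproduct₀.inl_fst, reassoc_of% C.biproduct₀.inl_snd]
  · simp [reassoc_of% C.inr₀_d, (C.biproduct 0 _).inr_snd, reassoc_of% C.biproduct₀.inr_fst,
      reassoc_of% C.biproduct₀.inr_snd]

theorem d_snd (i : ℕ) (hi : i + 1 ≤ n) : M.d (i + 1) hi ≫ C.snd (i + 1) hi =
    C.fst (i + 1) (Nat.le_succ_of_le hi) ≫ φ.f (i + 1) (Nat.le_succ_of_le hi) +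
      C.snd i (Nat.le_of_lt hi) ≫ Y.d i (Nat.le_of_lt hi) := by
  apply (C.biproduct i (by omega)).hom_ext
  · simp [reassoc_of% C.inl_d, (C.biproduct (i + 1) hi).inl_snd, (C.biproduct (i + 1) hi).inr_snd,
      reassoc_of% (C.biproduct i (by omega)).inl_fst,
      reassoc_of% (C.biproduct i (by omega)).inl_snd]
  · simp [reassoc_of% C.inr_d, (C.biproduct (i + 1) hi).inr_snd,
      reassoc_of% (C.biproduct i (by omega)).inr_fst,
      reassoc_of% (C.biproduct i (by omega)).inr_snd]

theorem δ_fst [S.Additive] : M.δ ≫ S.map (C.fst 0 (Nat.zero_le _)) =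
    (-1 : ℤ) ^ (n + 1) • (C.fst (n + 1) le_rfl ≫ X.δ) := by
  have h := C.biproduct₀.map S
  apply (C.biproduct n le_rfl).hom_ext
  · simp [reassoc_of% C.inl_δ, h.inl_fst, h.inr_fst, reassoc_of% (C.biproduct n _).inl_fst]
  · simp [reassoc_of% C.inr_δ, h.inr_fst, reassoc_of% (C.biproduct n _).inr_fst]

theorem δ_snd [S.Additive] : M.δ ≫ S.map C.snd₀ = (C.fst (n + 1) le_rfl ≫ φ.f (n + 1) le_rfl +
    C.snd n le_rfl ≫ Y.d n le_rfl) ≫ C.w.inv := by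
  have h := C.biproduct₀.map S
  apply (C.biproduct n le_rfl).hom_ext
  · simp [reassoc_of% C.inl_δ, h.inl_snd, h.inr_snd, reassoc_of% (C.biproduct n _).inl_fst,
      reassoc_of% (C.biproduct n _).inl_snd]
  · simp [reassoc_of% C.inr_δ, h.inr_snd, reassoc_of% (C.biproduct n _).inr_fst,
      reassoc_of% (C.biproduct n _).inr_snd]

end RotCone

end Angles

section Angles

variable {D : Type u} [Category.{v} D] [Preadditive D] {S : D ⥤ D} {n : ℕ}

/-- For a morphism `φ : X ⟶ Y` of `(n + 2)`-`S`-sequences with an isomorphism `φ_{n+1} = γ`, the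
structure of a mapping cocone of `φ` on `N`, as in `Cplx.CoconeData`. -/
structure AngleCocone {X Y : SuspSeq S n} (φ : SuspSeq.Hom X Y)
    (γ : X.obj (n + 1) le_rfl ≅ Y.obj (n + 1) le_rfl) (N : SuspSeq S n) where
  fst : ∀ (i : ℕ) (hi : i ≤ n), N.obj i (Nat.le_succ_of_le hi) ⟶ X.obj i (Nat.le_succ_of_le hi)
  snd : ∀ (i : ℕ) (hi : i ≤ n), N.obj (i + 1) (Nat.succ_le_succ hi) ⟶
    Y.obj i (Nat.le_succ_of_le hi)
  isIso_fst : IsIso (fst 0 (Nat.zero_le _))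
  isIso_snd : IsIso (snd n le_rfl)
  biproduct : ∀ (i : ℕ) (hi : i + 1 ≤ n), ∃ inl inr,
    IsBiproduct inl inr (fst (i + 1) hi) (snd i (Nat.le_of_lt hi))
  d_fst : ∀ (i : ℕ) (hi : i + 1 ≤ n), N.d i (Nat.le_of_lt hi) ≫ fst (i + 1) hi =
    fst i (Nat.le_of_lt hi) ≫ X.d i (Nat.le_of_lt hi)
  d_snd_zero : N.d 0 (Nat.zero_le _) ≫ snd 0 (Nat.zero_le _) =
    fst 0 (Nat.zero_le _) ≫ φ.f 0 (Nat.zero_le _)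
  d_snd : ∀ (i : ℕ) (hi : i + 1 ≤ n), N.d (i + 1) hi ≫ snd (i + 1) hi =
    fst (i + 1) hi ≫ φ.f (i + 1) (Nat.le_succ_of_le hi) -
      snd i (Nat.le_of_lt hi) ≫ Y.d i (Nat.le_of_lt hi)
  δ_fst : N.δ ≫ S.map (fst 0 (Nat.zero_le _)) = snd n le_rfl ≫ Y.d n le_rfl ≫ γ.inv ≫ X.δ

/-- For a morphism `φ : X ⟶ Y` of `(n + 2)`-`S`-sequences with an isomorphism `φ_0 = γ`, the
structure of a mapping cone of `φ` on `N`, as in `Cplx.ConeData`. -/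
structure AngleCone {X Y : SuspSeq S n} (φ : SuspSeq.Hom X Y)
    (γ : X.obj 0 (Nat.zero_le _) ≅ Y.obj 0 (Nat.zero_le _)) (N : SuspSeq S n) where
  inl : ∀ (i : ℕ) (hi : i ≤ n), X.obj (i + 1) (Nat.succ_le_succ hi) ⟶
    N.obj i (Nat.le_succ_of_le hi)
  inr : ∀ (i : ℕ) (hi : i ≤ n), Y.obj (i + 1) (Nat.succ_le_succ hi) ⟶
    N.obj (i + 1) (Nat.succ_le_succ hi)
  isIso_inl : IsIso (inl 0 (Nat.zero_le _))
  isIso_inr : IsIso (inr n le_rfl)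
  biproduct : ∀ (i : ℕ) (hi : i + 1 ≤ n), ∃ fst snd,
    IsBiproduct (inl (i + 1) hi) (inr i (Nat.le_of_lt hi)) fst snd
  inl_d : ∀ (i : ℕ) (hi : i + 1 ≤ n), inl i (Nat.le_of_lt hi) ≫ N.d i (Nat.le_of_lt hi) =
    -(X.d (i + 1) hi ≫ inl (i + 1) hi) +
      φ.f (i + 1) (Nat.le_succ_of_le hi) ≫ inr i (Nat.le_of_lt hi)
  inl_d_last : inl n le_rfl ≫ N.d n le_rfl = φ.f (n + 1) le_rfl ≫ inr n le_rfl
  inr_d : ∀ (i : ℕ) (hi : i + 1 ≤ n),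
    inr i (Nat.le_of_lt hi) ≫ N.d (i + 1) hi = Y.d (i + 1) hi ≫ inr (i + 1) hi
  inr_δ : inr n le_rfl ≫ N.δ =
    Y.δ ≫ S.map (γ.inv ≫ X.d 0 (Nat.zero_le _) ≫ inl 0 (Nat.zero_le _))

/-- The terms of a cocone are biproducts of terms of the two sequences. -/
theorem AngleCocone.prop_obj {P : ObjectProperty D} (hP : IsAdditiveSubcategory P)
    {X Y N : SuspSeq S n} {φ : SuspSeq.Hom X Y} {γ : X.obj (n + 1) le_rfl ≅ Y.obj (n + 1) le_rfl}
    (K : AngleCocone φ γ N) (hX : ∀ i hi, P (X.obj i hi)) (hY : ∀ i hi, P (Y.obj i hi)) (i : ℕ)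
    (hi : i ≤ n + 1) : P (N.obj i hi) := by
  have := K.isIso_fst
  have := K.isIso_snd
  rcases hi.lt_or_eq with hi' | rfl
  · cases i with
    | zero => exact hP.iso (asIso (K.fst 0 (Nat.zero_le _))).symm (hX 0 _)
    | succ i =>
      obtain ⟨inl, inr, b⟩ := K.biproduct i (Nat.le_of_lt_succ hi')
      exact hP.biprod _ _ _ _ b (hX (i + 1) _) (hY i _)
  · exact hP.iso (asIso (K.snd n le_rfl)).symm (hY n _)

/-- The terms of a cone are biproducts of terms of the two sequences. -/
theorem AngleCone.prop_obj {P : ObjectProperty D} (hP : IsAdditiveSubcategory P)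
    {X Y N : SuspSeq S n} {φ : SuspSeq.Hom X Y}
    {γ : X.obj 0 (Nat.zero_le _) ≅ Y.obj 0 (Nat.zero_le _)}
    (K : AngleCone φ γ N) (hX : ∀ i hi, P (X.obj i hi)) (hY : ∀ i hi, P (Y.obj i hi)) (i : ℕ)
    (hi : i ≤ n + 1) : P (N.obj i hi) := by
  have := K.isIso_inl
  have := K.isIso_inr
  rcases hi.lt_or_eq with hi' | rfl
  · cases i with
    | zero => exact hP.iso (asIso (K.inl 0 (Nat.zero_le _))) (hX 1 _)
    | succ i =>
      obtain ⟨fst, snd, b⟩ := K.biproduct i (Nat.le_of_lt_succ hi')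
      exact hP.biprod _ _ _ _ b (hX (i + 2) _) (hY (i + 1) _)
  · exact hP.iso (asIso (K.inr n le_rfl)) (hY (n + 1) _)

variable [HasFiniteBiproducts D] [S.IsEquivalence] [S.Additive] {pent : Set (SuspSeq S n)}

theorem neg_one_pow_mul_neg_one_pow (k : ℕ) : (-1 : ℤ) ^ k * (-1) ^ k = 1 := by
  rw [← pow_add]
  exact Even.neg_one_pow ⟨k, rfl⟩

/-- A cone of a morphism that is invertible in degree `n + 1` reduces to a cocone that is an
`(n + 2)`-angle: up to the differential, the summands `W` in degree `0` and `X_{n+1}` in degree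
`n + 1` split off. -/
theorem IsAngulated.exists_angleCocone (h : IsAngulated n S pent) (hn : 1 ≤ n)
    {X Y M : SuspSeq S n} (hX : X ∈ pent) (hY : Y ∈ pent) (hM : M ∈ pent) (φ : SuspSeq.Hom X Y)
    (γ : X.obj (n + 1) le_rfl ≅ Y.obj (n + 1) le_rfl) (hγ : φ.f (n + 1) le_rfl = γ.hom)
    (C : RotCone φ M) : ∃ N ∈ pent, Nonempty (AngleCocone φ γ N) := by
  have hXc := h.isPeriodicComplex hn hX
  have hYc := h.isPeriodicComplex hn hY
  -- Since `φ_{n+1}` is invertible, the component `W ⟶ Y_0` of `d_0` factors through `φ_0` by a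
  -- morphism `q` that annihilates `d_0 : X_0 ⟶ X_1`.
  obtain ⟨q, hq⟩ : ∃ q, S.map q = (-1 : ℤ) ^ (n + 1) • (C.w.hom ≫ γ.inv ≫ X.δ) :=
    ⟨S.preimage _, S.map_preimage _⟩
  have hqd : q ≫ X.d 0 (Nat.zero_le _) = 0 := S.map_injective (by
    simp [hq, hXc.δ_d])
  have hqφ : q ≫ φ.f 0 (Nat.zero_le _) = -C.d₀ := S.map_injective (by
    rw [S.map_comp, hq, S.map_neg, C.map_d₀]
    simp only [Preadditive.zsmul_comp, Category.assoc, φ.comm_δ, hγ, Iso.inv_hom_id_assoc,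
      pow_succ, mul_neg, mul_one, neg_smul, Preadditive.neg_comp])
  have b₀ := C.biproduct₀
  have bL := C.biproduct n le_rfl
  let a : Decomp (M.obj 0 (Nat.zero_le _)) :=
    { N := X.obj 0 (Nat.zero_le _)
      T := C.W
      inl := C.inl 0 (Nat.zero_le _)
      inr := C.inr₀ + q ≫ C.inl 0 (Nat.zero_le _)
      fst := C.fst 0 (Nat.zero_le _) - C.snd₀ ≫ q
      snd := C.snd₀
      isBiproduct := 
        { inl_fst := by simp [b₀.inl_fst, reassoc_of% b₀.inl_snd]
          inl_snd := b₀.inl_snd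
          inr_fst := by simp [b₀.inl_fst, b₀.inr_fst, reassoc_of% b₀.inl_snd,
                          reassoc_of% b₀.inr_snd]
          inr_snd := by simp [b₀.inr_snd, b₀.inl_snd]
          total := by simp [← b₀.total] } }
  let b : Decomp (M.obj (n + 1) le_rfl) :=
    { N := Y.obj n (Nat.le_succ _)
      T := X.obj (n + 1) le_rfl
      inl := C.inr n le_rfl - Y.d n le_rfl ≫ γ.inv ≫ C.inl (n + 1) le_rfl
      inr := C.inl (n + 1) le_rfl
      fst := C.snd n le_rfl
      snd := C.fst (n + 1) le_rfl + C.snd n le_rfl ≫ Y.d n le_rfl ≫ γ.inv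
      isBiproduct := 
        { inl_fst := by simp [bL.inl_snd, bL.inr_snd]
          inl_snd := by simp [bL.inl_fst, bL.inr_fst, reassoc_of% bL.inr_snd,
                          reassoc_of% bL.inl_snd]
          inr_fst := bL.inl_snd
          inr_snd := by simp [bL.inl_fst, reassoc_of% bL.inl_snd]
          total := by simp [← bL.total, add_comm] } }
  obtain ⟨N, hN, s, r, ⟨e₀, hs₀, -⟩, ⟨eL, hsL, -⟩, hsr⟩ := h.exists_restriction_two hM
    (Nat.zero_le _) le_rfl (Nat.succ_ne_zero n).symm a b (by
      intro Dc h₀ h₁ hDc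
      refine ⟨fun i hi => ?_, ?_⟩
      · by_cases hi₀ : i = 0
        · subst hi₀
          rw [h₀, hDc 1 _ (by omega) (by omega)]
          refine isDiagonal_triv_right ?_
          simp [a, C.inr₀_d, C.inl_d, reassoc_of% hqd, reassoc_of% hqφ]
        · rw [hDc i _ hi₀ (by omega)]
          rcases hi.lt_or_eq with hi' | rfl
          · rw [hDc (i + 1) _ (by omega) (by omega)]
            exact isDiagonal_triv _
          · rw [h₁]
            refine isDiagonal_triv_left ?_
            obtain ⟨m, rfl⟩ : ∃ m, i = m + 1 := ⟨i - 1, by omega⟩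
            have hφ : φ.f (m + 1) _ ≫ Y.d (m + 1) hi ≫ γ.inv = X.d (m + 1) hi := by
              rw [← reassoc_of% φ.comm (m + 1) hi, hγ, Iso.hom_inv_id, Category.comp_id]
            simp [b, C.d_fst, reassoc_of% C.d_snd, hφ, reassoc_of% hYc.d_d m le_rfl]
      · rw [h₀, h₁]
        constructor
        · change (C.inr n le_rfl - Y.d n le_rfl ≫ γ.inv ≫ C.inl (n + 1) le_rfl) ≫ M.δ ≫
            S.map C.snd₀ = 0
          simp [C.δ_snd, reassoc_of% bL.inr_fst, reassoc_of% bL.inr_snd, reassoc_of% bL.inl_fst,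
            reassoc_of% bL.inl_snd, hγ]
        · change C.inl (n + 1) le_rfl ≫ M.δ ≫ S.map (C.fst 0 (Nat.zero_le _) - C.snd₀ ≫ q) = 0
          simp [C.δ_fst, reassoc_of% C.δ_snd, reassoc_of% bL.inl_snd, hγ, hq])
  refine ⟨N, hN, ⟨{
    fst := fun i hi => (-1 : ℤ) ^ i • (s.f i (Nat.le_succ_of_le hi) ≫ C.fst i _)
    snd := fun i hi => (-1 : ℤ) ^ i • (s.f (i + 1) (Nat.succ_le_succ hi) ≫ C.snd i hi)
    isIso_fst := ?_
    isIso_snd := ?_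
    biproduct := ?_
    d_fst := ?_
    d_snd_zero := ?_
    d_snd := ?_
    δ_fst := ?_ }⟩⟩
  · have : s.f 0 (Nat.zero_le _) ≫ C.fst 0 (Nat.zero_le _) = e₀.hom := by
      rw [hs₀, Category.assoc]
      change e₀.hom ≫ C.inl 0 _ ≫ C.fst 0 _ = _
      rw [b₀.inl_fst, Category.comp_id]
    rw [this, pow_zero, one_smul]
    infer_instance
  · have : s.f (n + 1) le_rfl ≫ C.snd n le_rfl = eL.hom := by
      rw [hsL, Category.assoc]
      exact (congrArg (eL.hom ≫ ·) b.isBiproduct.inl_fst).trans (Category.comp_id _)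
    rw [this]
    exact ⟨(-1 : ℤ) ^ n • eL.inv, by simp [smul_smul, neg_one_pow_mul_neg_one_pow],
      by simp [smul_smul, neg_one_pow_mul_neg_one_pow]⟩
  · intro i hi
    obtain ⟨e, hs, -⟩ := hsr (i + 1) (Nat.le_succ_of_le hi) (by omega) (by omega)
    have b := C.biproduct i (Nat.le_of_lt hi)
    refine ⟨(-1 : ℤ) ^ (i + 1) • (C.inl (i + 1) _ ≫ e.inv),
      (-1 : ℤ) ^ i • (C.inr i (Nat.le_of_lt hi) ≫ e.inv), ?_⟩
    rw [hs]
    constructor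
    · simp [smul_smul, neg_one_pow_mul_neg_one_pow, b.inl_fst]
    · simp [b.inl_snd]
    · simp [b.inr_fst]
    · simp [smul_smul, neg_one_pow_mul_neg_one_pow, b.inr_snd]
    · simp only [Preadditive.zsmul_comp, Preadditive.comp_zsmul, smul_smul,
        neg_one_pow_mul_neg_one_pow, one_smul, Category.assoc]
      rw [← Preadditive.comp_add, ← Category.assoc, ← Category.assoc (C.snd i _),
        ← Preadditive.add_comp, b.total, Category.id_comp, Iso.hom_inv_id]
  · intro i hi
    rw [Preadditive.comp_zsmul, reassoc_of% s.comm i, C.d_fst]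
    simp [pow_succ]
  · rw [pow_zero, one_smul, one_smul, reassoc_of% s.comm 0, C.d_snd_zero, hs₀]
    have : a.inl ≫ C.snd₀ = 0 := b₀.inl_snd
    simp [reassoc_of% this]
  · intro i hi
    rw [Preadditive.comp_zsmul, reassoc_of% s.comm (i + 1), C.d_snd]
    simp [pow_succ, sub_eq_add_neg]
  · have : s.f (n + 1) le_rfl ≫ C.fst (n + 1) le_rfl = -(eL.hom ≫ Y.d n le_rfl ≫ γ.inv) := by
      rw [hsL, Category.assoc]
      change eL.hom ≫ (C.inr n le_rfl - Y.d n le_rfl ≫ γ.inv ≫ C.inl (n + 1) le_rfl) ≫ _ = _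
      simp [bL.inl_fst, bL.inr_fst]
    have this' : s.f (n + 1) le_rfl ≫ C.snd n le_rfl = eL.hom := by
      rw [hsL, Category.assoc]
      exact (congrArg (eL.hom ≫ ·) b.isBiproduct.inl_fst).trans (Category.comp_id _)
    rw [pow_zero, one_smul, S.map_comp, reassoc_of% s.comm_δ, C.δ_fst, this',
      Preadditive.comp_zsmul, reassoc_of% this]
    simp [pow_succ]

/-- A cone of a morphism that is invertible in degree `0` reduces, after a rotation, to a cone
that is an `(n + 2)`-angle: up to the differential, the summands `X_0` in degree `0` and `Y_0` in
degree `1` split off. -/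
theorem IsAngulated.exists_angleCone (h : IsAngulated n S pent) (hn : 1 ≤ n)
    {X Y M : SuspSeq S n} (hX : X ∈ pent) (hY : Y ∈ pent) (hM : M ∈ pent) (φ : SuspSeq.Hom X Y)
    (γ : X.obj 0 (Nat.zero_le _) ≅ Y.obj 0 (Nat.zero_le _)) (hγ : φ.f 0 (Nat.zero_le _) = γ.hom)
    (C : RotCone φ M) : ∃ N ∈ pent, Nonempty (AngleCone φ γ N) := by
  have hYc := h.isPeriodicComplex hn hY
  have hMc := h.isPeriodicComplex hn hM
  have b₀ := C.biproduct₀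
  have b₁ := C.biproduct 0 (Nat.zero_le _)
  have hd₀ : C.w.inv ≫ S.map C.d₀ = (-1 : ℤ) ^ n • Y.δ := by
    simp [C.map_d₀]
  have hδγ : φ.f (n + 1) le_rfl ≫ Y.δ ≫ S.map γ.inv = X.δ := by
    rw [← reassoc_of% φ.comm_δ, hγ, ← S.map_comp, Iso.hom_inv_id, S.map_id, Category.comp_id]
  let a : Decomp (M.obj 0 (Nat.zero_le _)) :=
    { N := C.W
      T := X.obj 0 (Nat.zero_le _)
      inl := C.inr₀ - C.d₀ ≫ γ.inv ≫ C.inl 0 (Nat.zero_le _)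
      inr := C.inl 0 (Nat.zero_le _)
      fst := C.snd₀
      snd := C.fst 0 (Nat.zero_le _) + C.snd₀ ≫ C.d₀ ≫ γ.inv
      isBiproduct :=
        { inl_fst := by simp [b₀.inl_snd, b₀.inr_snd]
          inl_snd := by simp [b₀.inl_fst, b₀.inr_fst, reassoc_of% b₀.inr_snd,
                          reassoc_of% b₀.inl_snd]
          inr_fst := b₀.inl_snd
          inr_snd := by simp [b₀.inl_fst, reassoc_of% b₀.inl_snd]
          total := by
            rw [← b₀.total]
            simp only [Preadditive.comp_sub, Preadditive.add_comp, Category.assoc]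
            abel } }
  let b : Decomp (M.obj 1 (Nat.succ_le_succ (Nat.zero_le _))) :=
    { N := X.obj 1 (Nat.succ_le_succ (Nat.zero_le _))
      T := X.obj 0 (Nat.zero_le _)
      inl := C.inl 1 (Nat.succ_le_succ (Nat.zero_le _))
      inr := C.inl 0 (Nat.zero_le _) ≫ M.d 0 (Nat.zero_le _)
      fst := C.fst 1 (Nat.succ_le_succ (Nat.zero_le _)) +
        C.snd 0 (Nat.zero_le _) ≫ γ.inv ≫ X.d 0 (Nat.zero_le _)
      snd := C.snd 0 (Nat.zero_le _) ≫ γ.inv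
      isBiproduct :=
        { inl_fst := by simp [b₁.inl_fst, reassoc_of% b₁.inl_snd]
          inl_snd := by simp [reassoc_of% b₁.inl_snd]
          inr_fst := by simp [C.inl_d, b₁.inl_fst, b₁.inr_fst, reassoc_of% b₁.inl_snd,
                          reassoc_of% b₁.inr_snd, hγ]
          inr_snd := by simp [C.inl_d, reassoc_of% b₁.inl_snd, reassoc_of% b₁.inr_snd, hγ]
          total := by simp [C.inl_d, hγ, ← b₁.total] } }
  obtain ⟨N', hN', s, r, ⟨e₀, -, hr₀⟩, ⟨e₁, -, hr₁⟩, hsr⟩ := h.exists_restriction_two hM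
    (Nat.zero_le _) (Nat.succ_le_succ (Nat.zero_le _)) (Nat.zero_ne_one) a b (by
      intro Dc h₀ h₁ hDc
      refine ⟨fun i hi => ?_, ?_⟩
      · match i, hi with
        | 0, hi =>
          rw [h₀, h₁]
          constructor
          · change (C.inr₀ - C.d₀ ≫ γ.inv ≫ C.inl 0 _) ≫ M.d 0 _ ≫ C.snd 0 _ ≫ γ.inv = 0
            simp [reassoc_of% C.inr₀_d, reassoc_of% C.inl_d, reassoc_of% b₁.inl_snd,
              reassoc_of% b₁.inr_snd, hγ]
          · exact (Category.assoc _ _ _).symm.trans b.isBiproduct.inr_fst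
        | 1, hi =>
          rw [h₁, hDc 2 _ (by omega) (by omega)]
          refine isDiagonal_triv_right ?_
          exact (Category.assoc _ _ _).trans
            ((congrArg (C.inl 0 _ ≫ ·) (hMc.d_d 0 hi)).trans comp_zero)
        | i + 2, hi =>
          rw [hDc (i + 2) _ (by omega) (by omega), hDc (i + 2 + 1) _ (by omega) (by omega)]
          exact isDiagonal_triv _
      · rw [h₀, hDc (n + 1) _ (by omega) (by omega)]
        refine isDiagonal_triv_left ?_
        change M.δ ≫ S.map (C.fst 0 _ + C.snd₀ ≫ C.d₀ ≫ γ.inv) = 0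
        simp only [S.map_add, S.map_comp, Preadditive.comp_add, C.δ_fst, reassoc_of% C.δ_snd,
          Preadditive.add_comp, Category.assoc, reassoc_of% hd₀, Preadditive.zsmul_comp,
          Preadditive.comp_zsmul, hδγ, reassoc_of% hYc.d_δ]
        simp [pow_succ])
  obtain ⟨N, ⟨ρ⟩⟩ := N'.exists_rotationData_from
  have hN'd : e₀.inv ≫ N'.d 0 (Nat.zero_le _) = C.d₀ ≫ γ.inv ≫ X.d 0 (Nat.zero_le _) ≫ e₁.inv := by
    have e : C.inr₀ ≫ r.f 0 (Nat.zero_le _) = e₀.inv := by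
      rw [hr₀]
      exact (Category.assoc _ _ _).symm.trans
        ((congrArg (· ≫ e₀.inv) b₀.inr_snd).trans (Category.id_comp _))
    rw [← e, Category.assoc, ← r.comm, hr₁, reassoc_of% C.inr₀_d]
    change C.d₀ ≫ C.inr 0 _ ≫ (C.fst 1 _ + C.snd 0 _ ≫ γ.inv ≫ X.d 0 _) ≫ _ = _
    simp [reassoc_of% b₁.inr_fst, reassoc_of% b₁.inr_snd]
  have hrδ : M.δ ≫ S.map (r.f 0 (Nat.zero_le _)) = (C.fst (n + 1) le_rfl ≫ φ.f (n + 1) le_rfl +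
      C.snd n le_rfl ≫ Y.d n le_rfl) ≫ C.w.inv ≫ S.map e₀.inv := by
    rw [hr₀]
    change M.δ ≫ S.map (C.snd₀ ≫ _) = _
    rw [S.map_comp, reassoc_of% C.δ_snd]
  have bL := C.biproduct n le_rfl
  have hNd : ∀ i (hi : i + 1 ≤ n), (ρ.e i (Nat.le_of_lt hi)).inv ≫ N.d i (Nat.le_of_lt hi) =
      N'.d (i + 1) hi ≫ (ρ.e (i + 1) hi).inv := fun i hi => by
    rw [Iso.inv_comp_eq, ← Category.assoc, Iso.eq_comp_inv, ρ.comm]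
  have hNl : (ρ.e n le_rfl).inv ≫ N.d n le_rfl = N'.δ ≫ ρ.eLast.inv := by
    rw [Iso.inv_comp_eq, ← Category.assoc, Iso.eq_comp_inv, ρ.comm_last]
  let inr : ∀ (i : ℕ) (hi : i ≤ n), Y.obj (i + 1) (Nat.succ_le_succ hi) ⟶
      N.obj (i + 1) (Nat.succ_le_succ hi) :=
    snocDep (m := n) (α := fun i hi => Y.obj (i + 1) (Nat.succ_le_succ hi) ⟶
      N.obj (i + 1) (Nat.succ_le_succ hi))
      (fun i hi => C.inr (i + 1) hi ≫ r.f (i + 2) (Nat.succ_le_succ hi) ≫ (ρ.e (i + 1) hi).inv)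
      (C.w.inv ≫ S.map e₀.inv ≫ ρ.eLast.inv)
  have hinr : ∀ i (hi : i < n), inr i hi.le =
      C.inr (i + 1) hi ≫ r.f (i + 2) (Nat.succ_le_succ hi) ≫ (ρ.e (i + 1) hi).inv :=
    fun i hi => snocDep_lt _ _ i hi
  have hinrL : inr n le_rfl = C.w.inv ≫ S.map e₀.inv ≫ ρ.eLast.inv := snocDep_last _ _
  clear_value inr
  have hinl₀ : C.inl 1 (Nat.succ_le_succ (Nat.zero_le _)) ≫
      r.f 1 (Nat.succ_le_succ (Nat.zero_le _)) = e₁.inv := by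
    rw [hr₁]
    exact (Category.assoc _ _ _).symm.trans
      ((congrArg (· ≫ e₁.inv) b.isBiproduct.inl_fst).trans (Category.id_comp _))
  refine ⟨N, (h.rotation_mem ρ).1 hN', ⟨{
    inl := fun i hi => C.inl (i + 1) (Nat.succ_le_succ hi) ≫
      r.f (i + 1) (Nat.succ_le_succ hi) ≫ (ρ.e i hi).inv
    inr := inr
    isIso_inl := ?_
    isIso_inr := ?_
    biproduct := ?_
    inl_d := ?_
    inl_d_last := ?_
    inr_d := ?_
    inr_δ := ?_ }⟩⟩
  · rw [reassoc_of% hinl₀]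
    infer_instance
  · rw [hinrL]
    infer_instance
  · intro i hi
    obtain ⟨e, -, hr⟩ := hsr (i + 2) (Nat.succ_le_succ hi) (by omega) (by omega)
    have b := C.biproduct (i + 1) hi
    refine ⟨(ρ.e (i + 1) hi).hom ≫ e.hom ≫ C.fst (i + 2) _,
      (ρ.e (i + 1) hi).hom ≫ e.hom ≫ C.snd (i + 1) hi, ?_⟩
    rw [hinr i hi, hr]
    constructor
    · simp [b.inl_fst]
    · simp [b.inl_snd]
    · simp [b.inr_fst]
    · simp [b.inr_snd]
    · simp only [Category.assoc]
      rw [← Preadditive.comp_add, ← Preadditive.comp_add, ← Category.assoc (C.fst _ _),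
        ← Category.assoc (C.snd _ _), ← Preadditive.add_comp, b.total, Category.id_comp,
        Iso.hom_inv_id_assoc, Iso.hom_inv_id]
  · intro i hi
    rw [hinr i hi]
    simp only [Category.assoc]
    rw [hNd i hi, ← reassoc_of% r.comm (i + 1) hi, reassoc_of% C.inl_d (i + 1) hi]
    simp
  · rw [hinrL]
    simp only [Category.assoc]
    rw [hNl, ← reassoc_of% r.comm_δ, reassoc_of% hrδ]
    simp [reassoc_of% bL.inl_fst, reassoc_of% bL.inl_snd]
  · intro i hi
    rw [hinr i hi]
    simp only [Category.assoc]
    rcases hi.lt_or_eq with hi' | rfl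
    · rw [hinr (i + 1) hi', hNd (i + 1) hi', ← reassoc_of% r.comm, reassoc_of% C.inr_d]
    · rw [hinrL, hNl, ← reassoc_of% r.comm_δ, reassoc_of% hrδ]
      simp [reassoc_of% bL.inr_fst, reassoc_of% bL.inr_snd]
  · have e : N.δ = ρ.eLast.hom ≫ ((-1 : ℤ) ^ (n + 2) • S.map (N'.d 0 (Nat.zero_le _))) ≫
        S.map (ρ.e 0 (Nat.zero_le _)).inv := by
      rw [← reassoc_of% ρ.comm_δ, ← S.map_comp, Iso.hom_inv_id, S.map_id, Category.comp_id]
    rw [hinrL, e, reassoc_of% hinl₀]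
    simp only [Category.assoc, Iso.inv_hom_id_assoc, Preadditive.zsmul_comp,
      Preadditive.comp_zsmul]
    rw [← S.map_comp_assoc, hN'd, S.map_comp_assoc, reassoc_of% hd₀]
    simp [smul_smul, pow_succ, neg_one_pow_mul_neg_one_pow]

end Angles

/-! ### Good lifts -/

section Subcategory

variable {D : Type u} [Category.{v} D] [Preadditive D] {S : D ⥤ D} {n : ℕ}
  {P : ObjectProperty D}

namespace IsAngulated

variable {pent : Set (SuspSeq S n)} [S.IsEquivalence] [S.Additive] [HasFiniteBiproducts D]
  (h : IsAngulated n S pent) (hn : 1 ≤ n) (hP : IsAdditiveSubcategory P)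
include h hn hP

/-- (EA2) for the induced structure: all terms of the reduced cone are in the subcategory. -/
theorem exists_coneData {A C C' : P.FullSubcategory} (c : C ⟶ C') (ρ : C'.obj ⟶ S.obj A.obj)
    (X : Cplx n A C) (Y : Cplx n A C') (hX : toSuspSeq X (c.hom ≫ ρ) ∈ pent)
    (hY : toSuspSeq Y ρ ∈ pent) :
    ∃ φ : X.toSeq.Hom Y.toSeq, Cplx.IsLift φ (𝟙 A) c ∧
      ∃ M : Cplx n (X.obj 1 (by omega)) C', Nonempty (Cplx.ConeData φ M) ∧
        toSuspSeq M (ρ ≫ S.map X.dFirst.hom) ∈ pent := by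
  obtain ⟨φ, hφ, M, hM, ⟨C⟩⟩ := h.exists_lift_toSuspSeq hX hY (𝟙 A) c (by simp)
  refine ⟨seqHom φ, hφ, ?_⟩
  obtain ⟨N, hN, ⟨K⟩⟩ := h.exists_angleCone hn hX hY hM φ (P.ι.mapIso (X.left ≪≫ Y.left.symm)) (by
    have : (seqHom φ).f 0 (Nat.zero_le _) = X.left.hom ≫ Y.left.inv := by
      rw [Iso.eq_comp_inv, hφ.left, Category.comp_id]
    exact congrArg InducedCategory.Hom.hom this) C
  have i₀ := K.isIso_inl
  have iL := K.isIso_inr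
  have hNP := K.prop_obj hP (fun i hi => (X.obj i hi).property) fun i hi => (Y.obj i hi).property
  obtain ⟨f, hf⟩ : ∃ f : (X.obj 1 (Nat.succ_le_succ (Nat.zero_le _))).obj ≅
    N.obj 0 (Nat.zero_le _), f.hom = K.inl 0 (Nat.zero_le _) :=
      ⟨@asIso _ _ _ _ (K.inl 0 (Nat.zero_le _)) i₀, rfl⟩
  obtain ⟨g, hg⟩ : ∃ g : (Y.obj (n + 1) le_rfl).obj ≅ N.obj (n + 1) le_rfl,
    g.hom = K.inr n le_rfl := ⟨@asIso _ _ _ _ (K.inr n le_rfl) iL, rfl⟩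
  obtain ⟨y, hy⟩ : ∃ y : (Y.obj (n + 1) le_rfl).obj ≅ C'.obj, y.hom = Y.right.hom.hom :=
    ⟨P.ι.mapIso Y.right, rfl⟩
  refine ⟨N.toCplx (h.isPeriodicComplex hn hN).d_d hNP f.symm (g.symm ≪≫ y), ⟨{
    inl := fun i hi => ObjectProperty.homMk (K.inl i hi)
    inr := fun i hi => ObjectProperty.homMk (K.inr i hi)
    inl_zero := ObjectProperty.hom_ext _ hf.symm
    inr_last := ?_
    biproduct := fun i hi => ?_
    inl_d := fun i hi => ObjectProperty.hom_ext _ (K.inl_d i hi)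
    inl_d_last := ObjectProperty.hom_ext _ K.inl_d_last
    inr_d := fun i hi => ObjectProperty.hom_ext _ (K.inr_d i hi) }⟩, ?_⟩
  · apply ObjectProperty.hom_ext
    change K.inr n le_rfl = Y.right.hom.hom ≫ y.inv ≫ g.hom
    rw [← hg, ← hy, Iso.hom_inv_id_assoc]
  · obtain ⟨fst, snd, b⟩ := K.biproduct i hi
    exact ⟨ObjectProperty.homMk fst, ObjectProperty.homMk snd,
      ⟨ObjectProperty.hom_ext _ b.inl_fst, ObjectProperty.hom_ext _ b.inl_snd,
        ObjectProperty.hom_ext _ b.inr_fst, ObjectProperty.hom_ext _ b.inr_snd,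
        ObjectProperty.hom_ext _ b.total⟩⟩
  · rw [SuspSeq.toSuspSeq_toCplx]
    · exact hN
    · have hδ : g.hom ≫ N.δ = (Y.right.hom.hom ≫ ρ ≫ S.map Y.left.inv.hom) ≫
        S.map ((Y.left.hom.hom ≫ X.left.inv.hom) ≫ (X.d 0 (Nat.zero_le _)).hom ≫ f.hom) := by
        rw [hg, hf]
        exact K.inr_δ
      rw [← cancel_epi g.hom, reassoc_of% hδ]
      change _ = g.hom ≫ (g.inv ≫ y.hom) ≫ _ ≫ S.map (X.left.inv.hom ≫ (X.d 0 _).hom)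
      simp only [Category.assoc, Iso.hom_inv_id_assoc, Iso.symm_hom, ← S.map_comp, hy,
        Iso.hom_inv_id, Category.comp_id]
      rw [ObjectProperty.isoInv_hom_id_hom_assoc]

/-- (EA2ᵒᵖ) for the induced structure: all terms of the reduced cocone are in the subcategory. -/
theorem exists_coconeData {A B C : P.FullSubcategory} (a : A ⟶ B) (δ : C.obj ⟶ S.obj A.obj)
    (X : Cplx n A C) (Y : Cplx n B C) (hX : toSuspSeq X δ ∈ pent)
    (hY : toSuspSeq Y (δ ≫ S.map a.hom) ∈ pent) :
    ∃ φ : X.toSeq.Hom Y.toSeq, Cplx.IsLift φ a (𝟙 C) ∧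
      ∃ N : Cplx n A (Y.obj n (by omega)), Nonempty (Cplx.CoconeData φ N) ∧
        toSuspSeq N (Y.dLast.hom ≫ δ) ∈ pent := by
  obtain ⟨φ, hφ, M, hM, ⟨K⟩⟩ := h.exists_lift_toSuspSeq hX hY a (𝟙 C) (by simp)
  refine ⟨seqHom φ, hφ, ?_⟩
  obtain ⟨N, hN, ⟨K⟩⟩ := h.exists_angleCocone hn hX hY hM φ
    (P.ι.mapIso (X.right ≪≫ Y.right.symm)) (by
      have : (seqHom φ).f (n + 1) le_rfl = X.right.hom ≫ Y.right.inv := by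
        rw [Iso.eq_comp_inv, hφ.right, Category.comp_id]
      exact congrArg InducedCategory.Hom.hom this) K
  have i₀ := K.isIso_fst
  have iL := K.isIso_snd
  have hNP := K.prop_obj hP (fun i hi => (X.obj i hi).property) fun i hi => (Y.obj i hi).property
  obtain ⟨f, hf⟩ : ∃ f : N.obj 0 (Nat.zero_le _) ≅ (X.obj 0 (Nat.zero_le _)).obj,
    f.hom = K.fst 0 (Nat.zero_le _) := ⟨@asIso _ _ _ _ (K.fst 0 (Nat.zero_le _)) i₀, rfl⟩
  obtain ⟨g, hg⟩ : ∃ g : N.obj (n + 1) le_rfl ≅ (Y.obj n (Nat.le_succ _)).obj,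
    g.hom = K.snd n le_rfl := ⟨@asIso _ _ _ _ (K.snd n le_rfl) iL, rfl⟩
  obtain ⟨x, hx⟩ : ∃ x : (X.obj 0 (Nat.zero_le _)).obj ≅ A.obj, x.inv = X.left.inv.hom :=
    ⟨P.ι.mapIso X.left, rfl⟩
  refine ⟨N.toCplx (h.isPeriodicComplex hn hN).d_d hNP (f ≪≫ x) g, ⟨{
    fst := fun i hi => ObjectProperty.homMk (K.fst i hi)
    snd := fun i hi => ObjectProperty.homMk (K.snd i hi)
    fst_zero := ?_
    snd_last := ObjectProperty.hom_ext _ hg.symm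
    biproduct := fun i hi => ?_
    d_fst := fun i hi => ObjectProperty.hom_ext _ (K.d_fst i hi)
    d_snd_zero := ObjectProperty.hom_ext _ K.d_snd_zero
    d_snd := fun i hi => ObjectProperty.hom_ext _ (K.d_snd i hi) }⟩, ?_⟩
  · apply ObjectProperty.hom_ext
    change K.fst 0 _ = (f.hom ≫ x.hom) ≫ X.left.inv.hom
    rw [← hf, ← hx, Category.assoc, Iso.hom_inv_id, Category.comp_id]
  · obtain ⟨inl, inr, b⟩ := K.biproduct i hi
    exact ⟨ObjectProperty.homMk inl, ObjectProperty.homMk inr,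
      ⟨ObjectProperty.hom_ext _ b.inl_fst, ObjectProperty.hom_ext _ b.inl_snd,
        ObjectProperty.hom_ext _ b.inr_fst, ObjectProperty.hom_ext _ b.inr_snd,
        ObjectProperty.hom_ext _ b.total⟩⟩
  · rw [SuspSeq.toSuspSeq_toCplx]
    · exact hN
    · have hδ : N.δ ≫ S.map f.hom = g.hom ≫ (Y.d n le_rfl).hom ≫
        (Y.right.hom.hom ≫ X.right.inv.hom) ≫ X.right.hom.hom ≫ δ ≫ S.map X.left.inv.hom := by
        rw [hf, hg]
        exact K.δ_fst
      rw [Iso.trans_hom, S.map_comp, reassoc_of% hδ]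
      change _ = _ ≫ ((Y.d n _).hom ≫ Y.right.hom.hom) ≫ _
      simp only [Category.assoc]
      rw [ObjectProperty.isoInv_hom_id_hom_assoc, ← S.map_comp, ← hx, Iso.inv_hom_id,
        S.map_id, Category.comp_id]

end IsAngulated

end Subcategory

/-! ### Composition of inflations and of deflations -/

section Inflations

variable {D : Type u} [Category.{v} D] {S : D ⥤ D} {n : ℕ}

/-- `f` is, up to isomorphism, the first morphism of an `(n + 2)`-angle with terms in `P`. -/
def IsAngleInflation (pent : Set (SuspSeq S n)) (P : ObjectProperty D) {A B : D} (f : A ⟶ B) :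
    Prop :=
  ∃ X ∈ pent, (∀ i hi, P (X.obj i hi)) ∧ ∃ (e₀ : X.obj 0 (Nat.zero_le _) ≅ A)
    (e₁ : X.obj 1 (Nat.succ_le_succ (Nat.zero_le _)) ≅ B),
    X.d 0 (Nat.zero_le _) ≫ e₁.hom = e₀.hom ≫ f

/-- `f` is, up to isomorphism, the morphism `d_n` of an `(n + 2)`-angle with terms in `P`. -/
def IsAngleDeflation (pent : Set (SuspSeq S n)) (P : ObjectProperty D) {A B : D} (f : A ⟶ B) :
    Prop :=
  ∃ X ∈ pent, (∀ i hi, P (X.obj i hi)) ∧ ∃ (e₀ : X.obj n (Nat.le_succ _) ≅ A)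
    (e₁ : X.obj (n + 1) le_rfl ≅ B), X.d n le_rfl ≫ e₁.hom = e₀.hom ≫ f

variable {pent : Set (SuspSeq S n)} {P : ObjectProperty D}

theorem IsAngleInflation.of_iso {A B A' B' : D} {f : A ⟶ B} {f' : A' ⟶ B'}
    (h : IsAngleInflation pent P f) (a : A ≅ A') (b : B ≅ B') (hf : f ≫ b.hom = a.hom ≫ f') :
    IsAngleInflation pent P f' := by
  obtain ⟨X, hX, hXP, e₀, e₁, he⟩ := h
  exact ⟨X, hX, hXP, e₀ ≪≫ a, e₁ ≪≫ b, by simp [reassoc_of% he, hf]⟩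

theorem IsAngleDeflation.of_iso {A B A' B' : D} {f : A ⟶ B} {f' : A' ⟶ B'}
    (h : IsAngleDeflation pent P f) (a : A ≅ A') (b : B ≅ B') (hf : f ≫ b.hom = a.hom ≫ f') :
    IsAngleDeflation pent P f' := by
  obtain ⟨X, hX, hXP, e₀, e₁, he⟩ := h
  exact ⟨X, hX, hXP, e₀ ≪≫ a, e₁ ≪≫ b, by simp [reassoc_of% he, hf]⟩

variable [Preadditive D]

namespace IsAngulated

open SuspSeq

variable [S.IsEquivalence] [S.Additive] [HasFiniteBiproducts D]
  (h : IsAngulated n S pent) (hP : IsAdditiveSubcategory P)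
include h hP

/-- Let `V_1 = C ⊕ B` and assume that the component `V_0 ⟶ C` of `d_0` factors through the
component `V_0 ⟶ B`. After an automorphism of `V_1` the component `V_0 ⟶ C` vanishes, so that `C`
is a direct summand of `V_2`. Adding the trivial sequence `C = C` in degrees `2` and `3` and
removing `C = C` in degrees `1` and `2` gives an angle with terms in `P`. -/
theorem isAngleInflation_of_biproduct (hn : 2 ≤ n) {V : SuspSeq S n} (hV : V ∈ pent)
    (hVP : ∀ i hi, P (V.obj i hi)) {B C : D} (hB : P B) (hC : P C)
    {inl : C ⟶ V.obj 1 (Nat.succ_le_succ (Nat.zero_le _))}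
    {inr : B ⟶ V.obj 1 (Nat.succ_le_succ (Nat.zero_le _))}
    {fst : V.obj 1 (Nat.succ_le_succ (Nat.zero_le _)) ⟶ C}
    {snd : V.obj 1 (Nat.succ_le_succ (Nat.zero_le _)) ⟶ B}
    (b : IsBiproduct inl inr fst snd) (g : B ⟶ C)
    (hg : V.d 0 (Nat.zero_le _) ≫ fst = V.d 0 (Nat.zero_le _) ≫ snd ≫ g) :
    IsAngleInflation pent P (V.d 0 (Nat.zero_le _) ≫ snd) := by
  have hn' : 1 ≤ n := by omega
  have hVc := h.isPeriodicComplex hn' hV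
  obtain ⟨t, ht⟩ := (h.isHomExact hn' hV 0 hn').desc (fst - snd ≫ g) (by simp [hg])
  have ht₁ : inl ≫ V.d 1 hn' ≫ t = 𝟙 C := by
    rw [← ht]
    simp [b.inl_fst, reassoc_of% b.inl_snd]
  obtain ⟨T, hT, hT₂, ⟨τ⟩⟩ := h.exists_isTrivAt C (k := 2) (by omega)
  have := hasBinaryBiproducts_of_finite_biproducts D
  obtain ⟨Z, hZ, zl, zr, zf, zs, hz⟩ := h.exists_sum hV hT
  have hTz : ∀ i hi, i ≠ 2 → i ≠ 3 → IsZero (T.obj i hi) := fun i hi h₁ h₂ =>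
    hT₂.isZero i hi h₁ h₂ (by omega)
  have hTP : ∀ i hi, P (T.obj i hi) := fun i hi => by
    by_cases h₁ : i = 2
    · subst h₁
      exact hP.iso τ.symm hC
    by_cases h₂ : i = 3
    · subst h₂
      have := hT₂.isIso hn
      exact hP.iso (τ.symm ≪≫ asIso (T.d 2 hn)) hC
    · exact hP.zero (hTz i hi h₁ h₂)
  have hZP : ∀ i hi, P (Z.obj i hi) := fun i hi =>
    hP.biprod _ _ _ _ (hz i hi) (hVP i hi) (hTP i hi)
  have hfl : ∀ i hi, i ≠ 2 → i ≠ 3 → zf.f i hi ≫ zl.f i hi = 𝟙 _ := fun i hi h₁ h₂ => by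
    rw [← (hz i hi).total, (hTz i hi h₁ h₂).eq_of_tgt (zs.f i hi) 0, zero_comp, add_zero]
  have z₁ := hz 1 (Nat.succ_le_succ (Nat.zero_le _))
  have z₂ := hz 2 (Nat.succ_le_succ hn')
  have hfl₁ := hfl 1 (Nat.succ_le_succ (Nat.zero_le _)) (by omega) (by omega)
  let a₁ : Decomp (Z.obj 1 (Nat.succ_le_succ (Nat.zero_le _))) :=
    { N := B
      T := C
      inl := (inr + g ≫ inl) ≫ zl.f 1 _
      inr := inl ≫ zl.f 1 _
      fst := zf.f 1 _ ≫ snd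
      snd := zf.f 1 _ ≫ (fst - snd ≫ g)
      isBiproduct :=
        { inl_fst := by simp [reassoc_of% z₁.inl_fst, b.inr_snd, b.inl_snd]
          inl_snd := by simp [reassoc_of% z₁.inl_fst, b.inr_fst, b.inl_fst,
            reassoc_of% b.inr_snd, reassoc_of% b.inl_snd]
          inr_fst := by simp [reassoc_of% z₁.inl_fst, b.inl_snd]
          inr_snd := by simp [reassoc_of% z₁.inl_fst, b.inl_fst, reassoc_of% b.inl_snd]
          total := by
            have e : snd ≫ (inr + g ≫ inl) + (fst - snd ≫ g) ≫ inl = 𝟙 _ := by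
              rw [← b.total]
              simp only [Preadditive.comp_add, Preadditive.sub_comp, Category.assoc]
              abel
            rw [Category.assoc, Category.assoc, ← Preadditive.comp_add, ← Category.assoc snd,
              ← Category.assoc (fst - _), ← Preadditive.add_comp, e, Category.id_comp, hfl₁] } }
  let a₂ : Decomp (Z.obj 2 (Nat.succ_le_succ hn')) :=
    { N := V.obj 2 (Nat.succ_le_succ hn')
      T := C
      inl := zl.f 2 _ - t ≫ τ.inv ≫ zr.f 2 _
      inr := inl ≫ V.d 1 hn' ≫ zl.f 2 _
      fst := zf.f 2 _ - (zf.f 2 _ ≫ t + zs.f 2 _ ≫ τ.hom) ≫ inl ≫ V.d 1 hn'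
      snd := zf.f 2 _ ≫ t + zs.f 2 _ ≫ τ.hom
      isBiproduct :=
        { inl_fst := by simp [z₂.inl_fst, z₂.inr_fst, reassoc_of% z₂.inl_fst,
            reassoc_of% z₂.inr_fst, reassoc_of% z₂.inl_snd, reassoc_of% z₂.inr_snd]
          inl_snd := by simp [reassoc_of% z₂.inl_fst,
            reassoc_of% z₂.inr_fst, reassoc_of% z₂.inl_snd, reassoc_of% z₂.inr_snd]
          inr_fst := by simp [z₂.inl_fst, reassoc_of% z₂.inl_fst, reassoc_of% z₂.inl_snd,
            reassoc_of% ht₁]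
          inr_snd := by simp [reassoc_of% z₂.inl_fst, reassoc_of% z₂.inl_snd, ht₁]
          total := by
            simp only [← z₂.total, Preadditive.comp_sub, Preadditive.sub_comp,
              Preadditive.add_comp, Category.assoc, reassoc_of% ht₁, Iso.hom_inv_id_assoc]
            abel } }
  obtain ⟨R, hR, s, r, ⟨e₁, hs₁, hr₁⟩, ⟨e₂, -, -⟩, hsr⟩ := h.exists_restriction_two hZ
    (Nat.succ_le_succ (Nat.zero_le _)) (Nat.succ_le_succ hn') (by decide) a₁ a₂ (by
      intro Dc h₁ h₂ hDc
      refine ⟨fun i hi => ?_, ?_⟩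
      · match i, hi with
        | 0, hi =>
          rw [h₁, hDc 0 _ (by omega) (by omega)]
          refine isDiagonal_triv_left ?_
          change Z.d 0 _ ≫ zf.f 1 _ ≫ (fst - snd ≫ g) = 0
          rw [reassoc_of% zf.comm 0]
          simp [hg]
        | 1, hi =>
          rw [h₁, h₂]
          constructor
          · change ((inr + g ≫ inl) ≫ zl.f 1 _) ≫ Z.d 1 _ ≫
              (zf.f 2 _ ≫ t + zs.f 2 _ ≫ τ.hom) = 0
            rw [Category.assoc, ← reassoc_of% zl.comm 1]
            simp only [Preadditive.comp_add, reassoc_of% z₂.inl_fst, reassoc_of% z₂.inl_snd,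
              zero_comp, add_zero, ← ht]
            simp [b.inl_fst, b.inr_fst, reassoc_of% b.inr_snd, reassoc_of% b.inl_snd]
          · change (inl ≫ zl.f 1 _) ≫ Z.d 1 _ ≫
              (zf.f 2 _ - (zf.f 2 _ ≫ t + zs.f 2 _ ≫ τ.hom) ≫ inl ≫ V.d 1 hn') = 0
            rw [Category.assoc, ← reassoc_of% zl.comm 1]
            simp [z₂.inl_fst, reassoc_of% z₂.inl_fst, reassoc_of% z₂.inl_snd, reassoc_of% ht₁]
        | 2, hi =>
          rw [h₂, hDc (2 + 1) _ (by omega) (by omega)]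
          refine isDiagonal_triv_right ?_
          change (inl ≫ V.d 1 hn' ≫ zl.f 2 _) ≫ Z.d 2 _ = 0
          simp only [Category.assoc]
          rw [← zl.comm 2, reassoc_of% hVc.d_d 1 hi]
          simp
        | i + 3, hi =>
          rw [hDc (i + 3) _ (by omega) (by omega), hDc (i + 3 + 1) _ (by omega) (by omega)]
          exact isDiagonal_triv _
      · rw [hDc (n + 1) _ (by omega) (by omega), hDc 0 _ (by omega) (by omega)]
        exact isDiagonal_map_triv S zero_comp)
  obtain ⟨e₀, hs₀, -⟩ := hsr 0 (Nat.zero_le _) (by omega) (by omega)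
  refine ⟨R, hR, fun i hi => ?_, ⟨s.f 0 _ ≫ zf.f 0 _, zl.f 0 _ ≫ e₀.inv, ?_, ?_⟩, e₁, ?_⟩
  · by_cases h₁ : i = 1
    · subst h₁
      exact hP.iso e₁.symm hB
    by_cases h₂ : i = 2
    · subst h₂
      exact hP.iso e₂.symm (hVP 2 _)
    · obtain ⟨e, -, -⟩ := hsr i hi h₁ h₂
      exact hP.iso e.symm (hZP i hi)
  · rw [hs₀, Category.assoc, reassoc_of% (hfl 0 (Nat.zero_le _) (by omega) (by omega)),
      Iso.hom_inv_id]
  · rw [hs₀, Category.assoc, Iso.inv_hom_id_assoc, (hz 0 _).inl_fst]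
  · have e : s.f 1 _ ≫ zf.f 1 _ ≫ snd = e₁.hom := by
      rw [hs₁, Category.assoc]
      exact (congrArg (e₁.hom ≫ ·) a₁.isBiproduct.inl_fst).trans (Category.comp_id _)
    rw [← e, reassoc_of% s.comm 0, reassoc_of% zf.comm 0, Category.assoc]

/-- Let `V_n = B ⊕ C` and assume that the component `C ⟶ V_{n+1}` of `d_n` factors through the
component `B ⟶ V_{n+1}`. After an automorphism of `V_n` the component `C ⟶ V_{n+1}` vanishes, so
that `C` is a direct summand of `V_{n-1}`. Adding the trivial sequence `C = C` in degrees `n - 2`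
and `n - 1` and removing `C = C` in degrees `n - 1` and `n` gives an angle with terms in `P`. -/
theorem isAngleDeflation_of_biproduct {m : ℕ} (hm : n = m + 2) {V : SuspSeq S n} (hV : V ∈ pent)
    (hVP : ∀ i hi, P (V.obj i hi)) {B C : D} (hB : P B) (hC : P C)
    {inl : B ⟶ V.obj n (Nat.le_succ _)} {inr : C ⟶ V.obj n (Nat.le_succ _)}
    {fst : V.obj n (Nat.le_succ _) ⟶ B} {snd : V.obj n (Nat.le_succ _) ⟶ C}
    (b : IsBiproduct inl inr fst snd) (w : C ⟶ B)
    (hw : inr ≫ V.d n le_rfl = w ≫ inl ≫ V.d n le_rfl) :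
    IsAngleDeflation pent P (inl ≫ V.d n le_rfl) := by
  subst hm
  have hn' : 1 ≤ m + 2 := by omega
  have k₀ : m ≤ m + 2 := by omega
  have k₁ : m + 1 ≤ m + 2 := by omega
  have l₀ : m ≤ m + 2 + 1 := by omega
  have l₁ : m + 1 ≤ m + 2 + 1 := by omega
  have l₂ : m + 2 ≤ m + 2 + 1 := by omega
  have hVc := h.isPeriodicComplex hn' hV
  obtain ⟨t, ht⟩ := (h.isHomExact hn' hV (m + 1) le_rfl).lift (inr - w ≫ inl) (by simp [hw])
  have ht₁ : t ≫ V.d (m + 1) k₁ ≫ snd = 𝟙 C := by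
    rw [← Category.assoc, ← ht]
    simp [b.inr_snd, b.inl_snd]
  have ht₂ : t ≫ V.d (m + 1) k₁ ≫ (fst + snd ≫ w) = 0 := by
    rw [← Category.assoc, ← ht]
    simp [b.inr_fst, b.inl_fst, reassoc_of% b.inr_snd, reassoc_of% b.inl_snd]
  obtain ⟨T, hT, hT₂, ⟨τ'⟩⟩ := h.exists_isTrivAt C (k := m) (by omega)
  have := hT₂.isIso k₀
  obtain ⟨τ⟩ : Nonempty (C ≅ T.obj (m + 1) l₁) := ⟨τ'.symm ≪≫ asIso (T.d m k₀)⟩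
  have := hasBinaryBiproducts_of_finite_biproducts D
  obtain ⟨Z, hZ, zl, zr, zf, zs, hz⟩ := h.exists_sum hV hT
  have hTz : ∀ i hi, i ≠ m → i ≠ m + 1 → IsZero (T.obj i hi) := fun i hi h₁ h₂ =>
    hT₂.isZero i hi h₁ h₂ (by omega)
  have hTP : ∀ i hi, P (T.obj i hi) := fun i hi => by
    by_cases h₁ : i = m
    · subst h₁
      exact hP.iso τ'.symm hC
    by_cases h₂ : i = m + 1
    · subst h₂
      exact hP.iso τ hC
    · exact hP.zero (hTz i hi h₁ h₂)
  have hZP : ∀ i hi, P (Z.obj i hi) := fun i hi =>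
    hP.biprod _ _ _ _ (hz i hi) (hVP i hi) (hTP i hi)
  have hfl : ∀ i hi, i ≠ m → i ≠ m + 1 → zf.f i hi ≫ zl.f i hi = 𝟙 _ := fun i hi h₁ h₂ => by
    rw [← (hz i hi).total, (hTz i hi h₁ h₂).eq_of_tgt (zs.f i hi) 0, zero_comp, add_zero]
  have z₁ := hz (m + 1) l₁
  have z₂ := hz (m + 2) l₂
  have hfl₂ := hfl (m + 2) l₂ (by omega) (by omega)
  let a₁ : Decomp (Z.obj (m + 1) l₁) :=
    { N := V.obj (m + 1) l₁
      T := C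
      inl := zl.f _ _ - V.d (m + 1) k₁ ≫ snd ≫ (t ≫ zl.f _ _ + τ.hom ≫ zr.f _ _)
      inr := t ≫ zl.f _ _ + τ.hom ≫ zr.f _ _
      fst := zf.f _ _ - zs.f _ _ ≫ τ.inv ≫ t
      snd := zf.f _ _ ≫ V.d (m + 1) k₁ ≫ snd
      isBiproduct :=
        { inl_fst := by simp [z₁.inl_fst, z₁.inr_fst, reassoc_of% z₁.inl_snd,
            reassoc_of% z₁.inr_snd]
          inl_snd := by simp [reassoc_of% z₁.inl_fst, reassoc_of% z₁.inr_fst, ht₁]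
          inr_fst := by simp [z₁.inl_fst, z₁.inr_fst, reassoc_of% z₁.inl_snd,
            reassoc_of% z₁.inr_snd]
          inr_snd := by simp [reassoc_of% z₁.inl_fst, reassoc_of% z₁.inr_fst, ht₁]
          total := by
            simp only [← z₁.total, Preadditive.comp_sub, Preadditive.sub_comp,
              Preadditive.comp_add, Category.assoc, reassoc_of% ht₁,
              Iso.inv_hom_id_assoc]
            abel } }
  let a₂ : Decomp (Z.obj (m + 2) l₂) :=
    { N := B
      T := C
      inl := inl ≫ zl.f _ _
      inr := (inr - w ≫ inl) ≫ zl.f _ _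
      fst := zf.f _ _ ≫ (fst + snd ≫ w)
      snd := zf.f _ _ ≫ snd
      isBiproduct :=
        { inl_fst := by simp [reassoc_of% z₂.inl_fst, b.inl_fst, reassoc_of% b.inl_snd]
          inl_snd := by simp [reassoc_of% z₂.inl_fst, b.inl_snd]
          inr_fst := by simp [reassoc_of% z₂.inl_fst, b.inr_fst, b.inl_fst,
            reassoc_of% b.inr_snd, reassoc_of% b.inl_snd]
          inr_snd := by simp [reassoc_of% z₂.inl_fst, b.inr_snd, b.inl_snd]
          total := by
            have e : (fst + snd ≫ w) ≫ inl + snd ≫ (inr - w ≫ inl) = 𝟙 _ := by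
              rw [← b.total]
              simp only [Preadditive.comp_sub, Preadditive.add_comp, Category.assoc]
              abel
            rw [Category.assoc, Category.assoc, ← Preadditive.comp_add, ← Category.assoc snd,
              ← Category.assoc (fst + _), ← Preadditive.add_comp, e, Category.id_comp, hfl₂] } }
  obtain ⟨R, hR, s, r, ⟨e₁, -, -⟩, ⟨e₂, hs₂, hr₂⟩, hsr⟩ := h.exists_restriction_two hZ
    l₁ l₂ (by omega) a₁ a₂ (by
      intro Dc h₁ h₂ hDc
      refine ⟨fun i hi => ?_, ?_⟩
      · by_cases i₀ : i = m
        · subst i₀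
          rw [h₁, hDc i _ (by omega) (by omega)]
          refine isDiagonal_triv_left ?_
          change Z.d i _ ≫ zf.f _ _ ≫ V.d (i + 1) k₁ ≫ snd = 0
          rw [reassoc_of% zf.comm i, reassoc_of% hVc.d_d i k₁]
          simp
        by_cases i₁ : i = m + 1
        · subst i₁
          rw [h₁, h₂]
          have e : (t ≫ zl.f (m + 1) l₁ + τ.hom ≫ zr.f (m + 1) l₁) ≫ Z.d (m + 1) hi ≫
              zf.f (m + 2) l₂ = t ≫ V.d (m + 1) k₁ := by
            rw [zf.comm (m + 1)]
            simp [reassoc_of% z₁.inl_fst, reassoc_of% z₁.inr_fst]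
          constructor
          · change (zl.f _ _ - V.d (m + 1) k₁ ≫ snd ≫ (t ≫ zl.f _ _ + τ.hom ≫ zr.f _ _)) ≫
              Z.d (m + 1) hi ≫ zf.f (m + 2) l₂ ≫ snd = 0
            rw [Preadditive.sub_comp, Category.assoc, Category.assoc, reassoc_of% e, ht₁,
              reassoc_of% zf.comm (m + 1), reassoc_of% z₁.inl_fst]
            simp
          · change (t ≫ zl.f _ _ + τ.hom ≫ zr.f _ _) ≫ Z.d (m + 1) hi ≫
              zf.f (m + 2) l₂ ≫ (fst + snd ≫ w) = 0
            rw [reassoc_of% e, ht₂]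
        by_cases i₂ : i = m + 2
        · subst i₂
          rw [h₂, hDc (m + 2 + 1) _ (by omega) (by omega)]
          refine isDiagonal_triv_right ?_
          change ((inr - w ≫ inl) ≫ zl.f _ _) ≫ Z.d (m + 2) _ = 0
          rw [Category.assoc, ← zl.comm (m + 2)]
          simp [reassoc_of% hw]
        · rw [hDc i _ (by omega) (by omega), hDc (i + 1) _ (by omega) (by omega)]
          exact isDiagonal_triv _
      · rw [hDc (m + 2 + 1) _ (by omega) (by omega), hDc 0 _ (by omega) (by omega)]
        exact isDiagonal_map_triv S zero_comp)
  obtain ⟨e₀, hs₀, hr₀⟩ := hsr (m + 2 + 1) le_rfl (by omega) (by omega)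
  refine ⟨R, hR, fun i hi => ?_, e₂, ⟨s.f _ _ ≫ zf.f _ _, zl.f _ _ ≫ e₀.inv, ?_, ?_⟩, ?_⟩
  · by_cases h₁ : i = m + 1
    · subst h₁
      exact hP.iso e₁.symm (hVP (m + 1) _)
    by_cases h₂ : i = m + 2
    · subst h₂
      exact hP.iso e₂.symm hB
    · obtain ⟨e, -, -⟩ := hsr i hi h₁ h₂
      exact hP.iso e.symm (hZP i hi)
  · rw [hs₀, Category.assoc, reassoc_of% (hfl (m + 2 + 1) le_rfl (by omega) (by omega)),
      Iso.hom_inv_id]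
  · rw [hs₀, Category.assoc, Iso.inv_hom_id_assoc, (hz _ _).inl_fst]
  · change R.d (m + 2) _ ≫ s.f _ _ ≫ zf.f _ _ = _
    rw [reassoc_of% s.comm (m + 2), hs₂, zf.comm (m + 2), Category.assoc]
    change e₂.hom ≫ (inl ≫ zl.f _ _) ≫ _ = _
    rw [Category.assoc, reassoc_of% z₂.inl_fst]

variable (hext : IsNExtensionClosed pent P)
include hext

/-- If `n ≥ 2` and `f ≫ g` is an inflation, then so is `f`: pushing out the angle of `f ≫ g` along
`f` and taking the cocone gives an angle starting with `(f ≫ g, f) : A ⟶ C ⊕ B`. -/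
theorem isAngleInflation_of_comp (hn : 2 ≤ n) {A B C : D} (f : A ⟶ B) (g : B ⟶ C) (hB : P B)
    (hfg : IsAngleInflation pent P (f ≫ g)) : IsAngleInflation pent P f := by
  have hn' : 1 ≤ n := by omega
  obtain ⟨X, hX, hXP, e₀, e₁, he⟩ := hfg
  obtain ⟨Y, hY, hYP, b₀, b₁, hb⟩ := hext hB (hXP (n + 1) le_rfl) (X.δ ≫ S.map (e₀.hom ≫ f))
  obtain ⟨φ, h₀, h₁, M, hM, ⟨C⟩⟩ := h.complete_ends_cone hX hY (e₀.hom ≫ f ≫ b₀.inv) b₁.inv (by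
    rw [← cancel_mono (S.map b₀.hom), Category.assoc, Category.assoc, hb, Iso.inv_hom_id_assoc,
      ← S.map_comp]
    simp)
  obtain ⟨N, hN, ⟨K⟩⟩ := h.exists_angleCocone hn' hX hY hM φ b₁.symm h₁ C
  obtain ⟨inl, inr, b⟩ := K.biproduct 0 hn'
  have := K.isIso_fst
  refine (h.isAngleInflation_of_biproduct hP hn hN (K.prop_obj hP hXP hYP) (hYP 0 _) (hXP 1 _) b
    (b₀.hom ≫ g ≫ e₁.inv) ?_).of_iso (asIso (K.fst 0 (Nat.zero_le _)) ≪≫ e₀) b₀ ?_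
  · rw [K.d_fst 0 hn', reassoc_of% K.d_snd_zero, h₀, ← cancel_mono e₁.hom, Category.assoc, he]
    simp
  · rw [K.d_snd_zero, h₀]
    simp

/-- If `n ≥ 2` and `f ≫ g` is a deflation, then so is `g`: pulling back the angle of `f ≫ g` along
`g` and taking the cone gives an angle with last morphism `(g, f ≫ g) : B ⊕ A ⟶ C`. -/
theorem isAngleDeflation_of_comp (hn : 2 ≤ n) {A B C : D} (f : A ⟶ B) (g : B ⟶ C) (hB : P B)
    (hfg : IsAngleDeflation pent P (f ≫ g)) : IsAngleDeflation pent P g := by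
  obtain ⟨m, rfl⟩ : ∃ m, n = m + 2 := ⟨n - 2, by omega⟩
  have hn' : 1 ≤ m + 2 := by omega
  obtain ⟨X, hX, hXP, e₀, e₁, he⟩ := hfg
  obtain ⟨E, hE, hEP, b₀, b₁, hb⟩ := hext (hXP 0 (Nat.zero_le _)) hB (g ≫ e₁.inv ≫ X.δ)
  obtain ⟨φ, h₀, h₁, M, hM, ⟨C⟩⟩ := h.complete_ends_cone hE hX b₀.hom (b₁.hom ≫ g ≫ e₁.inv) (by
    simpa using hb)
  obtain ⟨N, hN, ⟨K⟩⟩ := h.exists_angleCone hn' hE hX hM φ b₀ h₀ C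
  obtain ⟨fst, snd, b⟩ := K.biproduct (m + 1) le_rfl
  have := K.isIso_inr
  refine (h.isAngleDeflation_of_biproduct hP rfl hN (K.prop_obj hP hEP hXP) (hEP _ _) (hXP _ _) b
    (e₀.hom ≫ f ≫ b₁.inv) ?_).of_iso b₁ ((asIso (K.inr (m + 2) le_rfl)).symm ≪≫ e₁) ?_
  · have h₁' : φ.f (m + 2 + 1) le_rfl = b₁.hom ≫ g ≫ e₁.inv := h₁
    have : X.d (m + 2) le_rfl = e₀.hom ≫ (f ≫ g) ≫ e₁.inv := by
      rw [← Category.assoc, ← he, Category.assoc, Iso.hom_inv_id, Category.comp_id]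
    rw [K.inr_d (m + 1) le_rfl, K.inl_d_last, h₁', this]
    simp
  · have h₁' : φ.f (m + 2 + 1) le_rfl = b₁.hom ≫ g ≫ e₁.inv := h₁
    rw [K.inl_d_last, h₁']
    simp

/-- Given angles `X` starting with `f` and `Y` starting with `g`, the composition `f ≫ g` is the
first factor of an inflation: such an inflation starts the angle with
last morphism `(ε, δ) : E_n ⊕ X_{n+1} ⟶ S X_0`, where `X_2 ⟶ E_1 ⟶ ⋯ ⟶ E_n ⟶ Y_{n+1}` realizes the
image of the extension of `g` under `d_1 : X_1 ⟶ X_2`, and `ε` is a lift along `S f` of the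
extension of `g` restricted to `E_n`. -/
theorem exists_isAngleInflation_comp_comp (hn : 1 ≤ n) {A B C : D} {f : A ⟶ B} {g : B ⟶ C}
    (hf : IsAngleInflation pent P f) (hg : IsAngleInflation pent P g) :
    P C ∧ ∃ (T : D) (z : C ⟶ T), IsAngleInflation pent P ((f ≫ g) ≫ z) := by
  obtain ⟨X, hX, hXP, x₀, x₁, hx⟩ := hf
  obtain ⟨Y, hY, hYP, y₀, y₁, hy⟩ := hg
  refine ⟨hP.iso y₁ (hYP 1 _), ?_⟩
  have := hasBinaryBiproducts_of_finite_biproducts D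
  obtain ⟨E, hE, hEP, a₀, a₁, ha⟩ := hext (hXP 2 (Nat.succ_le_succ hn)) (hYP (n + 1) le_rfl)
    (Y.δ ≫ S.map (y₀.hom ≫ x₁.inv ≫ X.d 1 hn))
  obtain ⟨ε, hε⟩ := ((h.isHomExact hn hX 0 hn).map S).lift
    (E.d n le_rfl ≫ a₁.hom ≫ Y.δ ≫ S.map (y₀.hom ≫ x₁.inv)) (by
      have e : a₁.hom ≫ Y.δ ≫ S.map (y₀.hom ≫ x₁.inv) ≫ S.map (X.d 1 hn) = E.δ ≫ S.map a₀.hom := by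
        rw [ha, ← S.map_comp, Category.assoc]
      simp only [Category.assoc]
      change E.d n _ ≫ a₁.hom ≫ Y.δ ≫ S.map (y₀.hom ≫ x₁.inv) ≫ S.map (X.d 1 hn) = 0
      rw [e, reassoc_of% (h.isHomExact_last hn hE).zero, zero_comp])
  obtain ⟨U, hU, hUP, c₀, c₁, hc⟩ := hext (hXP 0 (Nat.zero_le _))
    (hP.biprod _ _ _ _ (isBiproduct_biprod (E.obj n (Nat.le_succ _)) (X.obj (n + 1) le_rfl))
      (hEP n _) (hXP (n + 1) _)) (biprod.desc ε X.δ)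
  have hU₀ : biprod.desc ε X.δ ≫ S.map (c₀.inv ≫ U.d 0 (Nat.zero_le _)) = 0 := by
    have e : c₁.hom ≫ biprod.desc ε X.δ ≫ S.map c₀.inv = U.δ := by
      rw [← reassoc_of% hc, ← S.map_comp, Iso.hom_inv_id, S.map_id, Category.comp_id]
    rw [← cancel_epi c₁.hom, S.map_comp, reassoc_of% e, (h.isHomExact_δ hn hU).zero, comp_zero]
  have hε₀ : ε ≫ S.map (c₀.inv ≫ U.d 0 (Nat.zero_le _)) = 0 := by
    rw [← biprod.inl_desc ε X.δ, Category.assoc, hU₀, comp_zero]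
  have hδ₀ : X.δ ≫ S.map (c₀.inv ≫ U.d 0 (Nat.zero_le _)) = 0 := by
    rw [← biprod.inr_desc ε X.δ, Category.assoc, hU₀, comp_zero]
  obtain ⟨u, hu⟩ := h.exists_extension hn hX _ hδ₀
  obtain ⟨k, hk⟩ := (h.isHomExact_last hn hE).desc
    (a₁.hom ≫ Y.δ ≫ S.map (y₀.hom ≫ x₁.inv ≫ u)) (by
      have e : E.d n le_rfl ≫ a₁.hom ≫ Y.δ ≫ S.map (y₀.hom ≫ x₁.inv ≫ u) =
          (E.d n le_rfl ≫ a₁.hom ≫ Y.δ ≫ S.map (y₀.hom ≫ x₁.inv)) ≫ S.map u := by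
        simp
      rw [e, hε, Category.assoc, ← S.map_comp, ← hu, hε₀])
  obtain ⟨k, rfl⟩ : ∃ k', k = S.map k' := ⟨S.preimage k, (S.map_preimage k).symm⟩
  obtain ⟨z, hz⟩ := h.exists_extension hn hY
    (y₀.hom ≫ x₁.inv ≫ u - y₀.hom ≫ x₁.inv ≫ X.d 1 hn ≫ a₀.inv ≫ k) (by
      rw [← cancel_epi a₁.hom, S.map_sub, Preadditive.comp_sub, Preadditive.comp_sub, hk,
        ← Category.assoc x₁.inv, ← Category.assoc y₀.hom, S.map_comp (y₀.hom ≫ _),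
        ← reassoc_of% ha, ← S.map_comp, Iso.hom_inv_id_assoc, sub_self, comp_zero])
  refine ⟨U.obj 1 _, y₁.inv ≫ z, U, hU, hUP, c₀ ≪≫ x₀, Iso.refl _, ?_⟩
  have e₁ : g ≫ y₁.inv = y₀.inv ≫ Y.d 0 (Nat.zero_le _) := by
    rw [Iso.comp_inv_eq, Category.assoc, hy, Iso.inv_hom_id_assoc]
  have e₂ : x₀.hom ≫ f ≫ x₁.inv = X.d 0 (Nat.zero_le _) := by
    rw [← reassoc_of% hx, Iso.hom_inv_id, Category.comp_id]
  have e₃ : X.d 0 (Nat.zero_le _) ≫ X.d 1 hn = 0 := (h.isHomExact hn hX 0 hn).zero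
  rw [Iso.refl_hom, Category.comp_id, Iso.trans_hom, Category.assoc, Category.assoc,
    ← Iso.inv_comp_eq, hu, reassoc_of% e₁, ← hz]
  simp only [Preadditive.comp_sub, Iso.inv_hom_id_assoc]
  rw [reassoc_of% e₂, reassoc_of% e₂, reassoc_of% e₃, zero_comp, sub_zero]

/-- The dual of `exists_isAngleInflation_comp_comp`. -/
theorem exists_isAngleDeflation_comp_comp (hn : 1 ≤ n) {A B C : D} {f : A ⟶ B} {g : B ⟶ C}
    (hf : IsAngleDeflation pent P f) (hg : IsAngleDeflation pent P g) :
    P A ∧ ∃ (T : D) (z : T ⟶ A), IsAngleDeflation pent P (z ≫ f ≫ g) := by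
  obtain ⟨m, rfl⟩ : ∃ m, n = m + 1 := ⟨n - 1, by omega⟩
  obtain ⟨X, hX, hXP, x₀, x₁, hx⟩ := hf
  obtain ⟨Y, hY, hYP, y₀, y₁, hy⟩ := hg
  refine ⟨hP.iso x₀ (hXP _ _), ?_⟩
  have := hasBinaryBiproducts_of_finite_biproducts D
  have k₀ : m ≤ m + 1 := Nat.le_succ _
  have k₁ : m ≤ m + 1 + 1 := Nat.le_succ_of_le k₀
  obtain ⟨E, hE, hEP, a₀, a₁, ha⟩ := hext (hXP 0 (Nat.zero_le _)) (hYP m k₁)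
    (Y.d m k₀ ≫ y₀.hom ≫ x₁.inv ≫ X.δ)
  obtain ⟨ε, hε⟩ := (h.isHomExact hn hY m le_rfl).desc
    (y₀.hom ≫ x₁.inv ≫ X.δ ≫ S.map (a₀.inv ≫ E.d 0 (Nat.zero_le _))) (by
      have e : Y.d m k₀ ≫ y₀.hom ≫ x₁.inv ≫ X.δ ≫ S.map a₀.inv = a₁.inv ≫ E.δ := by
        rw [Iso.eq_inv_comp, ← reassoc_of% ha, ← S.map_comp, Iso.hom_inv_id, S.map_id,
          Category.comp_id]
      rw [S.map_comp, reassoc_of% e, (h.isHomExact_δ hn hE).zero, comp_zero])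
  have hbi := isBiproduct_biprod (E.obj 1 (Nat.succ_le_succ (Nat.zero_le _)))
    (Y.obj 0 (Nat.zero_le _))
  have hbi' := hbi.map S
  obtain ⟨U, hU, hUP, c₀, c₁, hc⟩ := hext (hP.biprod _ _ _ _ hbi (hEP 1 _) (hYP 0 _))
    (hYP (m + 1 + 1) le_rfl) (ε ≫ S.map biprod.inl + Y.δ ≫ S.map biprod.inr)
  have hU₀ : (U.d (m + 1) le_rfl ≫ c₁.hom) ≫ (ε ≫ S.map biprod.inl + Y.δ ≫ S.map biprod.inr) =
      0 := by
    rw [Category.assoc, ← hc, reassoc_of% (h.isHomExact_last hn hU).zero, zero_comp]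
  have hε₀ : (U.d (m + 1) le_rfl ≫ c₁.hom) ≫ ε = 0 := by
    have := congrArg (· ≫ S.map biprod.fst) hU₀
    simpa only [Category.assoc, Preadditive.add_comp, hbi'.inl_fst, hbi'.inr_fst, comp_zero,
      add_zero, Category.comp_id, zero_comp] using this
  have hδ₀ : (U.d (m + 1) le_rfl ≫ c₁.hom) ≫ Y.δ = 0 := by
    have := congrArg (· ≫ S.map biprod.snd) hU₀
    simpa only [Category.assoc, Preadditive.add_comp, hbi'.inl_snd, hbi'.inr_snd, comp_zero,
      zero_add, Category.comp_id, zero_comp] using this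
  obtain ⟨u, hu⟩ := (h.isHomExact_last hn hY).lift _ hδ₀
  obtain ⟨k, hk⟩ := (h.isHomExact_δ hn hE).lift (u ≫ y₀.hom ≫ x₁.inv ≫ X.δ ≫ S.map a₀.inv) (by
    simp only [Category.assoc]
    rw [← S.map_comp, hε, ← reassoc_of% hu, ← Category.assoc, hε₀])
  obtain ⟨z, hz⟩ := (h.isHomExact_last hn hX).lift
    (u ≫ y₀.hom ≫ x₁.inv - k ≫ a₁.hom ≫ Y.d m k₀ ≫ y₀.hom ≫ x₁.inv) (by
      rw [Preadditive.sub_comp, sub_eq_zero]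
      simp only [Category.assoc]
      rw [← ha, ← reassoc_of% hk, ← S.map_comp, Iso.inv_hom_id, S.map_id, Category.comp_id])
  refine ⟨U.obj (m + 1) _, z ≫ x₀.hom, U, hU, hUP, Iso.refl _, c₁ ≪≫ y₁, ?_⟩
  have e₁ : x₀.hom ≫ f = X.d (m + 1) le_rfl ≫ x₁.hom := hx.symm
  have e₂ : y₀.hom ≫ g = Y.d (m + 1) le_rfl ≫ y₁.hom := hy.symm
  have e₃ : Y.d m k₀ ≫ Y.d (m + 1) le_rfl = 0 := (h.isHomExact hn hY m le_rfl).zero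
  rw [Iso.refl_hom, Category.id_comp, Iso.trans_hom, ← Category.assoc, hu, Category.assoc,
    Category.assoc, reassoc_of% e₁, ← reassoc_of% hz]
  simp only [Preadditive.sub_comp, Category.assoc, Iso.inv_hom_id_assoc]
  rw [e₂, reassoc_of% e₃, zero_comp, comp_zero, comp_zero, sub_zero]

end IsAngulated

end Inflations

/-! ### The triangulated case -/

section Triangulated

variable {D : Type u} [Category.{v} D] [Preadditive D] [HasFiniteBiproducts D] {S : D ⥤ D}
  [S.IsEquivalence] [S.Additive] {pent : Set (SuspSeq S 1)} {P : ObjectProperty D}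

namespace IsAngulated

open SuspSeq

variable (h : IsAngulated 1 S pent)
include h

/-- A triangle is determined by its first morphism up to isomorphism. -/
theorem nonempty_iso_of_iso {X Y : SuspSeq S 1} (hX : X ∈ pent) (hY : Y ∈ pent)
    (e₀ : X.obj 0 (by omega) ≅ Y.obj 0 (by omega)) (e₁ : X.obj 1 (by omega) ≅ Y.obj 1 (by omega))
    (he : X.d 0 (by omega) ≫ e₁.hom = e₀.hom ≫ Y.d 0 (by omega)) :
    Nonempty (X.obj 2 le_rfl ≅ Y.obj 2 le_rfl) := by
  -- An endomorphism which is the identity in degrees `0` and `1` is `1 + α` with `α ≫ α = 0`.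
  have key : ∀ {X : SuspSeq S 1}, X ∈ pent → ∀ χ : SuspSeq.Hom X X, χ.f 0 (by omega) = 𝟙 _ →
      χ.f 1 (by omega) = 𝟙 _ → IsIso (χ.f 2 le_rfl) := by
    intro X hX χ h₀ h₁
    obtain ⟨k, hk⟩ := (h.isHomExact_last le_rfl hX).lift (χ.f 2 le_rfl - 𝟙 _) (by
      have := χ.comm_δ
      rw [h₀, S.map_id, Category.comp_id] at this
      rw [Preadditive.sub_comp, ← this, Category.id_comp, sub_self])
    have h₂ : X.d 1 le_rfl ≫ (χ.f 2 le_rfl - 𝟙 _) = 0 := by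
      rw [Preadditive.comp_sub, χ.comm 1 le_rfl, h₁, Category.id_comp, Category.comp_id, sub_self]
    have h₃ : (χ.f 2 le_rfl - 𝟙 _) ≫ (χ.f 2 le_rfl - 𝟙 _) = 0 := by
      nth_rw 1 [hk]
      rw [Category.assoc, h₂, comp_zero]
    obtain ⟨α, hα⟩ : ∃ α, χ.f 2 le_rfl = 𝟙 _ + α := ⟨χ.f 2 le_rfl - 𝟙 _, by abel⟩
    rw [hα, add_sub_cancel_left] at h₃
    rw [hα]
    exact ⟨𝟙 _ - α, by simp [h₃], by simp [h₃]⟩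
  obtain ⟨φ, f₀, f₁⟩ := h.complete X hX Y hY e₀.hom e₁.hom he
  obtain ⟨ψ, g₀, g₁⟩ := h.complete Y hY X hX e₀.inv e₁.inv (by
    rw [Iso.comp_inv_eq, Category.assoc, he, Iso.inv_hom_id_assoc])
  have i₁ : IsIso (φ.f 2 le_rfl ≫ ψ.f 2 le_rfl) :=
    key hX (φ.comp' ψ) (by simp [f₀, g₀]) (by simp [f₁, g₁])
  have i₂ : IsIso (ψ.f 2 le_rfl ≫ φ.f 2 le_rfl) :=
    key hY (ψ.comp' φ) (by simp [f₀, g₀]) (by simp [f₁, g₁])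
  have : IsSplitEpi (φ.f 2 le_rfl) :=
    ⟨⟨⟨inv (ψ.f 2 le_rfl ≫ φ.f 2 le_rfl) ≫ ψ.f 2 le_rfl, by simp⟩⟩⟩
  have : Mono (φ.f 2 le_rfl) := mono_of_mono _ (ψ.f 2 le_rfl)
  have := isIso_of_mono_of_isSplitEpi (φ.f 2 le_rfl)
  exact ⟨asIso (φ.f 2 le_rfl)⟩

/-- A triangle is determined by its second morphism up to isomorphism. -/
theorem nonempty_iso_of_iso' {X Y : SuspSeq S 1} (hX : X ∈ pent) (hY : Y ∈ pent)
    (e₁ : X.obj 1 (by omega) ≅ Y.obj 1 (by omega)) (e₂ : X.obj 2 le_rfl ≅ Y.obj 2 le_rfl)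
    (he : X.d 1 le_rfl ≫ e₂.hom = e₁.hom ≫ Y.d 1 le_rfl) :
    Nonempty (X.obj 0 (by omega) ≅ Y.obj 0 (by omega)) := by
  obtain ⟨X', ⟨ρ⟩⟩ := X.exists_rotationData_from
  obtain ⟨Y', ⟨σ⟩⟩ := Y.exists_rotationData_from
  obtain ⟨e⟩ := h.nonempty_iso_of_iso ((h.rotation_mem ρ).1 hX) ((h.rotation_mem σ).1 hY)
    (ρ.e 0 (by omega) ≪≫ e₁ ≪≫ (σ.e 0 (by omega)).symm)
    (ρ.e 1 le_rfl ≪≫ e₂ ≪≫ (σ.e 1 le_rfl).symm) (by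
      have h₁ := ρ.comm 0 le_rfl
      have h₂ := σ.comm 0 le_rfl
      simp only [Iso.trans_hom, Iso.symm_hom, ← Category.assoc]
      rw [Iso.comp_inv_eq]
      simp only [Category.assoc]
      rw [h₂, Iso.inv_hom_id_assoc]
      change X'.d 0 _ ≫ (ρ.e (0 + 1) _).hom ≫ e₂.hom = _
      rw [reassoc_of% h₁]
      exact congrArg ((ρ.e 0 _).hom ≫ ·) he)
  exact ⟨S.preimageIso (ρ.eLast.symm ≪≫ e ≪≫ σ.eLast)⟩

variable (hP : IsAdditiveSubcategory P) (hext : IsNExtensionClosed pent P)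
include hP hext

/-- Composition of inflations for `n = 1`. The third terms of a triangle starting with `f ≫ g` and
of the triangle `X_2 ⟶ E_1 ⟶ Y_2` realizing the push-out of the extension of `g` are isomorphic,
because both are the third term of a triangle starting with `X_1 ⟶ Y_1 ⊕ X_2`. -/
theorem isAngleInflation_comp_of_triangulated {A B C : D} {f : A ⟶ B} {g : B ⟶ C}
    (hf : IsAngleInflation pent P f) (hg : IsAngleInflation pent P g) :
    IsAngleInflation pent P (f ≫ g) := by
  obtain ⟨X, hX, hXP, x₀, x₁, hx⟩ := hf
  obtain ⟨Y, hY, hYP, y₀, y₁, hy⟩ := hg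
  obtain ⟨Z, hZ, z₀, z₁, hz⟩ := h.exists_angle (f ≫ g)
  obtain ⟨E, hE, hEP, a₀, a₁, ha⟩ := hext (hXP 2 le_rfl) (hYP 2 le_rfl)
    (Y.δ ≫ S.map (y₀.hom ≫ x₁.inv ≫ X.d 1 le_rfl))
  -- The triangle `Y_0 ⟶ Y_1 ⊕ X_2 ⟶ E_1`.
  obtain ⟨φ, φ₀, φ₁, M, hM, ⟨K⟩⟩ := h.complete_ends_cone hY hE
    (y₀.hom ≫ x₁.inv ≫ X.d 1 le_rfl ≫ a₀.inv) a₁.inv (by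
      rw [← cancel_mono (S.map a₀.hom), Category.assoc, Category.assoc, ha,
        Iso.inv_hom_id_assoc, ← S.map_comp]
      simp)
  obtain ⟨N, hN, ⟨K⟩⟩ := h.exists_angleCocone le_rfl hY hE hM φ a₁.symm φ₁ K
  -- The triangle `X_1 ⟶ X_2 ⊕ Z_1 ⟶ Z_2`.
  obtain ⟨X', ⟨ρ⟩⟩ := X.exists_rotationData_from
  obtain ⟨Z', ⟨σ⟩⟩ := Z.exists_rotationData_from
  have hX' := (h.rotation_mem ρ).1 hX
  have hZ' := (h.rotation_mem σ).1 hZ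
  obtain ⟨ψ, ψ₀, ψ₁, M', hM', ⟨K'⟩⟩ := h.complete_ends_cone hX' hZ'
    ((ρ.e 0 (by omega)).hom ≫ x₁.hom ≫ g ≫ z₁.inv ≫ (σ.e 0 (by omega)).inv)
    (ρ.eLast ≪≫ S.mapIso (x₀ ≪≫ z₀.symm) ≪≫ σ.eLast.symm).hom (by
      have h₁ : Z'.δ = σ.eLast.hom ≫ ((-1 : ℤ) ^ (1 + 2) • S.map (Z.d 0 (by omega))) ≫
          S.map (σ.e 0 (by omega)).inv := by
        rw [← reassoc_of% σ.comm_δ, ← S.map_comp, Iso.hom_inv_id, S.map_id, Category.comp_id]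
      have h₂ : X.d 0 (by omega) ≫ x₁.hom ≫ g ≫ z₁.inv = x₀.hom ≫ z₀.inv ≫ Z.d 0 (by omega) := by
        rw [reassoc_of% hx, ← cancel_mono z₁.hom]
        simp [hz]
      rw [S.map_comp, reassoc_of% ρ.comm_δ, h₁]
      simp only [Iso.trans_hom, Iso.symm_hom, Category.assoc, Iso.inv_hom_id_assoc,
        Functor.mapIso_hom, Preadditive.zsmul_comp, Preadditive.comp_zsmul, ← S.map_comp]
      rw [reassoc_of% h₂])
  obtain ⟨N', hN', ⟨K'⟩⟩ := h.exists_angleCocone le_rfl hX' hZ' hM' ψ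
    (ρ.eLast ≪≫ S.mapIso (x₀ ≪≫ z₀.symm) ≪≫ σ.eLast.symm) ψ₁ K'
  -- Both triangles have the same first morphism.
  obtain ⟨inl, inr, b⟩ := K.biproduct 0 le_rfl
  obtain ⟨inl', inr', b'⟩ := K'.biproduct 0 le_rfl
  have i₁ := K.isIso_fst
  have i₂ := K.isIso_snd
  have i₁' := K'.isIso_fst
  have i₂' := K'.isIso_snd
  obtain ⟨e₁, he₁⟩ : ∃ e : N.obj 1 (by omega) ≅ N'.obj 1 (by omega), e.hom =
      K.fst 1 le_rfl ≫ y₁.hom ≫ z₁.inv ≫ (σ.e 0 (by omega)).inv ≫ inr' +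
      K.snd 0 (by omega) ≫ a₀.hom ≫ (ρ.e 1 le_rfl).inv ≫ inl' := by
    exact ⟨b.iso b'.symm (y₁ ≪≫ z₁.symm ≪≫ (σ.e 0 (by omega)).symm)
      (a₀ ≪≫ (ρ.e 1 le_rfl).symm), by simp⟩
  obtain ⟨e⟩ := h.nonempty_iso_of_iso hN hN'
    (asIso (K.fst 0 (Nat.zero_le _)) ≪≫ y₀ ≪≫ x₁.symm ≪≫ (ρ.e 0 (by omega)).symm ≪≫
      (asIso (K'.fst 0 (Nat.zero_le _))).symm) e₁ (by
    rw [he₁]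
    apply b'.hom_ext_to
    · have h₁ := ρ.comm 0 le_rfl
      have h₁' : X'.d 0 (by omega) = (ρ.e 0 (by omega)).hom ≫ X.d 1 le_rfl ≫
          (ρ.e 1 le_rfl).inv := by
        rw [← Category.assoc, Iso.eq_comp_inv]
        exact h₁
      simp only [Category.assoc, Preadditive.comp_add, Preadditive.add_comp, b'.inl_fst,
        b'.inr_fst, comp_zero, zero_add, Iso.trans_hom, Iso.symm_hom, asIso_hom, asIso_inv,
        Category.comp_id]
      rw [K'.d_fst 0 le_rfl, reassoc_of% K.d_snd_zero, φ₀, h₁']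
      simp
    · simp only [Category.assoc, Preadditive.comp_add, Preadditive.add_comp, b'.inl_snd,
        b'.inr_snd, comp_zero, add_zero, Iso.trans_hom, Iso.symm_hom, asIso_hom, asIso_inv,
        Category.comp_id]
      rw [K'.d_snd_zero, reassoc_of% K.d_fst 0 le_rfl, ψ₀, reassoc_of% hy]
      simp)
  have hZ₂ : P (Z.obj 2 le_rfl) := hP.iso ((asIso (K.snd 1 le_rfl)).symm ≪≫ e ≪≫
    asIso (K'.snd 1 le_rfl) ≪≫ σ.e 1 le_rfl) (hEP 1 _)
  refine ⟨Z, hZ, fun i hi => ?_, z₀, z₁, hz⟩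
  match i, hi with
  | 0, _ => exact hP.iso (x₀ ≪≫ z₀.symm) (hXP 0 _)
  | 1, _ => exact hP.iso (y₁ ≪≫ z₁.symm) (hYP 1 _)
  | 2, _ => exact hZ₂

/-- Composition of deflations for `n = 1`. The first terms of a triangle ending with `f ≫ g` and
of the triangle `X_0 ⟶ E_1 ⟶ Y_0` realizing the pull-back of the extension of `f` are isomorphic,
because both are the first term of a triangle ending with `Y_0 ⊕ X_1 ⟶ Y_1`. -/
theorem isAngleDeflation_comp_of_triangulated {A B C : D} {f : A ⟶ B} {g : B ⟶ C}
    (hf : IsAngleDeflation pent P f) (hg : IsAngleDeflation pent P g) :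
    IsAngleDeflation pent P (f ≫ g) := by
  obtain ⟨X, hX, hXP, x₁, x₂, hx⟩ := hf
  obtain ⟨Y, hY, hYP, y₁, y₂, hy⟩ := hg
  obtain ⟨W, hW, w₁, w₂, hw⟩ : ∃ W ∈ pent, ∃ (w₁ : W.obj 1 (by omega) ≅ A)
      (w₂ : W.obj 2 le_rfl ≅ C), W.d 1 le_rfl ≫ w₂.hom = w₁.hom ≫ f ≫ g := by
    obtain ⟨V, hV, v₀, v₁, hv⟩ := h.exists_angle (f ≫ g)
    obtain ⟨W, ⟨ω⟩⟩ := V.exists_rotationData_to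
    refine ⟨W, (h.rotation_mem ω).2 hV, (ω.e 0 (by omega)).symm ≪≫ v₀,
      (ω.e 1 le_rfl).symm ≪≫ v₁, ?_⟩
    have h₁ := ω.comm 0 le_rfl
    rw [← Iso.inv_comp_eq] at h₁
    change W.d (0 + 1) _ ≫ (ω.e 1 le_rfl).inv ≫ v₁.hom = _
    rw [← h₁]
    simp [hv]
  obtain ⟨E, hE, hEP, a₀, a₁, ha⟩ := hext (hXP 0 (Nat.zero_le _)) (hYP 0 (Nat.zero_le _))
    (Y.d 0 (Nat.zero_le _) ≫ y₁.hom ≫ x₂.inv ≫ X.δ)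
  -- The triangle `E_1 ⟶ E_2 ⊕ X_1 ⟶ X_2`.
  obtain ⟨φ, φ₀, φ₁, M, hM, ⟨K⟩⟩ := h.complete_ends_cone hE hX a₀.hom
    (a₁.hom ≫ Y.d 0 (Nat.zero_le _) ≫ y₁.hom ≫ x₂.inv) (by simpa using ha)
  obtain ⟨N, hN, ⟨K⟩⟩ := h.exists_angleCone le_rfl hE hX hM φ a₀ φ₀ K
  -- The triangle `W_0 ⟶ W_1 ⊕ Y_0 ⟶ Y_1`.
  obtain ⟨W', ⟨ρ⟩⟩ := W.exists_rotationData_to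
  obtain ⟨Y', ⟨σ⟩⟩ := Y.exists_rotationData_to
  have hW' := (h.rotation_mem ρ).2 hW
  have hY' := (h.rotation_mem σ).2 hY
  obtain ⟨c, hc⟩ : ∃ c : W'.obj 0 (by omega) ≅ Y'.obj 0 (by omega), S.map c.hom =
      ρ.eLast.inv ≫ w₂.hom ≫ y₂.inv ≫ σ.eLast.hom :=
    ⟨S.preimageIso (ρ.eLast.symm ≪≫ w₂ ≪≫ y₂.symm ≪≫ σ.eLast), by simp⟩
  obtain ⟨ψ, ψ₀, ψ₁, M', hM', ⟨K'⟩⟩ := h.complete_ends_cone hW' hY' c.hom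
    ((ρ.e 1 le_rfl).inv ≫ w₁.hom ≫ f ≫ y₁.inv ≫ (σ.e 1 le_rfl).hom) (by
      have h₁ := ρ.comm_last
      have h₂ := σ.comm_last
      have h₃ : g ≫ y₂.inv = y₁.inv ≫ Y.d 1 le_rfl := by
        rw [Iso.comp_inv_eq, Category.assoc, hy, Iso.inv_hom_id_assoc]
      simp only [Category.assoc]
      rw [hc, ← h₂, ← cancel_epi (ρ.e 1 le_rfl).hom, ← reassoc_of% h₁, Iso.hom_inv_id_assoc,
        reassoc_of% hw, Iso.hom_inv_id_assoc, reassoc_of% h₃])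
  obtain ⟨N', hN', ⟨K'⟩⟩ := h.exists_angleCone le_rfl hW' hY' hM' ψ c ψ₀ K'
  -- Both triangles have the same second morphism.
  obtain ⟨fst, snd, b⟩ := K.biproduct 0 le_rfl
  obtain ⟨fst', snd', b'⟩ := K'.biproduct 0 le_rfl
  have i₁ := K.isIso_inl
  have i₂ := K.isIso_inr
  have i₁' := K'.isIso_inl
  have i₂' := K'.isIso_inr
  obtain ⟨e₁, he₁⟩ : ∃ e : N.obj 1 (by omega) ≅ N'.obj 1 (by omega), e.hom =
      fst ≫ a₁.hom ≫ (σ.e 0 (by omega)).hom ≫ K'.inr 0 (by omega) +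
      snd ≫ x₁.hom ≫ w₁.inv ≫ (ρ.e 1 le_rfl).hom ≫ K'.inl 1 le_rfl := by
    exact ⟨b.iso b'.symm (a₁ ≪≫ σ.e 0 (by omega)) (x₁ ≪≫ w₁.symm ≪≫ ρ.e 1 le_rfl), by simp⟩
  obtain ⟨e⟩ := h.nonempty_iso_of_iso' hN hN' e₁
    ((asIso (K.inr 1 le_rfl)).symm ≪≫ x₂ ≪≫ y₁.symm ≪≫ σ.e 1 le_rfl ≪≫
      asIso (K'.inr 1 le_rfl)) (by
    have φ₂ : φ.f 2 le_rfl = a₁.hom ≫ Y.d 0 (by omega) ≫ y₁.hom ≫ x₂.inv := φ₁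
    have ψ₂ : ψ.f 2 le_rfl = (ρ.e 1 le_rfl).inv ≫ w₁.hom ≫ f ≫ y₁.inv ≫ (σ.e 1 le_rfl).hom := ψ₁
    have hY'd : (σ.e 0 (by omega)).hom ≫ Y'.d 1 le_rfl = Y.d 0 (by omega) ≫ (σ.e 1 le_rfl).hom :=
      (σ.comm 0 le_rfl).symm
    have h₁ : K.inl 1 le_rfl ≫ N.d 1 le_rfl = φ.f 2 le_rfl ≫ K.inr 1 le_rfl := K.inl_d_last
    have h₁' : K'.inl 1 le_rfl ≫ N'.d 1 le_rfl = ψ.f 2 le_rfl ≫ K'.inr 1 le_rfl := K'.inl_d_last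
    have h₂ : K.inr 0 (by omega) ≫ N.d 1 le_rfl = X.d 1 le_rfl ≫ K.inr 1 le_rfl := K.inr_d 0 le_rfl
    have h₂' : K'.inr 0 (by omega) ≫ N'.d 1 le_rfl = Y'.d 1 le_rfl ≫ K'.inr 1 le_rfl :=
      K'.inr_d 0 le_rfl
    rw [he₁]
    apply b.hom_ext
    · simp only [Iso.trans_hom, Iso.symm_hom, asIso_hom, asIso_inv, Preadditive.add_comp,
        Preadditive.comp_add, Category.assoc, reassoc_of% b.inl_fst, reassoc_of% b.inl_snd,
        zero_comp, add_zero]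
      rw [h₂', reassoc_of% hY'd, reassoc_of% h₁, φ₂]
      simp
    · simp only [Iso.trans_hom, Iso.symm_hom, asIso_hom, asIso_inv, Preadditive.add_comp,
        Preadditive.comp_add, Category.assoc, reassoc_of% b.inr_fst, reassoc_of% b.inr_snd,
        zero_comp, zero_add]
      rw [h₁', ψ₂, reassoc_of% h₂, IsIso.hom_inv_id_assoc, reassoc_of% hx]
      simp)
  have hW₀ : P (W.obj 0 (Nat.zero_le _)) := hP.iso (asIso (K.inl 0 (Nat.zero_le _)) ≪≫ e ≪≫
    (asIso (K'.inl 0 (Nat.zero_le _))).symm ≪≫ (ρ.e 0 (Nat.zero_le _)).symm) (hEP 1 _)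
  refine ⟨W, hW, fun i hi => ?_, w₁, w₂, hw⟩
  match i, hi with
  | 0, _ => exact hW₀
  | 1, _ => exact hP.iso (x₁ ≪≫ w₁.symm) (hXP 1 _)
  | 2, _ => exact hP.iso (y₂ ≪≫ w₂.symm) (hYP 2 _)

end IsAngulated

end Triangulated

/-! ### The induced structure on the subcategory -/

section Subcategory

variable {D : Type u} [Category.{v} D] [Preadditive D] {S : D ⥤ D} {n : ℕ}
  {P : ObjectProperty D} {pent : Set (SuspSeq S n)} [HasFiniteBiproducts D]

open ZeroObject in
theorem IsAdditiveSubcategory.hasFiniteBiproducts (hP : IsAdditiveSubcategory P) :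
    HasFiniteBiproducts P.FullSubcategory := by
  have := hasBinaryBiproducts_of_finite_biproducts D
  have h₀ : IsZero (⟨0, hP.zero (isZero_zero D)⟩ : P.FullSubcategory) := by
    rw [IsZero.iff_id_eq_zero]
    exact ObjectProperty.hom_ext _ ((isZero_zero D).eq_of_src _ _)
  have : HasZeroObject P.FullSubcategory := ⟨⟨_, h₀⟩⟩
  have : HasBinaryBiproducts P.FullSubcategory := ⟨fun X Y => by
    have b := isBiproduct_biprod X.obj Y.obj
    exact hasBinaryBiproduct_of_total
      { pt := ⟨X.obj ⊞ Y.obj, hP.biprod _ _ _ _ b X.property Y.property⟩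
        inl := ObjectProperty.homMk biprod.inl
        inr := ObjectProperty.homMk biprod.inr
        fst := ObjectProperty.homMk biprod.fst
        snd := ObjectProperty.homMk biprod.snd
        inl_fst := ObjectProperty.hom_ext _ b.inl_fst
        inl_snd := ObjectProperty.hom_ext _ b.inl_snd
        inr_fst := ObjectProperty.hom_ext _ b.inr_fst
        inr_snd := ObjectProperty.hom_ext _ b.inr_snd } (ObjectProperty.hom_ext _ b.total)⟩
  have := hasFiniteProducts_of_has_binary_and_terminal (C := P.FullSubcategory)
  exact HasFiniteBiproducts.of_hasFiniteProducts

namespace IsAngulated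

open SuspSeq

variable [S.IsEquivalence] [S.Additive] (h : IsAngulated n S pent) (hn : 1 ≤ n)
include h hn

theorem isInflation_iff {A B : P.FullSubcategory} (f : A ⟶ B) :
    IsInflation (inducedRealization pent P) f ↔ IsAngleInflation pent P f.hom := by
  constructor
  · rintro ⟨C, δ, X, e, hX, he⟩
    refine ⟨_, (h.inducedRealization_iff hn δ X).1 hX, fun i hi => (X.obj i hi).property,
      P.ι.mapIso X.left, P.ι.mapIso e, ?_⟩
    have : X.d 0 (Nat.zero_le _) ≫ e.hom = X.left.hom ≫ f := by
      rw [← he, Cplx.dFirst]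
      simp
    exact congrArg InducedCategory.Hom.hom this
  · rintro ⟨X, hX, hXP, e₀, e₁, he⟩
    refine ⟨⟨X.obj (n + 1) le_rfl, hXP _ _⟩, X.δ ≫ S.map e₀.hom,
      X.toCplx (h.isPeriodicComplex hn hX).d_d hXP e₀ (Iso.refl _), P.isoMk e₁, ?_, ?_⟩
    · refine (h.inducedRealization_iff hn _ _).2 ?_
      rw [toSuspSeq_toCplx]
      · exact hX
      · exact (Category.id_comp _).symm
    · apply ObjectProperty.hom_ext
      change (e₀.inv ≫ X.d 0 _) ≫ e₁.hom = f.hom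
      rw [Category.assoc, he, Iso.inv_hom_id_assoc]

theorem isDeflation_iff {A B : P.FullSubcategory} (f : A ⟶ B) :
    IsDeflation (inducedRealization pent P) f ↔ IsAngleDeflation pent P f.hom := by
  constructor
  · rintro ⟨C, δ, X, e, hX, he⟩
    refine ⟨_, (h.inducedRealization_iff hn δ X).1 hX, fun i hi => (X.obj i hi).property,
      P.ι.mapIso e, P.ι.mapIso X.right, ?_⟩
    have : X.d n le_rfl ≫ X.right.hom = e.hom ≫ f := by
      rw [← he, Cplx.dLast]
      simp
    exact congrArg InducedCategory.Hom.hom this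
  · rintro ⟨X, hX, hXP, e₀, e₁, he⟩
    refine ⟨⟨X.obj 0 (Nat.zero_le _), hXP _ _⟩, e₁.inv ≫ X.δ,
      X.toCplx (h.isPeriodicComplex hn hX).d_d hXP (Iso.refl _) e₁, P.isoMk e₀, ?_, ?_⟩
    · refine (h.inducedRealization_iff hn _ _).2 ?_
      rw [toSuspSeq_toCplx]
      · exact hX
      · rw [Iso.hom_inv_id_assoc, Iso.refl_hom]
        exact (congrArg (X.δ ≫ ·) (S.map_id _)).trans (Category.comp_id _)
    · apply ObjectProperty.hom_ext
      change e₀.inv ≫ X.d n _ ≫ e₁.hom = f.hom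
      rw [he, Iso.inv_hom_id_assoc]

variable (hext : IsNExtensionClosed pent P)
include hext

theorem isExactRealization : IsExactRealization (restrictedHomSusp S P)
    (inducedRealization pent P) where
  isClass A C δ := by
    obtain ⟨X, hX, hXP, e₀, e₁, he⟩ := hext A.property C.property δ
    let X' : Cplx n A C := X.toCplx (h.isPeriodicComplex hn hX).d_d hXP e₀ e₁
    have hX' : toSuspSeq X' δ ∈ pent := by
      rw [toSuspSeq_toCplx _ _ _ _ _ _ he]
      exact hX
    refine ⟨X', fun Y => (h.inducedRealization_iff hn δ Y).trans ⟨fun hY => ?_, fun hY => ?_⟩⟩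
    · exact h.homotopyEquivalent_of_mem hn hX' hY
    · exact h.mem_of_homotopyEquivalent hn hX' hY
  exists_lift A B C E δ ρ X Y hX hY a c hac := by
    obtain ⟨φ, hφ, -⟩ := h.exists_lift_toSuspSeq ((h.inducedRealization_iff hn δ X).1 hX)
      ((h.inducedRealization_iff hn ρ Y).1 hY) a c hac
    exact ⟨_, hφ⟩
  isExangle A C δ X hX := h.isExangle_of_mem hn ((h.inducedRealization_iff hn δ X).1 hX)
  triv_first A Z hZ X hX := (h.inducedRealization_iff hn _ X).2 (h.mem_of_isTrivFirst hX _)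
  triv_last Z C hZ X hX := (h.inducedRealization_iff hn _ X).2 (h.mem_of_isTrivLast hX _)

variable (hP : IsAdditiveSubcategory P)
include hP

theorem isAngleInflation_comp {A B C : D} {f : A ⟶ B} {g : B ⟶ C}
    (hf : IsAngleInflation pent P f) (hg : IsAngleInflation pent P g) :
    IsAngleInflation pent P (f ≫ g) := by
  rcases hn.eq_or_lt with rfl | hn'
  · exact h.isAngleInflation_comp_of_triangulated hP hext hf hg
  · obtain ⟨hC, T, z, hz⟩ := h.exists_isAngleInflation_comp_comp hP hext hn hf hg
    exact h.isAngleInflation_of_comp hP hext hn' _ z hC hz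

theorem isAngleDeflation_comp {A B C : D} {f : A ⟶ B} {g : B ⟶ C}
    (hf : IsAngleDeflation pent P f) (hg : IsAngleDeflation pent P g) :
    IsAngleDeflation pent P (f ≫ g) := by
  rcases hn.eq_or_lt with rfl | hn'
  · exact h.isAngleDeflation_comp_of_triangulated hP hext hf hg
  · obtain ⟨hA, T, z, hz⟩ := h.exists_isAngleDeflation_comp_comp hP hext hn hf hg
    exact h.isAngleDeflation_of_comp hP hext hn' z _ hA hz

theorem isNExangulated :
    IsNExangulated n (restrictedHomSusp S P) (inducedRealization pent P) where
  additive := hP.hasFiniteBiproducts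
  biadditive_left := ⟨fun {C C'} {c c'} => by
    ext A δ
    exact Preadditive.add_comp _ _ _ c.unop.hom c'.unop.hom δ⟩
  biadditive_right C := ⟨fun {A B} {a b} => by
    ext δ
    let δ' : C.unop.obj ⟶ S.obj A.obj := δ
    exact (congrArg (δ' ≫ ·) S.map_add).trans (Preadditive.comp_add _ _ _ δ' _ _)⟩
  exactRealization := h.isExactRealization hn hext
  inflation_comp X Y Z f g hf hg := (h.isInflation_iff hn _).2
    (h.isAngleInflation_comp hn hext hP ((h.isInflation_iff hn f).1 hf)
      ((h.isInflation_iff hn g).1 hg))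
  deflation_comp X Y Z f g hf hg := (h.isDeflation_iff hn _).2
    (h.isAngleDeflation_comp hn hext hP ((h.isDeflation_iff hn f).1 hf)
      ((h.isDeflation_iff hn g).1 hg))
  good_lift A C C' c ρ X Y hX hY := by
    obtain ⟨φ, hφ, M, hM, hM'⟩ := h.exists_coneData hn hP c ρ X Y
      ((h.inducedRealization_iff hn _ X).1 hX) ((h.inducedRealization_iff hn _ Y).1 hY)
    exact ⟨φ, hφ, M, hM, (h.inducedRealization_iff hn _ M).2 hM'⟩
  good_lift_op A B C a δ X Y hX hY := by
    obtain ⟨φ, hφ, N, hN, hN'⟩ := h.exists_coconeData hn hP a δ X Y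
      ((h.inducedRealization_iff hn _ X).1 hX) ((h.inducedRealization_iff hn _ Y).1 hY)
    exact ⟨φ, hφ, N, hN, (h.inducedRealization_iff hn _ N).2 hN'⟩

end IsAngulated

end Subcategory

end NExang

theorem corollary4p4 {D : Type u} [Category.{v} D] [Preadditive D] [HasFiniteBiproducts D]
    (n : ℕ) (hn : 1 ≤ n) (S : D ⥤ D) [S.Additive] [S.IsEquivalence]
    (pent : Set (NExang.SuspSeq S n)) (hpent : NExang.IsAngulated n S pent)
    (P : ObjectProperty D) (hP : NExang.IsAdditiveSubcategory P)
    (hext : NExang.IsNExtensionClosed pent P) :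
    NExang.IsNExangulated n (NExang.restrictedHomSusp S P)
      (NExang.inducedRealization pent P) :=
  hpent.isNExangulated hn hext hP
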